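/- **Setting.** Let $(X,d)$ be a finite metric space. A fractional state with $k$ servers is a vector $z\in[0,1]^X$ with $\sum_x z_x=k$; an integral state is a set of $k$ points of $X$ (identified with its indicator vector). A solution for a request sequence $r_1,r_2,\dots$ in $X$ is a sequence of states $z^0,z^1,\dots$ with $z^t_{r_t}=1$ for all $t\ge 1$; its cost up to time $T$ is the sum over $t\le T$ of the earthmover distances between $z^{t-1}$ and $z^{t}$. An online algorithm chooses $z^t$ as a function of $r_1,\dots,r_t$ (and, if randomized, of random choices). In the $(h,k)$-server problem an algorithm with $k$ servers is $\rho$-competitive if there is $C'$, independent of the requests, such that for all request sequences, all $T$ and all integral solutions with $h$ servers (with any initial state), the (expected) cost of the algorithm up to time $T$ is at most $\rho$ times the cost of that solution plus $C'$. $(X,d)$ is a tree metric if its points can be placed at vertices of a finite tree with positive edge lengths so that $d$ is the path distance; $D$ is the hop-diameter of the tree. It is induced by a $\tau$-HST, $\tau>1$, if moreover the tree is rooted, the points are exactly its leaves, and consecutive edge lengths decrease by a factor of at least $\tau$ along every root-leaf path. **Theorem.** Let $\varepsilon>0$ and let $1\le h<k\le|X|$ be integers with $k/h=1+\varepsilon$.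 Write $L(\varepsilon)=\log(2+1/\varepsilon)$, which is $\Theta(\log(1/\varepsilon))$ for $\varepsilon\le 1/2$. 1. There is an absolute constant $C$ such that, if $(X,d)$ is a tree metric on a tree of hop-diameter $D$, then for every initial state $A_0\subseteq X$ with $|A_0|=k$ there is a deterministic online algorithm that starts at $A_0$, outputs a fractional solution with $k$ servers, and is $C\,D\,L(\varepsilon)$-competitive for the $(h,k)$-server problem. 2. For every $\tau>1$ there is a constant $C=C(\tau)$ such that, if $(X,d)$ is induced by a $\tau$-HST of hop-diameter $D$, then for every initial state $A_0$ as above there is such a deterministic fractional algorithm that is $C\min\{D,\log k\}\,L(\varepsilon)$-competitive. Moreover it can be rounded: there is a randomized online algorithm with $k$ servers that starts at $A_0$, maintains integral states, has on every request sequence (fixed in advance) expected cost at most $C$ times the cost of the fractional algorithm, and is $C\min\{D,\log k\}\,L(\varepsilon)$-competitive as well. In both parts the additive term $C'$ depends on the instance (the tree with the placement of $X$, $h$ and $k$) only, and not on $A_0$ or the requests. -/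

import Mathlib

/-! ## Earthmover distance on a finite metric space -/

/-- A transport plan between two mass distributions on a finite set. -/
def IsTransportPlan {X : Type*} [Fintype X] (z z' : X → ℝ) (π : X → X → ℝ) : Prop :=
  (∀ x y, 0 ≤ π x y) ∧ (∀ x, ∑ y, π x y = z x) ∧ (∀ y, ∑ x, π x y = z' y)

/-- The earthmover distance between two nonnegative mass distributions of equal total mass. -/
noncomputable def earthmover {X : Type*} [Fintype X] [MetricSpace X] (z z' : X → ℝ) : ℝ :=
  sInf {c : ℝ | ∃ π : X → X → ℝ, IsTransportPlan z z' π ∧ c = ∑ x, ∑ y, π x y * dist x y}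

/-- The mass distribution of a set of servers: one unit of mass at each of its points. -/
def serverMass {X : Type*} [DecidableEq X] (A : Finset X) (x : X) : ℝ :=
  if x ∈ A then 1 else 0

/-! ## Online algorithms and offline solutions for the server problem

A request sequence is `r : ℕ → X`; the request `r t` has to be served in the state at time `t + 1`,
and the state at time `0` is the initial one. -/

/-- The first `t` requests, in chronological order. -/
def requestHistory {X : Type*} (r : ℕ → X) (t : ℕ) : List X :=
  (List.range t).map r

/-- The total movement cost of a sequence of states during the first `T` steps. -/
noncomputable def movementCost {X : Type*} [Fintype X] [MetricSpace X]
    (s : ℕ → X → ℝ) (T : ℕ) : ℝ :=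
  ∑ t ∈ Finset.range T, earthmover (s t) (s (t + 1))

/-- An offline integral solution with `h` servers for the first `T` requests of `r`.
Its initial state `B 0` is arbitrary. -/
def IsOfflineSolution {X : Type*} (h : ℕ) (r : ℕ → X) (T : ℕ) (B : ℕ → Finset X) : Prop :=
  (∀ t, (B t).card = h) ∧ ∀ t < T, r t ∈ B (t + 1)

/-- A deterministic online algorithm that maintains a fractional solution with `k` servers: its
state is a function of the requests seen so far. -/
structure FractionalAlgorithm (X : Type*) [Fintype X] (k : ℕ) where
  /-- the state after a finite history of requests -/
  state : List X → X → ℝ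
  nonneg : ∀ l x, 0 ≤ state l x
  le_one : ∀ l x, state l x ≤ 1
  total : ∀ l, ∑ x, state l x = k
  serves : ∀ l r, state (l ++ [r]) r = 1

/-- The algorithm starts with one server at each point of `A`. -/
def FractionalAlgorithm.StartsAt {X : Type*} [Fintype X] [DecidableEq X] {k : ℕ}
    (Z : FractionalAlgorithm X k) (A : Finset X) : Prop :=
  Z.state [] = serverMass A

/-- The cost of the algorithm on the first `T` requests of `r`. -/
noncomputable def FractionalAlgorithm.cost {X : Type*} [Fintype X] [MetricSpace X] {k : ℕ}
    (Z : FractionalAlgorithm X k) (r : ℕ → X) (T : ℕ) : ℝ :=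
  movementCost (fun t => Z.state (requestHistory r t)) T

/-- The algorithm has cost at most `ρ` times the cost of any solution with `h` servers, up to the
additive term `c`. -/
def FractionalAlgorithm.IsCompetitive {X : Type*} [Fintype X] [DecidableEq X] [MetricSpace X]
    {k : ℕ} (Z : FractionalAlgorithm X k) (h : ℕ) (ρ c : ℝ) : Prop :=
  ∀ (r : ℕ → X) (T : ℕ) (B : ℕ → Finset X), IsOfflineSolution h r T B →
    Z.cost r T ≤ ρ * movementCost (fun t => serverMass (B t)) T + c

/-- A randomized online algorithm with `k` servers: a random choice of a deterministic online
algorithm that maintains a set of `k` points. -/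
structure RandomizedAlgorithm (X : Type*) (k : ℕ) where
  /-- the sample space of the random choices -/
  Ω : Type
  mΩ : MeasurableSpace Ω
  /-- the law of the random choices -/
  μ : @MeasureTheory.Measure Ω mΩ
  isProb : MeasureTheory.IsProbabilityMeasure μ
  /-- the state after a finite history of requests, given the random choices -/
  state : Ω → List X → Finset X
  measurable_state : ∀ l S, MeasurableSet {ω | state ω l = S}
  card_state : ∀ ω l, (state ω l).card = k
  serves : ∀ ω l r, r ∈ state ω (l ++ [r])

/-- The algorithm starts with one server at each point of `A`. -/
def RandomizedAlgorithm.StartsAt {X : Type*} {k : ℕ}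
    (R : RandomizedAlgorithm X k) (A : Finset X) : Prop :=
  ∀ ω, R.state ω [] = A

/-- The expected cost of the algorithm on the first `T` requests of `r`. -/
noncomputable def RandomizedAlgorithm.expectedCost {X : Type*} [Fintype X] [DecidableEq X]
    [MetricSpace X] {k : ℕ} (R : RandomizedAlgorithm X k) (r : ℕ → X) (T : ℕ) : ℝ :=
  @MeasureTheory.integral R.Ω ℝ _ _ R.mΩ R.μ
    (fun ω => movementCost (fun t => serverMass (R.state ω (requestHistory r t))) T)

/-- The algorithm has expected cost at most `ρ` times the cost of any solution with `h` servers,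
up to the additive term `c`, on every request sequence (fixed in advance). -/
def RandomizedAlgorithm.IsCompetitive {X : Type*} [Fintype X] [DecidableEq X] [MetricSpace X]
    {k : ℕ} (R : RandomizedAlgorithm X k) (h : ℕ) (ρ c : ℝ) : Prop :=
  ∀ (r : ℕ → X) (T : ℕ) (B : ℕ → Finset X), IsOfflineSolution h r T B →
    R.expectedCost r T ≤ ρ * movementCost (fun t => serverMass (B t)) T + c

/-! ## Tree metrics and HSTs -/

/-- A tree with positive edge lengths. -/
structure WeightedTree (V : Type*) where
  graph : SimpleGraph V
  isTree : graph.IsTree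
  /-- the length of an edge -/
  len : Sym2 V → ℝ
  len_pos : ∀ e ∈ graph.edgeSet, 0 < len e

/-- The metric of `X` is the path metric of the tree, the point `x` being located at the
vertex `φ x`. -/
def WeightedTree.Realizes {V X : Type*} [MetricSpace X] (T : WeightedTree V) (φ : X → V) : Prop :=
  ∀ (x y : X) (p : T.graph.Walk (φ x) (φ y)), p.IsPath → dist x y = (p.edges.map T.len).sum

/-- The vertex `v` is a child of `u` when the tree is rooted at `root`. -/
def WeightedTree.IsChild {V : Type*} (T : WeightedTree V) (root u v : V) : Prop :=
  T.graph.Adj u v ∧ T.graph.dist root v = T.graph.dist root u + 1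

/-- The leaves of the tree rooted at `root`. -/
def WeightedTree.leaves {V : Type*} (T : WeightedTree V) (root : V) : Set V :=
  {u | ∀ v, ¬ T.IsChild root u v}

/-- The tree rooted at `root` is a `τ`-HST: along every path that leads away from the root,
consecutive edge lengths decrease by a factor of at least `τ`. -/
def WeightedTree.IsHST {V : Type*} (T : WeightedTree V) (root : V) (τ : ℝ) : Prop :=
  ∀ u v w, T.IsChild root u v → T.IsChild root v w → τ * T.len s(v, w) ≤ T.len s(u, v)

/-! The metric is first replaced by a weighted hierarchy of clusters (`Hierarchy`) whose tree
distance agrees with it up to a constant. Choose κ with h ≤ κ < k ≤ 2κ and put τ = 1 - κ/k. The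
algorithm maintains a point of a covering polytope (`Hierarchy.IsFeasible`) that describes a
fractional solution with κ servers through its missing mass, and a request only asks for missing
mass at most τ at its leaf, not for 0. Multiplying the server mass by k/κ = 1/(1 - τ) gives a state
with k servers that serves the request. Resource augmentation thus appears as slack: an offline
solution with at most κ servers has missing mass 0 where the algorithm needs only τ.

On each request the point is projected onto the admissible part of the polytope in the Bregman
divergence of the entropy shifted by τ. Testing first-order optimality of the projection in suitable
directions yields everything. Truncation, exchange and raising or lowering one coordinate show that
values stay at most 1, remain sorted by rank, and that the missing mass of a cluster equals that of
its children (`Hierarchy.IsProjection.isState`); moreover only the requested leaf gains server mass,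
so all mass flows to one sink. The direction u + τ on the deeper levels, corrected by twice the
vector towards the offline solution, shows that the mass entering clusters of a given level is paid
for by the drop of the divergence from the offline solution, up to a telescoping term
(`Hierarchy.IsProjection.inflow_le`). A unit of offline movement raises this divergence by O(log(1 +
1/τ)), and this is O(L(ε)) by `exists_comparison`.

Summing over levels loses the height of the hierarchy, which is D + 1 for a tree. If weights depend
on the level only and decay geometrically, the telescoping term vanishes by conservation of mass.
The potential `Hierarchy.lightPot` then charges the inflow of all levels to the O(log k) levels
where the mass is halved on the way down to the request. The metric of an HST is equivalent to such
a hierarchy: its clusters are the components formed by the edges below geometrically decreasing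
thresholds.

For the rounding, a distribution on k-sets is kept whose number of servers in every cluster is the
floor or the ceiling of the fractional mass, with the correct mean (`Hierarchy.IsBalanced`). The
next distribution comes from a coupling that minimizes expected movement plus penalties for
violating these conditions. Exchange arguments, level by level from the root, show that a minimizer
violates none of them, while the diagonal coupling shows that the minimum is O(fractional movement).
Couplings are realized online by subdividing events in the unit interval. -/

set_option linter.unusedSectionVars false

section

open Finset

/-! ### Elementary bounds for the earthmover distance -/

theorem earthmover_nonneg {X : Type*} [Fintype X] [MetricSpace X] (z z' : X → ℝ) :
    0 ≤ earthmover z z' := by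
  refine Real.sInf_nonneg ?_
  rintro c ⟨π, hπ, rfl⟩
  exact sum_nonneg fun x _ => sum_nonneg fun y _ => mul_nonneg (hπ.1 x y) dist_nonneg

theorem earthmover_le {X : Type*} [Fintype X] [MetricSpace X] {z z' : X → ℝ} {π : X → X → ℝ}
    (hπ : IsTransportPlan z z' π) : earthmover z z' ≤ ∑ x, ∑ y, π x y * dist x y := by
  refine csInf_le ⟨0, ?_⟩ ⟨π, hπ, rfl⟩
  rintro c ⟨π, hπ, rfl⟩
  exact sum_nonneg fun x _ => sum_nonneg fun y _ => mul_nonneg (hπ.1 x y) dist_nonneg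

/-- Existence of a plan cannot be dropped: the infimum of the empty set is 0 in `ℝ`. -/
theorem le_earthmover {X : Type*} [Fintype X] [MetricSpace X] {z z' : X → ℝ} {c : ℝ}
    (hne : ∃ π, IsTransportPlan z z' π)
    (h : ∀ π, IsTransportPlan z z' π → c ≤ ∑ x, ∑ y, π x y * dist x y) : c ≤ earthmover z z' := by
  obtain ⟨π, hπ⟩ := hne
  refine le_csInf ⟨_, π, hπ, rfl⟩ ?_
  rintro _ ⟨π, hπ, rfl⟩
  exact h π hπ

/-- The product plan. -/
theorem exists_transportPlan {X : Type*} [Fintype X] {z z' : X → ℝ} {k : ℝ} (hk : 0 < k)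
    (hz : ∀ x, 0 ≤ z x) (hz' : ∀ x, 0 ≤ z' x) (hs : ∑ x, z x = k) (hs' : ∑ x, z' x = k) :
    ∃ π, IsTransportPlan z z' π := by
  refine ⟨fun x y => z x * z' y / k, fun x y => div_nonneg (mul_nonneg (hz x) (hz' y)) hk.le,
    fun x => ?_, fun y => ?_⟩
  · rw [← sum_div, ← mul_sum, hs', mul_div_assoc, div_self hk.ne', mul_one]
  · rw [← sum_div, ← sum_mul, hs, mul_comm, mul_div_assoc, div_self hk.ne', mul_one]

theorem earthmover_le_mul {X : Type*} [Fintype X] [MetricSpace X] {z z' : X → ℝ} {k b : ℝ}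
    (hk : 0 < k) (hz : ∀ x, 0 ≤ z x) (hz' : ∀ x, 0 ≤ z' x) (hs : ∑ x, z x = k)
    (hs' : ∑ x, z' x = k) (hb : ∀ x y : X, dist x y ≤ b) : earthmover z z' ≤ k * b := by
  obtain ⟨π, hπ⟩ := exists_transportPlan hk hz hz' hs hs'
  refine (earthmover_le hπ).trans ?_
  calc ∑ x, ∑ y, π x y * dist x y ≤ ∑ x, ∑ y, π x y * b :=
        sum_le_sum fun x _ => sum_le_sum fun y _ => mul_le_mul_of_nonneg_left (hb x y) (hπ.1 x y)
    _ = k * b := by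
        rw [← hs, sum_mul]
        exact sum_congr rfl fun x _ => by rw [← sum_mul, hπ.2.1]

/-- If only the point `r` gains mass, all the mass moves to `r`. -/
theorem earthmover_le_of_single_sink {X : Type*} [Fintype X] [MetricSpace X] {z z' : X → ℝ} (r : X)
    (hz : ∀ x, 0 ≤ z x) (hz' : ∀ x, 0 ≤ z' x) (hs : ∑ x, z x = ∑ x, z' x)
    (hle : ∀ x, x ≠ r → z' x ≤ z x) :
    earthmover z z' ≤ ∑ x, (z x - z' x) * dist x r := by
  classical
  have hplan : IsTransportPlan z z' (fun x y => if y = r then (if x = r then z r else z x - z' x)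
      else if y = x then z' x else 0) := by
    refine ⟨fun x y => ?_, fun x => ?_, fun y => ?_⟩
    · dsimp only
      split_ifs with h1 h2 h3
      · exact hz r
      · linarith [hle x h2]
      · exact hz' x
      · exact le_rfl
    · by_cases hx : x = r
      · subst hx
        rw [sum_eq_single x]
        · simp
        · intro b _ hb; simp [hb]
        · simp
      · rw [← add_sum_erase _ _ (mem_univ r), sum_eq_single x]
        · simp [hx]
        · intro b hb hbx
          simp [hbx, ne_of_mem_erase hb]
        · intro h; simp [hx] at h
    · by_cases hy : y = r
      · subst hy
        rw [← add_sum_erase _ _ (mem_univ y)]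
        have : ∑ x ∈ univ.erase y, (if y = y then (if x = y then z y else z x - z' x)
            else if y = x then z' x else 0) = ∑ x ∈ univ.erase y, (z x - z' x) :=
          sum_congr rfl fun x hx => by simp [ne_of_mem_erase hx]
        rw [this]
        have h1 := add_sum_erase univ z (mem_univ y)
        have h2 := add_sum_erase univ z' (mem_univ y)
        rw [sum_sub_distrib]
        simp only [if_true]
        linarith
      · simp [hy]
  refine (earthmover_le hplan).trans (le_of_eq ?_)
  refine sum_congr rfl fun x _ => ?_
  rw [sum_eq_single r]
  · by_cases hx : x = r
    · simp [hx]
    · simp [hx]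
  · intro y _ hy
    by_cases hyx : y = x
    · simp [hyx]
    · simp [hy, hyx]
  · simp

theorem serverMass_nonneg {X : Type*} [DecidableEq X] (A : Finset X) (x : X) :
    0 ≤ serverMass A x := by
  unfold serverMass; split_ifs <;> norm_num

theorem serverMass_le_one {X : Type*} [DecidableEq X] (A : Finset X) (x : X) :
    serverMass A x ≤ 1 := by
  unfold serverMass; split_ifs <;> norm_num

theorem sum_serverMass {X : Type*} [DecidableEq X] (A S : Finset X) :
    ∑ x ∈ S, serverMass A x = ((A ∩ S).card : ℝ) := by
  unfold serverMass
  rw [sum_ite_mem, sum_const, nsmul_eq_mul, mul_one, inter_comm]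

theorem sum_univ_serverMass {X : Type*} [DecidableEq X] [Fintype X] (A : Finset X) :
    ∑ x, serverMass A x = (A.card : ℝ) := by
  rw [sum_serverMass, inter_univ]

theorem earthmover_self {X : Type*} [Fintype X] [MetricSpace X] {z : X → ℝ}
    (hz : ∀ x, 0 ≤ z x) : earthmover z z = 0 := by
  refine le_antisymm ?_ (earthmover_nonneg _ _)
  cases isEmpty_or_nonempty X
  · refine (earthmover_le (π := fun _ _ => 0) ⟨fun x => isEmptyElim x, fun x => isEmptyElim x,
      fun x => isEmptyElim x⟩).trans (by simp)
  · refine (earthmover_le_of_single_sink (Classical.arbitrary X) hz hz rfl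
      fun _ _ => le_rfl).trans ?_
    simp

/-- Moving one server from `a` to `b` costs at most `dist a b`. -/
theorem earthmover_move {X : Type*} [Fintype X] [DecidableEq X] [MetricSpace X] {A B : Finset X}
    (hAB : A.card = B.card) (hA : 0 < A.card)
    {a b : X} (ha : a ∈ B) (hb : b ∉ B) :
    earthmover (serverMass A) (serverMass (insert b (B.erase a))) ≤
      earthmover (serverMass A) (serverMass B) + dist a b := by
  have hab : a ≠ b := fun h => hb (h ▸ ha)
  rw [← sub_le_iff_le_add]
  refine le_earthmover (exists_transportPlan (k := A.card) (by exact_mod_cast hA)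
    (serverMass_nonneg A) (serverMass_nonneg B) (sum_univ_serverMass A)
    (by rw [sum_univ_serverMass, hAB])) fun π hπ => ?_
  -- Column `b` of the plan is empty, so the mass that arrived at `a` can be redirected there
  -- without collision.
  have hcol : ∀ x, π x b = 0 := by
    have h0 : ∑ x, π x b = 0 := by rw [hπ.2.2 b]; simp [serverMass, hb]
    intro x
    exact (sum_eq_zero_iff_of_nonneg fun x _ => hπ.1 x b).1 h0 x (mem_univ x)
  have hsplit : ∀ f : X → ℝ, ∑ y, f y = f a + (f b + ∑ y ∈ (univ.erase a).erase b, f y) :=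
    fun f => by
      rw [add_sum_erase _ _ (mem_erase.2 ⟨hab.symm, mem_univ b⟩), add_sum_erase _ _ (mem_univ a)]
  have hrest : ∀ y ∈ (univ.erase a).erase b, y ≠ a ∧ y ≠ b := fun y hy =>
    ⟨ne_of_mem_erase (mem_of_mem_erase hy), ne_of_mem_erase hy⟩
  have hplan : IsTransportPlan (serverMass A) (serverMass (insert b (B.erase a)))
      (fun x y => if y = a then 0 else if y = b then π x a else π x y) := by
    refine ⟨fun x y => ?_, fun x => ?_, fun y => ?_⟩
    · dsimp only; split_ifs <;> first | exact le_rfl | exact hπ.1 _ _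
    · dsimp only
      rw [← hπ.2.1 x, hsplit, hsplit (π x), hcol x, if_pos rfl, if_neg hab.symm, if_pos rfl,
        sum_congr rfl fun y hy => by rw [if_neg (hrest y hy).1, if_neg (hrest y hy).2]]
      ring
    · by_cases hya : y = a
      · subst hya; simp [serverMass, hab]
      · by_cases hyb : y = b
        · subst hyb; simp [hya, hπ.2.2, serverMass, ha]
        · simp [hya, hyb, hπ.2.2, serverMass]
  rw [sub_le_iff_le_add]
  refine (earthmover_le hplan).trans ?_
  have hrow : ∀ x, ∑ y, (if y = a then 0 else if y = b then π x a else π x y) * dist x y ≤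
      ∑ y, π x y * dist x y + π x a * dist a b := fun x => by
    rw [hsplit, hsplit fun y => π x y * dist x y, hcol x, if_pos rfl, if_neg hab.symm, if_pos rfl,
      sum_congr rfl fun y hy => by rw [if_neg (hrest y hy).1, if_neg (hrest y hy).2]]
    have := mul_le_mul_of_nonneg_left (dist_triangle x a b) (hπ.1 x a)
    linarith
  refine (sum_le_sum fun x _ => hrow x).trans ?_
  rw [sum_add_distrib, ← sum_mul, hπ.2.2 a]
  simp [serverMass, ha]

/-- A weighted family of sets whose cut metric is dominated by the metric bounds the earthmover
distance from below. -/
theorem sum_cut_le_earthmover {X ι : Type*} [Fintype X] [DecidableEq X] [MetricSpace X]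
    (I : Finset ι) (S : ι → Finset X) (w : ι → ℝ) (hw : ∀ i ∈ I, 0 ≤ w i) {c : ℝ}
    (hcut : ∀ x y : X, ∑ i ∈ I, w i * |serverMass (S i) x - serverMass (S i) y| ≤ c * dist x y)
    (hc : 0 < c) {z z' : X → ℝ} {k : ℝ} (hk : 0 < k)
    (hz : ∀ x, 0 ≤ z x) (hz' : ∀ x, 0 ≤ z' x) (hs : ∑ x, z x = k) (hs' : ∑ x, z' x = k) :
    ∑ i ∈ I, w i * |∑ x ∈ S i, z' x - ∑ x ∈ S i, z x| ≤ c * earthmover z z' := by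
  rw [← div_le_iff₀' hc]
  refine le_earthmover (exists_transportPlan hk hz hz' hs hs') fun π hπ => ?_
  rw [div_le_iff₀' hc]
  have hS : ∀ (T : Finset X) (f : X → ℝ), ∑ x ∈ T, f x = ∑ x, serverMass T x * f x := by
    intro T f
    simp [serverMass, sum_ite_mem]
  have hdiff : ∀ T : Finset X, ∑ x ∈ T, z' x - ∑ x ∈ T, z x =
      ∑ x, ∑ y, π x y * (serverMass T y - serverMass T x) := by
    intro T
    simp only [mul_sub, sum_sub_distrib]
    rw [hS, hS T z, sum_comm]
    congr 1
    · exact sum_congr rfl fun y _ => by rw [← sum_mul, hπ.2.2, mul_comm]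
    · exact sum_congr rfl fun x _ => by rw [← sum_mul, hπ.2.1, mul_comm]
  calc ∑ i ∈ I, w i * |∑ x ∈ S i, z' x - ∑ x ∈ S i, z x|
      ≤ ∑ i ∈ I, w i * ∑ x, ∑ y, π x y * |serverMass (S i) x - serverMass (S i) y| := by
        refine sum_le_sum fun i hi => mul_le_mul_of_nonneg_left ?_ (hw i hi)
        rw [hdiff]
        refine (abs_sum_le_sum_abs _ _).trans (sum_le_sum fun x _ =>
          (abs_sum_le_sum_abs _ _).trans (sum_le_sum fun y _ => ?_))
        rw [abs_mul, abs_of_nonneg (hπ.1 x y), abs_sub_comm]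
    _ = ∑ x, ∑ y, π x y * ∑ i ∈ I, w i * |serverMass (S i) x - serverMass (S i) y| := by
        simp only [mul_sum]
        rw [sum_comm]
        refine sum_congr rfl fun x _ => ?_
        rw [sum_comm]
        exact sum_congr rfl fun y _ => sum_congr rfl fun i _ => by ring
    _ ≤ ∑ x, ∑ y, π x y * (c * dist x y) :=
        sum_le_sum fun x _ => sum_le_sum fun y _ =>
          mul_le_mul_of_nonneg_left (hcut x y) (hπ.1 x y)
    _ = c * ∑ x, ∑ y, π x y * dist x y := by
        simp only [mul_sum]
        exact sum_congr rfl fun x _ => sum_congr rfl fun y _ => by ring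

/-! ## Hierarchical clusterings of uniform depth -/

/-- A laminar family of clusters with levels `0, …, height`; `node j x` is the cluster of `x` at
level `j`. -/
structure Hierarchy (X C : Type*) where
  height : ℕ
  node : ℕ → X → C
  parent : ℕ → C → C
  weight : ℕ → C → ℝ
  weight_pos : ∀ j a, 0 < weight j a
  parent_node : ∀ j x, parent j (node (j + 1) x) = node j x
  node_zero : ∀ x y, node 0 x = node 0 y
  node_height : Function.Injective (node height)

namespace Hierarchy

variable {X C : Type*} [Fintype X] [DecidableEq C] (G : Hierarchy X C)

/-- The weight of the cluster of `x` at level `j`. -/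
def wt (j : ℕ) (x : X) : ℝ := G.weight j (G.node j x)

omit [Fintype X] [DecidableEq C] in
theorem wt_pos (j : ℕ) (x : X) : 0 < G.wt j x := G.weight_pos _ _

/-- The points of the cluster `a` at level `j`. -/
def cl (j : ℕ) (a : C) : Finset X := univ.filter fun x => G.node j x = a

/-- The position of `x` in its cluster at level `j`, in a fixed order of the points. -/
noncomputable def rank (j : ℕ) (x : X) : ℕ :=
  ((G.cl j (G.node j x)).filter fun x' => Fintype.equivFin X x' < Fintype.equivFin X x).card

/-- The first `s` points of the cluster `a` at level `j`. -/
noncomputable def seg (j : ℕ) (a : C) (s : ℕ) : Finset X := (G.cl j a).filter fun x => G.rank j x < s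

variable {G}

theorem mem_cl {j : ℕ} {a : C} {x : X} : x ∈ G.cl j a ↔ G.node j x = a := by simp [cl]

theorem mem_seg {j : ℕ} {a : C} {s : ℕ} {x : X} :
    x ∈ G.seg j a s ↔ G.node j x = a ∧ G.rank j x < s := by simp [seg, mem_cl]

theorem seg_subset (j : ℕ) (a : C) (s : ℕ) : G.seg j a s ⊆ G.cl j a := filter_subset _ _

theorem seg_mono (j : ℕ) (a : C) {s t : ℕ} (h : s ≤ t) : G.seg j a s ⊆ G.seg j a t := fun x hx => by
  rw [mem_seg] at hx ⊢; exact ⟨hx.1, hx.2.trans_le h⟩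

theorem rank_lt_rank {j : ℕ} {x y : X} (h : G.node j x = G.node j y)
    (hxy : Fintype.equivFin X x < Fintype.equivFin X y) : G.rank j x < G.rank j y := by
  unfold rank
  rw [h]
  refine card_lt_card ?_
  rw [ssubset_iff_of_subset]
  · exact ⟨x, by simp [mem_cl, h, hxy], by simp⟩
  · intro z hz
    simp only [mem_filter] at hz ⊢
    exact ⟨hz.1, hz.2.trans hxy⟩

theorem rank_injOn (j : ℕ) (a : C) : Set.InjOn (G.rank j) (G.cl j a : Set X) := by
  intro x hx y hy h
  rw [mem_coe, mem_cl] at hx hy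
  by_contra hne
  rcases lt_or_gt_of_ne (fun h' => hne ((Fintype.equivFin X).injective h')) with hlt | hlt
  · exact absurd h (rank_lt_rank (hx.trans hy.symm) hlt).ne
  · exact absurd h (rank_lt_rank (hy.trans hx.symm) hlt).ne'

theorem rank_lt_card {j : ℕ} {a : C} {x : X} (hx : x ∈ G.cl j a) : G.rank j x < (G.cl j a).card := by
  rw [mem_cl] at hx
  subst hx
  refine card_lt_card ?_
  rw [ssubset_iff_of_subset (filter_subset _ _)]
  exact ⟨x, by simp [mem_cl], by simp⟩

theorem image_rank (j : ℕ) (a : C) : (G.cl j a).image (G.rank j) = range (G.cl j a).card := by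
  refine eq_of_subset_of_card_le (fun i hi => ?_) ?_
  · obtain ⟨x, hx, rfl⟩ := mem_image.1 hi
    exact mem_range.2 (rank_lt_card hx)
  · rw [card_range, card_image_of_injOn (rank_injOn j a)]

theorem card_filter_rank (j : ℕ) (a : C) (p : ℕ → Prop) [DecidablePred p] :
    ((G.cl j a).filter fun x => p (G.rank j x)).card = ((range (G.cl j a).card).filter p).card := by
  rw [← image_rank, filter_image, card_image_of_injOn]
  exact (rank_injOn j a).mono fun x hx => by simpa using (mem_filter.1 hx).1

theorem card_seg {j : ℕ} {a : C} {s : ℕ} (hs : s ≤ (G.cl j a).card) : (G.seg j a s).card = s := by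
  unfold seg
  rw [card_filter_rank j a fun i => i < s]
  have : (range (G.cl j a).card).filter (fun i => i < s) = range s := by
    ext i; simp only [mem_filter, mem_range]; omega
  rw [this, card_range]

theorem seg_zero (j : ℕ) (a : C) : G.seg j a 0 = ∅ := by
  ext x; simp [mem_seg]

theorem seg_card (j : ℕ) (a : C) : G.seg j a (G.cl j a).card = G.cl j a := by
  ext x
  rw [mem_seg, mem_cl]
  exact ⟨fun h => h.1, fun h => ⟨h, rank_lt_card (mem_cl.2 h)⟩⟩

omit [Fintype X] [DecidableEq C] in
theorem node_eq_of_le {i j : ℕ} (hij : i ≤ j) {x y : X} (h : G.node j x = G.node j y) :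
    G.node i x = G.node i y := by
  induction j, hij using Nat.le_induction with
  | base => exact h
  | succ j _ ih => exact ih (by rw [← G.parent_node, h, G.parent_node])

theorem cl_subset_cl {i j : ℕ} (hij : i ≤ j) (x : X) :
    G.cl j (G.node j x) ⊆ G.cl i (G.node i x) := fun y hy => by
  rw [mem_cl] at hy ⊢; exact node_eq_of_le hij hy

theorem cl_zero (x : X) : G.cl 0 (G.node 0 x) = univ := by
  ext y; simp [mem_cl, G.node_zero y x]

/-! ### Feasible states -/

variable (G) in
/-- The covering polytope: `y j x` is the missing mass of the server number `rank j x` in the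
cluster of `x` at level `j`. -/
structure IsFeasible (κ : ℕ) (y : ℕ → X → ℝ) : Prop where
  nonneg : ∀ j x, 0 ≤ y j x
  root : ∀ x, y 0 x = if G.rank 0 x < κ then 0 else 1
  above : ∀ j, G.height < j → ∀ x, y j x = 0
  cover : ∀ j < G.height, ∀ a, ∀ S ⊆ G.cl j a,
    ∑ x ∈ G.seg j a S.card, y j x ≤ ∑ x ∈ S, y (j + 1) x

variable (G) in
/-- The invariants of the algorithm. -/
structure IsState (κ : ℕ) (τ : ℝ) (y : ℕ → X → ℝ) : Prop extends G.IsFeasible κ y where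
  le_one : ∀ j x, y j x ≤ 1
  sorted : ∀ j x x', G.node j x = G.node j x' → G.rank j x < G.rank j x' → y j x ≤ y j x'
  conserve : ∀ j < G.height, ∀ a, ∑ x ∈ G.cl j a, y (j + 1) x = ∑ x ∈ G.cl j a, y j x
  leaf : ∀ x, τ ≤ y G.height x

variable (G) in
/-- The states among which the projection chooses after the request `r`. -/
def candidates (κ : ℕ) (τ : ℝ) (r : X) : Set (ℕ → X → ℝ) :=
  {q | G.IsFeasible κ q ∧ (∀ j x, q j x ≤ 2) ∧ q G.height r ≤ τ}

end Hierarchy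

/-! ### Bregman divergence and projection -/

/-- The Bregman divergence of the shifted negative entropy. -/
noncomputable def breg (δ u v : ℝ) : ℝ :=
  (u + δ) * Real.log (u + δ) - (u + δ) * Real.log (v + δ) - u + v

theorem breg_self (δ u : ℝ) : breg δ u u = 0 := by unfold breg; ring

/-- This is `log t ≤ t - 1` at the ratio of the shifted arguments. -/
theorem breg_nonneg {δ u v : ℝ} (hδ : 0 < δ) (hu : 0 ≤ u) (hv : 0 ≤ v) : 0 ≤ breg δ u v := by
  have hA : 0 < u + δ := by linarith
  have hB : 0 < v + δ := by linarith
  have := Real.log_le_sub_one_of_pos (div_pos hB hA)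
  rw [Real.log_div hB.ne' hA.ne'] at this
  have h2 := mul_le_mul_of_nonneg_left this hA.le
  have h3 : (u + δ) * ((v + δ) / (u + δ) - 1) = v - u := by field_simp; ring
  unfold breg
  linarith [mul_sub (u + δ) (Real.log (v + δ)) (Real.log (u + δ))]

theorem continuous_breg (δ v : ℝ) : Continuous fun u => breg δ u v := by
  unfold breg
  have : Continuous fun u : ℝ => (u + δ) * Real.log (u + δ) :=
    Real.continuous_mul_log.comp (continuous_id.add continuous_const)
  fun_prop

/-- Convexity of the divergence in its first argument. -/
theorem breg_sub_le {δ u u' v : ℝ} (hδ : 0 < δ) (hu : 0 ≤ u) (hu' : 0 ≤ u') :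
    breg δ u' v - breg δ u v ≤ (u' - u) * (Real.log (u' + δ) - Real.log (v + δ)) := by
  have := breg_nonneg hδ hu hu'
  unfold breg at *
  linarith

/-- The three-point identity. -/
theorem breg_three_point (δ q u v : ℝ) :
    (q - u) * (Real.log (u + δ) - Real.log (v + δ)) =
      breg δ q v - breg δ q u - breg δ u v := by
  unfold breg; ring

namespace Hierarchy

variable {X C : Type*} [Fintype X] [DecidableEq C] (G : Hierarchy X C)

/-- The total divergence of two states. -/
noncomputable def div (δ : ℝ) (u v : ℕ → X → ℝ) : ℝ :=
  ∑ j ∈ Icc 1 G.height, ∑ x, G.wt j x * breg δ (u j x) (v j x)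

/-- The directional derivative of the divergence. -/
noncomputable def slope (δ : ℝ) (u v d : ℕ → X → ℝ) : ℝ :=
  ∑ j ∈ Icc 1 G.height, ∑ x, G.wt j x * (d j x * (Real.log (u j x + δ) - Real.log (v j x + δ)))

variable {G}

omit [DecidableEq C] in
theorem div_nonneg {δ : ℝ} (hδ : 0 < δ) {u v : ℕ → X → ℝ} (hu : ∀ j x, 0 ≤ u j x)
    (hv : ∀ j x, 0 ≤ v j x) : 0 ≤ G.div δ u v :=
  sum_nonneg fun j _ => sum_nonneg fun x _ =>
    mul_nonneg (G.wt_pos j x).le (breg_nonneg hδ (hu j x) (hv j x))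

omit [DecidableEq C] in
theorem slope_sub (δ : ℝ) (q u v : ℕ → X → ℝ) :
    G.slope δ u v (fun j x => q j x - u j x) = G.div δ q v - G.div δ q u - G.div δ u v := by
  unfold slope div
  simp only [← sum_sub_distrib, ← mul_sub, breg_three_point]

omit [DecidableEq C] in
theorem slope_add_mul (δ : ℝ) (u v d e : ℕ → X → ℝ) (c : ℝ) :
    G.slope δ u v (fun j x => d j x + c * e j x) = G.slope δ u v d + c * G.slope δ u v e := by
  unfold slope
  simp only [mul_sum, ← sum_add_distrib]
  exact sum_congr rfl fun j _ => sum_congr rfl fun x _ => by ring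

variable (G) in
/-- `u` is a minimizer of the divergence from `v` among the candidates. -/
def IsProjection (κ : ℕ) (τ δ : ℝ) (r : X) (v u : ℕ → X → ℝ) : Prop :=
  u ∈ G.candidates κ τ r ∧ ∀ q ∈ G.candidates κ τ r, G.div δ u v ≤ G.div δ q v

/-- The candidates form a closed subset of a product of intervals [0, 2]. The cap 2 is there only
for compactness; since the minimizer turns out to be at most 1, the cap is never active in
first-order conditions. -/
theorem exists_isProjection {κ : ℕ} {τ δ : ℝ} {r : X} (v : ℕ → X → ℝ)
    (hne : (G.candidates κ τ r).Nonempty) : ∃ u, G.IsProjection κ τ δ r v u := by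
  have hcl : IsClosed (G.candidates κ τ r) := by
    have heq : G.candidates κ τ r = {q | ∀ j x, 0 ≤ q j x} ∩
        {q | ∀ x, q 0 x = if G.rank 0 x < κ then 0 else 1} ∩
        {q | ∀ j, G.height < j → ∀ x, q j x = 0} ∩
        {q | ∀ j < G.height, ∀ a, ∀ S ⊆ G.cl j a,
          ∑ x ∈ G.seg j a S.card, q j x ≤ ∑ x ∈ S, q (j + 1) x} ∩
        {q | ∀ j x, q j x ≤ 2} ∩ {q | q G.height r ≤ τ} := by
      ext q
      constructor
      · rintro ⟨⟨h1, h2, h3, h4⟩, h5, h6⟩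
        exact ⟨⟨⟨⟨⟨h1, h2⟩, h3⟩, h4⟩, h5⟩, h6⟩
      · rintro ⟨⟨⟨⟨⟨h1, h2⟩, h3⟩, h4⟩, h5⟩, h6⟩
        exact ⟨⟨h1, h2, h3, h4⟩, h5, h6⟩
    rw [heq]
    refine IsClosed.inter (IsClosed.inter (IsClosed.inter (IsClosed.inter (IsClosed.inter ?_ ?_)
      ?_) ?_) ?_) ?_
    · simp only [Set.ofPred_forall]
      exact isClosed_iInter fun j => isClosed_iInter fun x =>
        isClosed_le continuous_const (by fun_prop)
    · simp only [Set.ofPred_forall]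
      exact isClosed_iInter fun x => isClosed_eq (by fun_prop) continuous_const
    · simp only [Set.ofPred_forall]
      exact isClosed_iInter fun j => isClosed_iInter fun _ => isClosed_iInter fun x =>
        isClosed_eq (by fun_prop) continuous_const
    · simp only [Set.ofPred_forall]
      exact isClosed_iInter fun j => isClosed_iInter fun _ => isClosed_iInter fun a =>
        isClosed_iInter fun S => isClosed_iInter fun _ => isClosed_le (by fun_prop) (by fun_prop)
    · simp only [Set.ofPred_forall]
      exact isClosed_iInter fun j => isClosed_iInter fun x =>
        isClosed_le (by fun_prop) continuous_const
    · exact isClosed_le (by fun_prop) continuous_const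
  have hcomp : IsCompact (G.candidates κ τ r) := by
    refine (isCompact_univ_pi fun _ : ℕ => isCompact_univ_pi fun _ : X =>
      isCompact_Icc (a := (0 : ℝ)) (b := 2)).of_isClosed_subset hcl ?_
    rintro q ⟨h, h2, -⟩ j - x -
    exact ⟨h.nonneg j x, h2 j x⟩
  have hcont : Continuous fun q : ℕ → X → ℝ => G.div δ q v := by
    unfold div
    refine continuous_finsetSum _ fun j _ => continuous_finsetSum _ fun x _ =>
      continuous_const.mul ((continuous_breg δ (v j x)).comp (by fun_prop))
  obtain ⟨u, hu, hmin⟩ := hcomp.exists_isMinOn hne hcont.continuousOn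
  exact ⟨u, hu, fun q hq => hmin hq⟩

open Filter Topology in
/-- First-order optimality in a feasible direction. -/
theorem IsProjection.slope_nonneg {κ : ℕ} {τ δ : ℝ} {r : X} {v u : ℕ → X → ℝ}
    (h : G.IsProjection κ τ δ r v u) (hδ : 0 < δ) {d : ℕ → X → ℝ}
    (hd : ∀ᶠ t : ℝ in 𝓝[>] 0, (fun j x => u j x + t * d j x) ∈ G.candidates κ τ r) :
    0 ≤ G.slope δ u v d := by
  have hlim : Tendsto (fun t : ℝ => ∑ j ∈ Icc 1 G.height, ∑ x, G.wt j x *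
      (d j x * (Real.log (u j x + t * d j x + δ) - Real.log (v j x + δ)))) (𝓝[>] 0)
      (𝓝 (G.slope δ u v d)) := by
    unfold slope
    refine tendsto_finsetSum _ fun j _ => tendsto_finsetSum _ fun x _ =>
      (Tendsto.const_mul _ (Tendsto.const_mul _ (Tendsto.sub_const ?_ _)))
    have hpos : u j x + δ ≠ 0 := by have := h.1.1.nonneg j x; positivity
    refine (Real.continuousAt_log hpos).tendsto.comp ?_
    have : Tendsto (fun t : ℝ => u j x + t * d j x + δ) (𝓝 0) (𝓝 (u j x + 0 * d j x + δ)) :=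
      Continuous.tendsto (by fun_prop) 0
    rw [zero_mul, add_zero] at this
    exact this.mono_left nhdsWithin_le_nhds
  refine ge_of_tendsto hlim ?_
  filter_upwards [hd, self_mem_nhdsWithin] with t ht ht0
  have ht0 : (0 : ℝ) < t := ht0
  have h1 := h.2 _ ht
  have h2 : G.div δ (fun j x => u j x + t * d j x) v - G.div δ u v ≤
      t * ∑ j ∈ Icc 1 G.height, ∑ x, G.wt j x *
      (d j x * (Real.log (u j x + t * d j x + δ) - Real.log (v j x + δ))) := by
    unfold div
    rw [← sum_sub_distrib, mul_sum]
    refine sum_le_sum fun j _ => ?_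
    rw [← sum_sub_distrib, mul_sum]
    refine sum_le_sum fun x _ => ?_
    rw [← mul_sub]
    have := mul_le_mul_of_nonneg_left
      (breg_sub_le (v := v j x) hδ (h.1.1.nonneg j x) (ht.1.nonneg j x)) (G.wt_pos j x).le
    refine this.trans (le_of_eq (by ring))
  exact le_of_mul_le_mul_left (by linarith) ht0

end Hierarchy

open Filter Topology in
-- One linear constraint along a ray: slack survives short steps, and a tight constraint survives if
-- the direction does not decrease it.
theorem eventually_nonneg_add_mul {α β : ℝ} (h : 0 ≤ α) (h0 : α = 0 → 0 ≤ β) :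
    ∀ᶠ t : ℝ in 𝓝[>] 0, 0 ≤ α + t * β := by
  rcases h.eq_or_lt with h | h
  · filter_upwards [self_mem_nhdsWithin] with t ht
    rw [← h, zero_add]
    exact mul_nonneg (le_of_lt ht) (h0 h.symm)
  · have : Tendsto (fun t : ℝ => α + t * β) (𝓝 0) (𝓝 (α + 0 * β)) :=
      Continuous.tendsto (by fun_prop) 0
    rw [zero_mul, add_zero] at this
    exact ((this.mono_left nhdsWithin_le_nhds).eventually (lt_mem_nhds h)).mono fun t ht => ht.le

/-! ### The projection preserves the invariants -/

namespace Hierarchy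

variable {X C : Type*} [Fintype X] [DecidableEq X] [DecidableEq C] {G : Hierarchy X C}
  {κ : ℕ} {τ δ : ℝ} {r : X} {u v : ℕ → X → ℝ}

theorem card_le_card_cl {j : ℕ} {a : C} {S : Finset X} (hS : S ⊆ G.cl j a) :
    (G.seg j a S.card).card = S.card := card_seg (card_le_card hS)

/-- Truncation costs nothing in a cover constraint. Elements of `S` above 1 contribute exactly 1
each after truncation, which dominates as many terms on the left; the remaining ones satisfy the
original constraint. -/
theorem IsFeasible.min_one (h : G.IsFeasible κ u) :
    G.IsFeasible κ fun j x => min (u j x) 1 := by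
  refine ⟨fun j x => le_min (h.nonneg j x) zero_le_one, fun x => ?_, fun j hj x => ?_,
    fun j hj a S hS => ?_⟩
  · rw [h.root]; split_ifs <;> simp
  · rw [h.above j hj]; simp
  · set T := S.filter fun x => u (j + 1) x ≤ 1 with hT
    have hTS : T ⊆ S := filter_subset _ _
    have hsub := seg_mono (G := G) j a (card_le_card hTS)
    have hc1 := card_le_card_cl hS
    have hc2 := card_le_card_cl (hTS.trans hS)
    have h1 : ∑ x ∈ S, min (u (j + 1) x) 1 = ∑ x ∈ T, u (j + 1) x + ((S \ T).card : ℝ) := by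
      rw [← sum_sdiff hTS, add_comm]
      congr 1
      · exact sum_congr rfl fun x hx => min_eq_left (mem_filter.1 hx).2
      · rw [sum_congr rfl fun x hx => min_eq_right ?_, sum_const, nsmul_eq_mul, mul_one]
        rw [mem_sdiff, hT, mem_filter, not_and] at hx
        exact (not_le.1 (hx.2 hx.1)).le
    rw [h1, ← sum_sdiff hsub, add_comm]
    refine add_le_add ((sum_le_sum fun x _ => min_le_left _ _).trans
      (h.cover j hj a T (hTS.trans hS))) ((sum_le_sum fun x _ => min_le_right _ _).trans ?_)
    rw [sum_const, nsmul_eq_mul, mul_one, card_sdiff_of_subset hsub, card_sdiff_of_subset hTS,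
      hc1, hc2]

theorem candidates_convex {p q : ℕ → X → ℝ} (hp : p ∈ G.candidates κ τ r)
    (hq : q ∈ G.candidates κ τ r) {t : ℝ} (h0 : 0 ≤ t) (h1 : t ≤ 1) :
    (fun j x => p j x + t * (q j x - p j x)) ∈ G.candidates κ τ r := by
  have hcomb : ∀ a b : ℝ, a + t * (b - a) = (1 - t) * a + t * b := fun a b => by ring
  have hmono : ∀ {a b a' b' : ℝ}, a ≤ a' → b ≤ b' → a + t * (b - a) ≤ a' + t * (b' - a') := by
    intro a b a' b' ha hb
    rw [hcomb, hcomb]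
    exact add_le_add (mul_le_mul_of_nonneg_left ha (by linarith)) (mul_le_mul_of_nonneg_left hb h0)
  refine ⟨⟨fun j x => ?_, fun x => ?_, fun j hj x => ?_, fun j hj a S hS => ?_⟩, fun j x => ?_, ?_⟩
  · simpa using hmono (hp.1.nonneg j x) (hq.1.nonneg j x)
  · rw [hp.1.root, hq.1.root]; ring
  · rw [hp.1.above j hj, hq.1.above j hj]; ring
  · simp only [sum_add_distrib, ← mul_sum, sum_sub_distrib]
    exact hmono (hp.1.cover j hj a S hS) (hq.1.cover j hj a S hS)
  · simpa using hmono (hp.2.1 j x) (hq.2.1 j x)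
  · simpa using hmono hp.2.2 hq.2.2

/-- The segment towards the truncation at 1 consists of candidates. Every truncated coordinate
satisfies u > 1 ≥ v, so the divergence would strictly decrease along it. -/
theorem IsProjection.le_one (h : G.IsProjection κ τ δ r v u) (hδ : 0 < δ) (hv : G.IsState κ τ v) (j : ℕ) (x : X) : u j x ≤ 1 := by
  by_contra hlt
  rw [not_le] at hlt
  have hmem : (fun j x => min (u j x) 1) ∈ G.candidates κ τ r :=
    ⟨h.1.1.min_one, fun j x => (min_le_left _ _).trans (h.1.2.1 j x),
      (min_le_left _ _).trans h.1.2.2⟩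
  have hs := h.slope_nonneg hδ (d := fun j x => min (u j x) 1 - u j x) (by
    filter_upwards [Ioc_mem_nhdsGT (zero_lt_one' ℝ)] with t ht
    exact candidates_convex h.1 hmem ht.1.le ht.2)
  have hterm : ∀ j x, G.wt j x * ((min (u j x) 1 - u j x) *
      (Real.log (u j x + δ) - Real.log (v j x + δ))) ≤ 0 := fun j x => by
    refine mul_nonpos_of_nonneg_of_nonpos (G.wt_pos j x).le ?_
    by_cases hu : u j x ≤ 1
    · rw [min_eq_left hu]; simp
    · refine mul_nonpos_of_nonpos_of_nonneg (by linarith [min_le_left (u j x) 1]) (sub_nonneg.2 ?_)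
      exact Real.log_le_log (by linarith [hv.nonneg j x]) (by linarith [hv.le_one j x])
  have hj : j ∈ Icc 1 G.height := by
    rw [mem_Icc]
    constructor
    · by_contra h0
      obtain rfl : j = 0 := by omega
      rw [h.1.1.root] at hlt
      split_ifs at hlt <;> linarith
    · by_contra h0
      rw [h.1.1.above j (by omega)] at hlt
      linarith
  have hneg : G.slope δ u v (fun j x => min (u j x) 1 - u j x) < 0 := by
    refine sum_neg' (fun i _ => sum_nonpos fun z _ => hterm i z) ⟨j, hj, ?_⟩
    refine sum_neg' (fun z _ => hterm j z) ⟨x, mem_univ x, ?_⟩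
    refine mul_neg_of_pos_of_neg (G.wt_pos j x) ?_
    dsimp only
    rw [min_eq_right hlt.le]
    refine mul_neg_of_neg_of_pos (by linarith) (sub_pos.2 ?_)
    exact Real.log_lt_log (by linarith [hv.nonneg j x]) (by linarith [hv.le_one j x])
  linarith

open Filter Topology in
/-- Sufficient conditions for a direction to be feasible. -/
theorem eventually_mem_candidates (hu : u ∈ G.candidates κ τ r) (hu1 : ∀ j x, u j x ≤ 1)
    {d : ℕ → X → ℝ} (hd0 : ∀ x, d 0 x = 0) (habove : ∀ j, G.height < j → ∀ x, d j x = 0)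
    (hnn : ∀ j x, u j x = 0 → 0 ≤ d j x)
    (hcov : ∀ j < G.height, ∀ a, ∀ S ⊆ G.cl j a,
      ∑ x ∈ G.seg j a S.card, u j x = ∑ x ∈ S, u (j + 1) x →
      ∑ x ∈ G.seg j a S.card, d j x ≤ ∑ x ∈ S, d (j + 1) x)
    (hr : u G.height r = τ → d G.height r ≤ 0) :
    ∀ᶠ t : ℝ in 𝓝[>] 0, (fun j x => u j x + t * d j x) ∈ G.candidates κ τ r := by
  have e1 : ∀ᶠ t : ℝ in 𝓝[>] 0, ∀ j ∈ range (G.height + 1), ∀ x ∈ (univ : Finset X),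
      0 ≤ u j x + t * d j x := by
    rw [Filter.eventually_all_finset]; intro j _
    rw [Filter.eventually_all_finset]; intro x _
    exact eventually_nonneg_add_mul (hu.1.nonneg j x) (hnn j x)
  -- Slack at least 1 in the cap 2, whatever the direction.
  have e2 : ∀ᶠ t : ℝ in 𝓝[>] 0, ∀ j ∈ range (G.height + 1), ∀ x ∈ (univ : Finset X),
      0 ≤ (2 - u j x) + t * (- d j x) := by
    rw [Filter.eventually_all_finset]; intro j _
    rw [Filter.eventually_all_finset]; intro x _
    exact eventually_nonneg_add_mul (by linarith [hu1 j x]) (by intro h; linarith [hu1 j x])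
  -- Indexing clusters by their points leaves finitely many constraints; those of empty clusters are
  -- trivial.
  have e3 : ∀ᶠ t : ℝ in 𝓝[>] 0, ∀ j ∈ range G.height, ∀ z ∈ (univ : Finset X),
      ∀ S ∈ (G.cl j (G.node j z)).powerset,
      0 ≤ (∑ x ∈ S, u (j + 1) x - ∑ x ∈ G.seg j (G.node j z) S.card, u j x) +
        t * (∑ x ∈ S, d (j + 1) x - ∑ x ∈ G.seg j (G.node j z) S.card, d j x) := by
    rw [Filter.eventually_all_finset]; intro j hj
    rw [Filter.eventually_all_finset]; intro z _
    rw [Filter.eventually_all_finset]; intro S hS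
    rw [mem_powerset] at hS
    have hj := mem_range.1 hj
    exact eventually_nonneg_add_mul (sub_nonneg.2 (hu.1.cover j hj _ S hS))
      fun h => sub_nonneg.2 (hcov j hj _ S hS (by linarith))
  have e4 : ∀ᶠ t : ℝ in 𝓝[>] 0, 0 ≤ (τ - u G.height r) + t * (- d G.height r) :=
    eventually_nonneg_add_mul (by linarith [hu.2.2]) fun h => by linarith [hr (by linarith)]
  filter_upwards [e1, e2, e3, e4] with t h1 h2 h3 h4
  refine ⟨⟨fun j x => ?_, fun x => ?_, fun j hj x => ?_, fun j hj a S hS => ?_⟩, fun j x => ?_, ?_⟩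
  · by_cases hj : j ≤ G.height
    · exact h1 j (by simp; omega) x (mem_univ x)
    · rw [habove j (by omega), hu.1.above j (by omega)]; simp
  · rw [hd0, hu.1.root]; simp
  · rw [habove j hj, hu.1.above j hj]; simp
  · rcases S.eq_empty_or_nonempty with rfl | ⟨z, hz⟩
    · simp [seg_zero]
    · have ha := mem_cl.1 (hS hz)
      subst ha
      have := h3 j (mem_range.2 hj) z (mem_univ z) S (mem_powerset.2 hS)
      simp only [sum_add_distrib, ← mul_sum]
      linarith
  · by_cases hj : j ≤ G.height
    · have := h2 j (by simp; omega) x (mem_univ x)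
      dsimp only; linarith
    · dsimp only; rw [habove j (by omega), hu.1.above j (by omega)]; simp
  · dsimp only; linarith

/-- The coordinate direction of the point `x` at level `j`. -/
def unit (j : ℕ) (x : X) : ℕ → X → ℝ := fun j' x' => if j' = j ∧ x' = x then 1 else 0

theorem sum_unit (j : ℕ) (x : X) (i : ℕ) (S : Finset X) :
    ∑ z ∈ S, unit j x i z = if i = j ∧ x ∈ S then 1 else 0 := by
  unfold unit
  by_cases hi : i = j
  · simp [hi]
  · simp [hi]

theorem slope_unit {j : ℕ} (hj : j ∈ Icc 1 G.height) (x : X) :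
    G.slope δ u v (unit j x) = G.wt j x * (Real.log (u j x + δ) - Real.log (v j x + δ)) := by
  unfold slope
  rw [sum_eq_single j, sum_eq_single x]
  · simp [unit]
  · intro z _ hz; simp [unit, hz]
  · simp
  · intro i _ hi; exact sum_eq_zero fun z _ => by simp [unit, hi]
  · intro h; exact absurd hj h

theorem slope_mul (c : ℝ) (d : ℕ → X → ℝ) :
    G.slope δ u v (fun j x => c * d j x) = c * G.slope δ u v d := by
  unfold slope
  simp only [mul_sum]
  exact sum_congr rfl fun j _ => sum_congr rfl fun x _ => by ring

theorem le_of_log_sub_nonneg {a b : ℝ} (hδ : 0 < δ) (hb : 0 ≤ b) (ha : 0 ≤ a)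
    (h : 0 ≤ Real.log (a + δ) - Real.log (b + δ)) : b ≤ a := by
  have := (Real.log_le_log_iff (by linarith) (by linarith)).1 (sub_nonneg.1 h)
  linarith

/-- Raising a coordinate is feasible if no tight constraint forbids it. -/
theorem IsProjection.le_of_raise (h : G.IsProjection κ τ δ r v u) (hδ : 0 < δ)
    (hv : G.IsState κ τ v) {j : ℕ} (hj : j ∈ Icc 1 G.height) {x : X}
    (htight : j < G.height → ∀ S ⊆ G.cl j (G.node j x),
      ∑ z ∈ G.seg j (G.node j x) S.card, u j z = ∑ z ∈ S, u (j + 1) z → S.card ≤ G.rank j x)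
    (hr : j = G.height → x = r → u G.height r < τ) : v j x ≤ u j x := by
  rw [mem_Icc] at hj
  have hs := h.slope_nonneg hδ (d := unit j x) (eventually_mem_candidates h.1 (h.le_one hδ hv)
    (fun z => by simp [unit]; omega) (fun i hi z => by simp [unit]; omega)
    (fun i z _ => by unfold unit; split_ifs <;> norm_num)
    (fun i hi a S hS ht => by
      rw [sum_unit, sum_unit]
      by_cases hij : i = j
      · subst hij
        have : ¬ x ∈ G.seg i a S.card := by
          intro hx
          rw [mem_seg] at hx
          obtain ⟨rfl, hx⟩ := hx
          have := htight hi S hS ht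
          omega
        simp [this]
      · simp only [hij, false_and, if_false]; split_ifs <;> norm_num)
    (fun h0 => by
      unfold unit
      by_cases hc : G.height = j ∧ r = x
      · have := hr hc.1.symm hc.2.symm; linarith
      · rw [if_neg hc]))
  rw [slope_unit (mem_Icc.2 hj)] at hs
  exact le_of_log_sub_nonneg hδ (hv.nonneg j x) (h.1.1.nonneg j x)
    (nonneg_of_mul_nonneg_right hs (G.wt_pos j x))

/-- Lowering a coordinate is feasible if no tight constraint forbids it. -/
theorem IsProjection.le_of_lower (h : G.IsProjection κ τ δ r v u) (hδ : 0 < δ)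
    (hv : G.IsState κ τ v) {i : ℕ} (hi : i < G.height) {x : X}
    (htight : ∀ S ⊆ G.cl i (G.node i x),
      ∑ z ∈ G.seg i (G.node i x) S.card, u i z = ∑ z ∈ S, u (i + 1) z → x ∉ S) :
    u (i + 1) x ≤ v (i + 1) x := by
  by_cases h0 : u (i + 1) x = 0
  · rw [h0]; exact hv.nonneg _ _
  have hs := h.slope_nonneg hδ (d := fun j z => (-1) * unit (i + 1) x j z)
    (eventually_mem_candidates h.1 (h.le_one hδ hv)
    (fun z => by simp [unit]) (fun i hi z => by simp [unit]; omega)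
    (fun j z hz => by
      unfold unit
      by_cases hc : j = i + 1 ∧ z = x
      · rw [hc.1, hc.2] at hz; exact absurd hz h0
      · rw [if_neg hc]; simp)
    (fun j hj a S hS ht => by
      rw [← mul_sum, ← mul_sum, sum_unit, sum_unit]
      by_cases hij : j = i
      · subst hij
        have : x ∉ S := by
          intro hx
          have := mem_cl.1 (hS hx)
          subst this
          exact htight S hS ht hx
        simp [this]
      · have : ¬ j + 1 = i + 1 := by omega
        simp only [this, false_and, if_false]; split_ifs <;> norm_num)
    (fun _ => by unfold unit; split_ifs <;> norm_num))
  rw [slope_mul, slope_unit (mem_Icc.2 ⟨by omega, by omega⟩)] at hs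
  have h1 : 0 ≤ G.wt (i + 1) x *
      (Real.log (v (i + 1) x + δ) - Real.log (u (i + 1) x + δ)) := by linarith
  exact le_of_log_sub_nonneg hδ (h.1.1.nonneg _ x) (hv.nonneg _ x)
    (nonneg_of_mul_nonneg_right h1 (G.wt_pos _ x))

/-- A leaf value never stands on the left of a cover constraint, so it may always be raised except
at the request. Hence all other leaves only lose server mass. -/
theorem IsProjection.leaf_mono (h : G.IsProjection κ τ δ r v u) (hδ : 0 < δ)
    (hv : G.IsState κ τ v) (hH : 1 ≤ G.height) {x : X} (hx : x ≠ r) :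
    v G.height x ≤ u G.height x :=
  h.le_of_raise hδ hv (mem_Icc.2 ⟨hH, le_rfl⟩) (fun h => absurd h (lt_irrefl _))
    fun _ h => absurd h hx

/-- If the value were below τ it could be raised, and optimality would place it above the old value,
which is at least τ. -/
theorem IsProjection.leaf_request (h : G.IsProjection κ τ δ r v u) (hδ : 0 < δ)
    (hv : G.IsState κ τ v) (hH : 1 ≤ G.height) : u G.height r = τ := by
  refine le_antisymm h.1.2.2 (not_lt.1 fun hlt => ?_)
  have := h.le_of_raise hδ hv (mem_Icc.2 ⟨hH, le_rfl⟩) (x := r)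
    (fun h => absurd h (lt_irrefl _)) fun _ _ => hlt
  linarith [hv.leaf r]

/-- At an inversion, shift missing mass from the lower rank to the higher one. Left sides are sums
over initial segments and do not grow. A tight right side that decreases contains `x` but not `x'`,
and exchanging the two would violate its constraint. The old values being sorted, this direction
strictly decreases the divergence. -/
theorem IsProjection.sorted (h : G.IsProjection κ τ δ r v u) (hδ : 0 < δ)
    (hv : G.IsState κ τ v) {j : ℕ} {x x' : X}
    (hnode : G.node j x = G.node j x') (hrank : G.rank j x < G.rank j x') : u j x ≤ u j x' := by
  have hxx : x ≠ x' := fun h => by rw [h] at hrank; exact lt_irrefl _ hrank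
  rcases Nat.eq_zero_or_pos j with rfl | hj0
  · rw [h.1.1.root, h.1.1.root]
    split_ifs <;> first | omega | norm_num
  by_cases hjH : G.height < j
  · rw [h.1.1.above j hjH, h.1.1.above j hjH]
  have hjH' : j < G.height := by
    rcases (not_lt.1 hjH).eq_or_lt with h | h
    · subst h; exact absurd (G.node_height hnode) hxx
    · exact h
  by_contra hlt
  rw [not_le] at hlt
  have hs := h.slope_nonneg hδ (d := fun i z => unit j x' i z + (-1) * unit j x i z)
    (eventually_mem_candidates h.1 (h.le_one hδ hv)
    (fun z => by simp [unit]; split_ifs <;> first | omega | simp)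
    (fun i hi z => by
      have : ¬ i = j := by omega
      simp [unit, this])
    (fun i z hz => by
      unfold unit
      by_cases hc : i = j ∧ z = x
      · rw [hc.1, hc.2] at hz; linarith [h.1.1.nonneg j x']
      · rw [if_neg hc]; split_ifs <;> norm_num)
    (fun i hi a S hS ht => by
      rw [sum_add_distrib, sum_add_distrib, ← mul_sum, ← mul_sum, sum_unit, sum_unit, sum_unit,
        sum_unit]
      by_cases hij : i = j
      · subst hij
        have h1 : ¬ i + 1 = i := by omega
        have h2 : x' ∈ G.seg i a S.card → x ∈ G.seg i a S.card := fun hx => by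
          rw [mem_seg] at hx ⊢; exact ⟨hnode.trans hx.1, hrank.trans hx.2⟩
        simp only [h1, false_and, if_false, true_and]
        by_cases hx' : x' ∈ G.seg i a S.card
        · simp [hx', h2 hx']
        · simp only [hx', if_false]; split_ifs <;> norm_num
      · simp only [hij, false_and, if_false]
        by_cases hij' : i + 1 = j
        · subst hij'
          simp only [true_and]
          by_cases hx : x ∈ S
          · by_cases hx' : x' ∈ S
            · simp [hx, hx']
            -- The constraint for the set with `x` replaced by `x'` has the same left side and a
            -- strictly smaller right side.
            · exfalso
              have ha := mem_cl.1 (hS hx)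
              have hsub : insert x' (S.erase x) ⊆ G.cl i a := by
                refine insert_subset ?_ ((erase_subset _ _).trans hS)
                rw [mem_cl, ← node_eq_of_le (Nat.le_succ i) hnode, ha]
              have hnot : x' ∉ S.erase x := fun h => hx' (mem_of_mem_erase h)
              have hcov := h.1.1.cover i hi a _ hsub
              rw [card_insert_of_notMem hnot, card_erase_of_mem hx, Nat.sub_add_cancel
                (card_pos.2 ⟨x, hx⟩), sum_insert hnot, ht, ← add_sum_erase S _ hx] at hcov
              linarith
          · simp only [hx, if_false]; split_ifs <;> norm_num
        · simp [hij'])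
    (fun _ => by
      have : ¬ G.height = j := by omega
      simp [unit, this]))
  rw [slope_add_mul, slope_unit (mem_Icc.2 ⟨hj0, hjH'.le⟩),
    slope_unit (mem_Icc.2 ⟨hj0, hjH'.le⟩)] at hs
  have hw : G.wt j x = G.wt j x' := by unfold wt; rw [hnode]
  rw [hw] at hs
  have h1 : Real.log (u j x' + δ) < Real.log (u j x + δ) :=
    Real.log_lt_log (by linarith [h.1.1.nonneg j x']) (by linarith)
  have h2 : Real.log (v j x + δ) ≤ Real.log (v j x' + δ) :=
    Real.log_le_log (by linarith [hv.nonneg j x])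
      (by linarith [hv.sorted j x x' hnode hrank])
  have h3 := mul_pos (G.wt_pos j x') (show (0 : ℝ) < (Real.log (u j x + δ) - Real.log (u j x' + δ)) +
    (Real.log (v j x' + δ) - Real.log (v j x + δ)) by linarith)
  linarith

end Hierarchy

theorem sum_le_sum_of_card_eq {ι : Type*} {A B : Finset ι} {f : ι → ℝ} (hcard : A.card = B.card)
    (h : ∀ a ∈ A, ∀ b ∈ B, f a ≤ f b) : ∑ a ∈ A, f a ≤ ∑ b ∈ B, f b := by
  rcases B.eq_empty_or_nonempty with rfl | hB
  · have : A = ∅ := card_eq_zero.1 (by simpa using hcard)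
    simp [this]
  · obtain ⟨b, hb, hmin⟩ := exists_min_image B f hB
    calc ∑ a ∈ A, f a ≤ A.card • f b := sum_le_card_nsmul A f _ fun a ha => h a ha b hb
      _ = B.card • f b := by rw [hcard]
      _ ≤ ∑ b ∈ B, f b := card_nsmul_le_sum B f _ hmin

namespace Hierarchy

variable {X C : Type*} [Fintype X] [DecidableEq X] [DecidableEq C] {G : Hierarchy X C}
  {κ : ℕ} {τ δ : ℝ} {r : X} {u v : ℕ → X → ℝ}

/-- The partial sums of a sorted sequence are convex. -/
theorem sum_seg_add_le {j : ℕ} {a : C} {f : X → ℝ}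
    (hf : ∀ x x', G.node j x = G.node j x' → G.rank j x < G.rank j x' → f x ≤ f x')
    {p s t q : ℕ} (hps : p ≤ s) (hst : s ≤ t) (hpq : p + q = s + t) (hq : q ≤ (G.cl j a).card) :
    ∑ x ∈ G.seg j a s, f x + ∑ x ∈ G.seg j a t, f x ≤
      ∑ x ∈ G.seg j a p, f x + ∑ x ∈ G.seg j a q, f x := by
  have h1 := sum_sdiff (f := f) (seg_mono (G := G) j a hps)
  have h2 := sum_sdiff (f := f) (seg_mono (G := G) j a (show t ≤ q by omega))
  have h3 : ∑ x ∈ G.seg j a s \ G.seg j a p, f x ≤ ∑ x ∈ G.seg j a q \ G.seg j a t, f x := by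
    refine sum_le_sum_of_card_eq ?_ fun x hx x' hx' => ?_
    · rw [card_sdiff_of_subset (seg_mono j a hps), card_sdiff_of_subset (seg_mono j a (by omega)),
        card_seg hq, card_seg (by omega), card_seg (by omega), card_seg (by omega)]
      omega
    · rw [mem_sdiff, mem_seg, mem_seg] at hx hx'
      have : ¬ G.rank j x' < t := fun h => hx'.2 ⟨hx'.1.1, h⟩
      exact hf x x' (hx.1.1.trans hx'.1.1.symm) (by omega)
  linarith

/-- The union of two tight sets is tight. -/
theorem tight_union (hu : G.IsFeasible κ u) {j : ℕ} (hj : j < G.height) {a : C}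
    (hf : ∀ x x', G.node j x = G.node j x' → G.rank j x < G.rank j x' → u j x ≤ u j x')
    {S T : Finset X} (hS : S ⊆ G.cl j a) (hT : T ⊆ G.cl j a)
    (hSt : ∑ x ∈ G.seg j a S.card, u j x = ∑ x ∈ S, u (j + 1) x)
    (hTt : ∑ x ∈ G.seg j a T.card, u j x = ∑ x ∈ T, u (j + 1) x) :
    ∑ x ∈ G.seg j a (S ∪ T).card, u j x = ∑ x ∈ S ∪ T, u (j + 1) x := by
  -- Uncrossing: by convexity of the segment sums, the left sides of `S` and `T` total at most those
  -- of `S ∩ T` and `S ∪ T`, while the right sides have equal totals. So equality holds throughout.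
  have h1 := sum_union_inter (s₁ := S) (s₂ := T) (f := u (j + 1))
  have h2 := card_union_add_card_inter S T
  have h3 := hu.cover j hj a (S ∩ T) (inter_subset_left.trans hS)
  have h4 := hu.cover j hj a (S ∪ T) (union_subset hS hT)
  have h5 := card_le_card (union_subset hS hT)
  have h6 : (S ∩ T).card ≤ S.card := card_le_card inter_subset_left
  have h7 : (S ∩ T).card ≤ T.card := card_le_card inter_subset_right
  rcases le_total S.card T.card with hc | hc
  · have := sum_seg_add_le (G := G) (a := a) hf h6 hc (by omega) h5
    linarith
  · have := sum_seg_add_le (G := G) (a := a) hf h7 hc (by omega) h5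
    linarith

/-- Let M be the largest tight set. Outside M child values can be lowered, hence did not increase;
beyond the first |M| ranks parent values can be raised, hence did not decrease. Conservation in the
old state and its cover constraint for M then leave no room for a surplus of the children. -/
theorem IsProjection.conserve (h : G.IsProjection κ τ δ r v u) (hδ : 0 < δ)
    (hv : G.IsState κ τ v) {i : ℕ} (hi : i < G.height) (a : C) :
    ∑ x ∈ G.cl i a, u (i + 1) x = ∑ x ∈ G.cl i a, u i x := by
  have hsort : ∀ x x', G.node i x = G.node i x' → G.rank i x < G.rank i x' → u i x ≤ u i x' :=
    fun x x' => h.sorted hδ hv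
  refine le_antisymm ?_ ?_
  swap
  · have := h.1.1.cover i hi a _ (Subset.refl _)
    rwa [seg_card] at this
  obtain ⟨M, hM, hmax⟩ := exists_max_image
    ((G.cl i a).powerset.filter fun S =>
      ∑ x ∈ G.seg i a S.card, u i x = ∑ x ∈ S, u (i + 1) x) card
    ⟨∅, by simp [seg_zero]⟩
  rw [mem_filter, mem_powerset] at hM
  -- Tight sets are closed under unions, so a tight set of maximal size contains all of them.
  have hsub : ∀ S ⊆ G.cl i a, ∑ x ∈ G.seg i a S.card, u i x = ∑ x ∈ S, u (i + 1) x → S ⊆ M := by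
    intro S hS hSt
    have h1 := tight_union h.1.1 hi hsort hM.1 hS hM.2 hSt
    have h2 := hmax (M ∪ S) (mem_filter.2 ⟨mem_powerset.2 (union_subset hM.1 hS), h1⟩)
    have h3 := eq_of_subset_of_card_le subset_union_left h2
    rw [h3]; exact subset_union_right
  have hlow : ∀ x ∈ G.cl i a \ M, u (i + 1) x ≤ v (i + 1) x := by
    intro x hx
    rw [mem_sdiff, mem_cl] at hx
    obtain ⟨rfl, hxM⟩ := hx
    exact h.le_of_lower hδ hv hi fun S hS hSt hxS => hxM (hsub S hS hSt hxS)
  have hhigh : ∀ x ∈ G.cl i a \ G.seg i a M.card, v i x ≤ u i x := by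
    intro x hx
    rw [mem_sdiff, mem_cl, mem_seg] at hx
    obtain ⟨rfl, hxM⟩ := hx
    rcases Nat.eq_zero_or_pos i with rfl | hi0
    · rw [h.1.1.root, hv.root]
    · refine h.le_of_raise hδ hv (mem_Icc.2 ⟨hi0, hi.le⟩) (fun _ S hS hSt => ?_)
        fun h => absurd h hi.ne
      have := card_le_card (hsub S hS hSt)
      by_contra hlt
      exact hxM ⟨rfl, by omega⟩
  have h1 := sum_sdiff (f := u (i + 1)) hM.1
  have h2 := sum_sdiff (f := v (i + 1)) hM.1
  have h3 := sum_sdiff (f := u i) (G.seg_subset i a M.card)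
  have h4 := sum_sdiff (f := v i) (G.seg_subset i a M.card)
  have h5 := sum_le_sum hlow
  have h6 := sum_le_sum hhigh
  have h7 := hv.conserve i hi a
  have h8 := hv.cover i hi a M hM.1
  linarith [hM.2]

theorem IsProjection.isState (h : G.IsProjection κ τ δ r v u) (hδ : 0 < δ)
    (hv : G.IsState κ τ v) (hH : 1 ≤ G.height) : G.IsState κ τ u where
  toIsFeasible := h.1.1
  le_one := h.le_one hδ hv
  sorted := fun _ _ _ => h.sorted hδ hv
  conserve := fun _ hj a => h.conserve hδ hv hj a
  leaf := fun x => by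
    by_cases hx : x = r
    · rw [hx, h.leaf_request hδ hv hH]
    · exact (hv.leaf x).trans (h.leaf_mono hδ hv hH hx)

end Hierarchy

/-! ### Offline solutions in the polytope and the inflow inequality -/

namespace Hierarchy

variable {X C : Type*} [Fintype X] [DecidableEq X] [DecidableEq C] {G : Hierarchy X C}
  {κ : ℕ} {τ δ : ℝ} {r : X} {u v : ℕ → X → ℝ} {B : Finset X}

theorem sum_seg_threshold {j : ℕ} {a : C} {s : ℕ} (hs : s ≤ (G.cl j a).card) (m : ℕ) :
    ∑ x ∈ G.seg j a s, (if G.rank j x < m then (0 : ℝ) else 1) = s - (min s m : ℕ) := by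
  have h1 : ∀ x ∈ G.seg j a s, (if G.rank j x < m then (0 : ℝ) else 1) =
      1 - (if G.rank j x < m then 1 else 0) := fun x _ => by split_ifs <;> norm_num
  rw [sum_congr rfl h1, sum_sub_distrib, sum_const, card_seg hs, nsmul_eq_mul, mul_one,
    ← sum_filter, sum_const, nsmul_eq_mul, mul_one]
  have h2 : (G.seg j a s).filter (fun x => G.rank j x < m) = G.seg j a (min s m) := by
    ext x; simp only [mem_filter, mem_seg, lt_min_iff]; tauto
  rw [h2, card_seg ((min_le_left _ _).trans hs)]

variable (G) in
/-- The state of the polytope that describes the set of servers `B`. -/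
noncomputable def opt (κ : ℕ) (B : Finset X) (j : ℕ) (x : X) : ℝ :=
  if j = 0 then (if G.rank 0 x < κ then 0 else 1)
  else if j ≤ G.height then (if G.rank j x < (B ∩ G.cl j (G.node j x)).card then 0 else 1)
  else 0

theorem opt_eq {j : ℕ} (hj : j ∈ Icc 1 G.height) (x : X) :
    G.opt κ B j x = if G.rank j x < (B ∩ G.cl j (G.node j x)).card then 0 else 1 := by
  rw [mem_Icc] at hj
  unfold opt
  rw [if_neg (by omega), if_pos hj.2]

theorem opt_nonneg (j : ℕ) (x : X) : 0 ≤ G.opt κ B j x := by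
  unfold opt; split_ifs <;> norm_num

theorem opt_le_one (j : ℕ) (x : X) : G.opt κ B j x ≤ 1 := by
  unfold opt; split_ifs <;> norm_num

theorem filter_node_eq {i j : ℕ} (hij : i ≤ j) {a : C} {b : C}
    (hb : b ∈ (G.cl i a).image (G.node j)) :
    (G.cl i a).filter (fun x => G.node j x = b) = G.cl j b := by
  obtain ⟨z, hz, rfl⟩ := mem_image.1 hb
  rw [mem_cl] at hz
  subst hz
  ext x
  rw [mem_filter, mem_cl, mem_cl]
  exact ⟨fun h => h.2, fun h => ⟨node_eq_of_le hij h, h⟩⟩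

theorem sum_cl_fiberwise {i j : ℕ} (hij : i ≤ j) (a : C) (f : X → ℝ) :
    ∑ x ∈ G.cl i a, f x = ∑ b ∈ (G.cl i a).image (G.node j), ∑ x ∈ G.cl j b, f x := by
  rw [← sum_fiberwise_of_maps_to (g := G.node j) (t := (G.cl i a).image (G.node j))
    fun x hx => mem_image_of_mem _ hx]
  exact sum_congr rfl fun b hb => by rw [filter_node_eq hij hb]

/-- In each child the present servers occupy the first ranks, so their number is that of the servers
of `B` in the child; summation over the children gives the bound. -/
theorem card_opt_zero_le (j : ℕ) (a : C) :
    ((G.cl j a).filter fun x => G.rank (j + 1) x <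
      (B ∩ G.cl (j + 1) (G.node (j + 1) x)).card).card ≤ (B ∩ G.cl j a).card := by
  rw [card_eq_sum_card_fiberwise (f := G.node (j + 1))
      (t := (G.cl j a).image (G.node (j + 1)))
      fun x hx => mem_coe.2 (mem_image_of_mem _ (mem_filter.1 hx).1),
    card_eq_sum_card_fiberwise (s := B ∩ G.cl j a) (f := G.node (j + 1))
      (t := (G.cl j a).image (G.node (j + 1)))
      fun x hx => mem_coe.2 (mem_image_of_mem _ (mem_inter.1 hx).2)]
  refine sum_le_sum fun b hb => ?_
  have h1 : (B ∩ G.cl j a).filter (fun x => G.node (j + 1) x = b) = B ∩ G.cl (j + 1) b := by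
    rw [← filter_node_eq (Nat.le_succ j) hb, inter_filter]
  rw [h1, ← card_seg (G := G) (j := j + 1) (a := b) (card_le_card inter_subset_right)]
  refine card_le_card fun x hx => ?_
  rw [mem_filter, mem_filter] at hx
  obtain ⟨⟨-, hx⟩, rfl⟩ := hx
  exact mem_seg.2 ⟨rfl, hx⟩

/-- Both sides count absent servers. A segment of length s has s - min(s, m) of them with m at least
the number of servers in the cluster, and `S` has at least s - min(s, m) by `card_opt_zero_le`. At
the root m is κ rather than |B|. -/
theorem isFeasible_opt (hB : B.card ≤ κ) : G.IsFeasible κ (G.opt κ B) where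
  nonneg := opt_nonneg
  root := fun x => by simp [opt]
  above := fun j hj x => by
    unfold opt; rw [if_neg (by omega), if_neg (by omega)]
  cover := fun j hj a S hS => by
    have hm : ∃ m, (B ∩ G.cl j a).card ≤ m ∧ ∀ x ∈ G.cl j a,
        G.opt κ B j x = if G.rank j x < m then 0 else 1 := by
      rcases Nat.eq_zero_or_pos j with rfl | hj0
      · exact ⟨κ, (card_le_card inter_subset_left).trans hB, fun x _ => by simp [opt]⟩
      · refine ⟨_, le_rfl, fun x hx => ?_⟩
        rw [opt_eq (mem_Icc.2 ⟨hj0, hj.le⟩), mem_cl.1 hx]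
    obtain ⟨m, hm, heq⟩ := hm
    rw [sum_congr rfl fun x hx => heq x (G.seg_subset j a _ hx),
      sum_seg_threshold (card_le_card hS)]
    have h1 : ∀ x ∈ S, G.opt κ B (j + 1) x =
        1 - (if G.rank (j + 1) x < (B ∩ G.cl (j + 1) (G.node (j + 1) x)).card then 1 else 0) :=
      fun x _ => by
        rw [opt_eq (mem_Icc.2 ⟨by omega, hj⟩)]; split_ifs <;> norm_num
    rw [sum_congr rfl h1, sum_sub_distrib, sum_const, nsmul_eq_mul, mul_one, ← sum_filter,
      sum_const, nsmul_eq_mul, mul_one]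
    have h2 := card_filter_le S
      fun x => G.rank (j + 1) x < (B ∩ G.cl (j + 1) (G.node (j + 1) x)).card
    have h3 := (card_le_card (filter_subset_filter
      (fun x => G.rank (j + 1) x < (B ∩ G.cl (j + 1) (G.node (j + 1) x)).card) hS)).trans
      ((card_opt_zero_le (B := B) j a).trans hm)
    have h4 := le_min h2 h3
    have : ((S.filter fun x => G.rank (j + 1) x <
      (B ∩ G.cl (j + 1) (G.node (j + 1) x)).card).card : ℝ) ≤ (min S.card m : ℕ) := by
        exact_mod_cast h4
    linarith

theorem cl_height (x : X) : G.cl G.height (G.node G.height x) = {x} := by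
  ext z
  rw [mem_cl, mem_singleton]
  exact ⟨fun h => G.node_height h, fun h => by rw [h]⟩

theorem opt_leaf (hH : 1 ≤ G.height) (hr : r ∈ B) : G.opt κ B G.height r = 0 := by
  rw [opt_eq (mem_Icc.2 ⟨hH, le_rfl⟩)]
  have h1 := rank_lt_card (mem_cl.2 rfl : r ∈ G.cl G.height (G.node G.height r))
  rw [cl_height] at *
  rw [if_pos]
  rwa [inter_singleton_of_mem hr]

theorem opt_mem_candidates (hτ : 0 ≤ τ) (hH : 1 ≤ G.height) (hB : B.card ≤ κ) (hr : r ∈ B) :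
    G.opt κ B ∈ G.candidates κ τ r :=
  ⟨isFeasible_opt hB, fun j x => (opt_le_one j x).trans (by norm_num), by rwa [opt_leaf hH hr]⟩

/-- The zeros common to two feasible states do not increase from a cluster to a tight set below. -/
theorem sum_shifted_le (hu : G.IsFeasible κ u) (hv : G.IsFeasible κ v) (hτ : 0 ≤ τ) {j : ℕ}
    (hj : j < G.height) {a : C} {S : Finset X} (hS : S ⊆ G.cl j a) :
    ∑ x ∈ G.seg j a S.card, (if v j x = 0 ∧ u j x = 0 then 0 else u j x + τ) ≤
      ∑ x ∈ S, (if v (j + 1) x = 0 ∧ u (j + 1) x = 0 then 0 else u (j + 1) x + τ) := by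
  have hterm : ∀ i x, (if v i x = 0 ∧ u i x = 0 then 0 else u i x + τ) =
      u i x + τ - (if v i x = 0 ∧ u i x = 0 then τ else 0) := fun i x => by
    split_ifs with h
    · rw [h.2]; ring
    · ring
  -- If a state vanishes on a set F of child coordinates, its cover constraint forces the first |F|
  -- parent coordinates to vanish. Thus the segment has at least as many common zeros as `S`.
  have hcount : (S.filter fun x => v (j + 1) x = 0 ∧ u (j + 1) x = 0).card ≤
      ((G.seg j a S.card).filter fun x => v j x = 0 ∧ u j x = 0).card := by
    set F := S.filter fun x => v (j + 1) x = 0 ∧ u (j + 1) x = 0 with hF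
    have hFS : F ⊆ S := filter_subset _ _
    have hzero : ∀ {w : ℕ → X → ℝ}, G.IsFeasible κ w → (∀ x ∈ F, w (j + 1) x = 0) →
        ∀ x ∈ G.seg j a F.card, w j x = 0 := by
      intro w hw h0
      have h1 := hw.cover j hj a F (hFS.trans hS)
      rw [sum_eq_zero h0] at h1
      exact (sum_eq_zero_iff_of_nonneg fun x _ => hw.nonneg j x).1
        (le_antisymm h1 (sum_nonneg fun x _ => hw.nonneg j x))
    rw [← card_le_card_cl (G := G) (hFS.trans hS)]
    refine card_le_card fun x hx => mem_filter.2 ⟨seg_mono j a (card_le_card hFS) hx, ?_, ?_⟩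
    · exact hzero hv (fun z hz => (mem_filter.1 hz).2.1) x hx
    · exact hzero hu (fun z hz => (mem_filter.1 hz).2.2) x hx
  simp only [hterm, sum_sub_distrib, sum_add_distrib, ← sum_filter, sum_const, nsmul_eq_mul]
  rw [card_le_card_cl hS]
  have h1 := hu.cover j hj a S hS
  have h2 := mul_le_mul_of_nonneg_right (Nat.cast_le (α := ℝ).2 hcount) hτ
  linarith

theorem sum_Icc_ite_lt {H ℓ : ℕ} (f : ℕ → ℝ) :
    ∑ j ∈ Icc 1 H, (if ℓ < j then f j else 0) = ∑ j ∈ Icc (ℓ + 1) H, f j := by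
  rw [← sum_filter]
  refine sum_congr ?_ fun _ _ => rfl
  ext j; simp only [mem_filter, mem_Icc]; omega

/-- The mass that enters the clusters of level `ℓ` is paid for by the decrease of the divergence
from any set of servers that serves the request. -/
theorem IsProjection.inflow_le (h : G.IsProjection κ τ τ r v u) (hτ : 0 < τ)
    (hv : G.IsState κ τ v) (hB : B.card ≤ κ) (hr : r ∈ B) {ℓ : ℕ} (hℓ : ℓ ∈ Icc 1 G.height) :
    ∑ x, G.wt ℓ x * max (v ℓ x - u ℓ x) 0 ≤
      ∑ j ∈ Icc (ℓ + 1) G.height, ∑ x, G.wt j x * (u j x - v j x) +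
        2 * (G.div τ (G.opt κ B) v - G.div τ (G.opt κ B) u) := by
  rw [mem_Icc] at hℓ
  have hH : 1 ≤ G.height := hℓ.1.trans hℓ.2
  have hus := h.isState hτ hv hH
  have hopt := isFeasible_opt (G := G) hB
  -- Deeper than ℓ the direction is u + τ away from the common zeros; on level ℓ it is u + τ where
  -- missing mass has dropped; above it is 0. Constraints from level ℓ downwards survive by
  -- `sum_shifted_le`, those higher up because their left side does not move.
  set d : ℕ → X → ℝ := fun j x =>
    if ℓ < j ∧ j ≤ G.height then (if v j x = 0 ∧ u j x = 0 then 0 else u j x + τ)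
    else if j = ℓ ∧ u j x < v j x then u j x + τ else 0 with hd
  have hd_nonneg : ∀ j x, 0 ≤ d j x := fun j x => by
    have := hus.nonneg j x
    simp only [hd]; split_ifs <;> first | exact le_rfl | positivity
  have hd_le : ∀ j x, d j x ≤ if v j x = 0 ∧ u j x = 0 then 0 else u j x + τ := fun j x => by
    have := hus.nonneg j x
    simp only [hd]
    by_cases h1 : ℓ < j ∧ j ≤ G.height
    · rw [if_pos h1]
    · rw [if_neg h1]
      by_cases h2 : v j x = 0 ∧ u j x = 0
      · rw [if_pos h2, if_neg (by rw [h2.1, h2.2]; simp)]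
      · rw [if_neg h2]; split_ifs <;> linarith
  -- The factor 2 is dictated by the request: the leaf value is τ, `d` raises it by at most 2τ, and
  -- the correction towards `opt` lowers it by 2τ.
  have hs := h.slope_nonneg hτ (d := fun j x => d j x + 2 * (G.opt κ B j x - u j x))
    (eventually_mem_candidates h.1 hus.le_one
    (fun x => by
      have h1 : ¬ ℓ < 0 := by omega
      have h2 : ¬ 0 = ℓ := by omega
      simp only [hd, h1, h2, false_and, if_false, hopt.root, hus.root]; ring)
    (fun j hj x => by
      have h1 : ¬ j ≤ G.height := by omega
      have h2 : ¬ j = ℓ := by omega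
      simp only [hd, h1, h2, false_and, and_false, if_false, hopt.above j hj, hus.above j hj]
      ring)
    (fun j x hx => by
      have h1 := hd_nonneg j x
      have h2 := hopt.nonneg j x
      rw [hx]; linarith)
    (fun j hj a S hS ht => by
      simp only [sum_add_distrib, ← mul_sum, sum_sub_distrib]
      have h1 := hopt.cover j hj a S hS
      have h2 : ∑ x ∈ G.seg j a S.card, d j x ≤ ∑ x ∈ S, d (j + 1) x := by
        by_cases hjℓ : ℓ ≤ j
        · refine (sum_le_sum fun x _ => hd_le j x).trans
            ((sum_shifted_le hus.toIsFeasible hv.toIsFeasible hτ.le hj hS).trans (le_of_eq ?_))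
          refine sum_congr rfl fun x _ => ?_
          simp only [hd]
          rw [if_pos (⟨by omega, hj⟩ : ℓ < j + 1 ∧ j + 1 ≤ G.height)]
        · rw [sum_eq_zero fun x _ => ?_]
          · exact sum_nonneg fun x _ => hd_nonneg _ x
          · simp only [hd]
            rw [if_neg (by omega), if_neg (by omega)]
      linarith)
    (fun hτr => by
      have h1 := (hd_le G.height r).trans
        (show _ ≤ u G.height r + τ by
          have := hus.nonneg G.height r
          split_ifs <;> linarith)
      rw [opt_leaf hH hr]
      linarith))
  rw [slope_add_mul, slope_sub] at hs
  have hterm : ∀ j ∈ Icc 1 G.height, ∀ x, G.wt j x *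
      (d j x * (Real.log (u j x + τ) - Real.log (v j x + τ))) ≤
      (if ℓ < j then G.wt j x * (u j x - v j x) else 0) -
      (if j = ℓ then G.wt j x * max (v j x - u j x) 0 else 0) +
      G.wt j x * breg τ (u j x) (v j x) := by
    intro j hj x
    have hb := mul_nonneg (G.wt_pos j x).le (breg_nonneg hτ (hus.nonneg j x) (hv.nonneg j x))
    -- Since the entropy is shifted by the same τ, the direction u + τ turns the logarithms into the
    -- divergence plus a linear term.
    have hid : (u j x + τ) * (Real.log (u j x + τ) - Real.log (v j x + τ)) =
      breg τ (u j x) (v j x) + (u j x - v j x) := by unfold breg; ring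
    simp only [hd]
    by_cases h1 : ℓ < j
    · rw [if_pos ⟨h1, (mem_Icc.1 hj).2⟩, if_pos h1, if_neg (show ¬ j = ℓ by omega)]
      by_cases h2 : v j x = 0 ∧ u j x = 0
      · rw [if_pos h2, h2.1, h2.2, breg_self]; simp
      · rw [if_neg h2, hid]; linarith
    · rw [if_neg (by omega), if_neg h1]
      by_cases h2 : j = ℓ
      · by_cases h3 : u j x < v j x
        · rw [if_pos ⟨h2, h3⟩, if_pos h2, max_eq_left (by linarith), hid]; linarith
        · rw [if_neg (by tauto), if_pos h2, max_eq_right (by linarith)]; linarith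
      · rw [if_neg (by tauto), if_neg h2]; linarith
  have hslope : G.slope τ u v d ≤ ∑ j ∈ Icc (ℓ + 1) G.height, ∑ x, G.wt j x * (u j x - v j x) -
      ∑ x, G.wt ℓ x * max (v ℓ x - u ℓ x) 0 + G.div τ u v := by
    refine (sum_le_sum fun j hj => sum_le_sum fun x _ => hterm j hj x).trans (le_of_eq ?_)
    simp only [sum_add_distrib, sum_sub_distrib]
    congr 1
    congr 1
    · rw [← sum_Icc_ite_lt (ℓ := ℓ)]
      refine sum_congr rfl fun j _ => ?_
      split_ifs <;> simp
    · rw [sum_eq_single ℓ]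
      · simp
      · intro j _ hj; simp [hj]
      · intro hn; exact absurd (mem_Icc.2 hℓ) hn
  -- The direction `d` costs one copy of the divergence of u from v, the correction returns two by
  -- `slope_sub`.
  have hdn := div_nonneg (G := G) hτ hus.nonneg hv.nonneg
  linarith

/-! ### The initial state -/

variable (G) in
/-- The state in which all leaves carry the same mass. -/
noncomputable def init (κ : ℕ) (j : ℕ) (x : X) : ℝ :=
  if j = 0 then (if G.rank 0 x < κ then 0 else 1)
  else if j ≤ G.height then 1 - κ / Fintype.card X else 0

/-- At the root the cover constraint for s points reads s - min(s, κ) ≤ s (1 - κ/n), that is s κ/n ≤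
min(s, κ), with n the number of points. Below the root all values are equal. The leaf bound τ is
where k ≤ n enters. -/
theorem isState_init (hκ : κ ≤ Fintype.card X) (hn : 0 < Fintype.card X)
    (hτ : τ ≤ 1 - κ / Fintype.card X) (hH : 1 ≤ G.height) : G.IsState κ τ (G.init κ) := by
  have hn' : (0 : ℝ) < Fintype.card X := by exact_mod_cast hn
  have hκ' : (κ : ℝ) / Fintype.card X ≤ 1 := (div_le_one hn').2 (by exact_mod_cast hκ)
  have hκ0 : (0 : ℝ) ≤ κ / Fintype.card X := by positivity
  have hpos : ∀ j, 1 ≤ j → j ≤ G.height → ∀ x, G.init κ j x = 1 - κ / Fintype.card X :=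
    fun j h1 h2 x => by unfold init; rw [if_neg (by omega), if_pos h2]
  have hroot : ∀ x, G.init κ 0 x = if G.rank 0 x < κ then 0 else 1 := fun x => by simp [init]
  have hcl : ∀ a, (G.cl 0 a).Nonempty → G.cl 0 a = univ := by
    rintro a ⟨x, hx⟩
    rw [← mem_cl.1 hx, cl_zero]
  constructor
  · refine ⟨fun j x => ?_, hroot, fun j hj x => ?_, fun j hj a S hS => ?_⟩
    · unfold init; split_ifs <;> linarith
    · unfold init; rw [if_neg (by omega), if_neg (by omega)]
    · rw [sum_congr rfl fun x _ => hpos (j + 1) (by omega) hj x, sum_const, nsmul_eq_mul]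
      rcases Nat.eq_zero_or_pos j with rfl | hj0
      · rw [sum_congr rfl fun x _ => hroot x, sum_seg_threshold (card_le_card hS), Nat.cast_min]
        have hs : (S.card : ℝ) ≤ Fintype.card X := by
          exact_mod_cast card_le_univ S
        have h1 : (S.card : ℝ) * (κ / Fintype.card X) ≤ κ := by
          rw [mul_div_assoc', div_le_iff₀ hn', mul_comm]
          exact mul_le_mul_of_nonneg_left hs (by positivity)
        have h2 : (S.card : ℝ) * (κ / Fintype.card X) ≤ S.card := by
          simpa using mul_le_mul_of_nonneg_left hκ' (Nat.cast_nonneg S.card)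
        have h3 := le_min h2 h1
        linarith [mul_sub (S.card : ℝ) 1 (κ / Fintype.card X)]
      · rw [sum_congr rfl fun x _ => hpos j hj0 hj.le x, sum_const, nsmul_eq_mul,
          card_le_card_cl hS]
  · intro j x
    unfold init; split_ifs <;> linarith
  · intro j x x' _ hr
    by_cases h0 : j = 0
    · subst h0
      rw [hroot, hroot]; split_ifs <;> first | omega | norm_num
    · unfold init; rw [if_neg h0, if_neg h0]
  · intro j hj a
    rcases Nat.eq_zero_or_pos j with rfl | hj0
    · rcases (G.cl 0 a).eq_empty_or_nonempty with he | he
      · simp [he]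
      · have h1 := sum_seg_threshold (G := G) (a := a) (le_refl (G.cl 0 a).card) κ
        rw [seg_card] at h1
        rw [sum_congr rfl fun x _ => hroot x, h1, hcl a he, card_univ,
          sum_congr rfl fun x _ => hpos (0 + 1) le_rfl hH x, sum_const, nsmul_eq_mul, card_univ,
          min_eq_right hκ, mul_sub, mul_one, mul_div_cancel₀ _ hn'.ne']
    · exact sum_congr rfl fun x _ => by
        rw [hpos j hj0 hj.le, hpos (j + 1) (by omega) hj]
  · intro x
    rw [hpos G.height hH le_rfl]; exact hτ

/-- In a cluster of level `i` the total missing mass is the same at all lower levels. -/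
theorem IsState.sum_cl_eq (hv : G.IsState κ τ v) {i j : ℕ} (hij : i ≤ j) (hj : j ≤ G.height) (a : C) :
    ∑ x ∈ G.cl i a, v j x = ∑ x ∈ G.cl i a, v i x := by
  induction j, hij using Nat.le_induction with
  | base => rfl
  | succ j hij ih =>
    rw [← ih (by omega), sum_cl_fiberwise hij, sum_cl_fiberwise hij]
    exact sum_congr rfl fun b _ => hv.conserve j (by omega) b

theorem IsState.sum_eq (hv : G.IsState κ τ v) {j : ℕ} (hj : j ≤ G.height) [Nonempty X]
    (hκ : κ ≤ Fintype.card X) : ∑ x, v j x = Fintype.card X - κ := by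
  have hx := cl_zero (G := G) (Classical.arbitrary X)
  rw [← hx, hv.sum_cl_eq (Nat.zero_le j) hj, sum_congr rfl fun x _ => hv.root x]
  have h1 := sum_seg_threshold (G := G) (j := 0) (a := G.node 0 (Classical.arbitrary X))
    le_rfl κ
  rw [seg_card] at h1
  rw [h1, hx, card_univ, min_eq_right hκ]

/-! ### The movement of the offline servers -/

variable (G) in
/-- The nonempty clusters of level `j`. -/
def nodes (j : ℕ) : Finset C := univ.image (G.node j)

theorem sum_nodes (j : ℕ) (f : X → ℝ) : ∑ a ∈ G.nodes j, ∑ x ∈ G.cl j a, f x = ∑ x, f x := by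
  rw [← sum_fiberwise_of_maps_to (s := univ) (g := G.node j) (t := G.nodes j)
    fun x hx => mem_image_of_mem _ hx]
  exact sum_congr rfl fun b _ => sum_congr (by ext x; simp [mem_cl]) fun _ _ => rfl

variable (G) in
/-- The tree metric of the hierarchy. -/
noncomputable def treeDist (x y : X) : ℝ :=
  ∑ j ∈ Icc 1 G.height, if G.node j x = G.node j y then 0 else G.wt j x + G.wt j y

theorem serverMass_cl (j : ℕ) (a : C) (x : X) :
    serverMass (G.cl j a) x = if G.node j x = a then 1 else 0 := by
  unfold serverMass; simp only [mem_cl]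

theorem sum_cut_le_treeDist (x y : X) :
    ∑ i ∈ (Icc 1 G.height).sigma fun j => G.nodes j, G.weight i.1 i.2 *
      |serverMass (G.cl i.1 i.2) x - serverMass (G.cl i.1 i.2) y| ≤ G.treeDist x y := by
  rw [sum_sigma]
  refine sum_le_sum fun j _ => ?_
  simp only [serverMass_cl]
  by_cases h : G.node j x = G.node j y
  · rw [if_pos h, h]; simp
  · rw [if_neg h]
    have hb : ∀ a ∈ G.nodes j, G.weight j a * |(if G.node j x = a then (1 : ℝ) else 0) -
        if G.node j y = a then 1 else 0| ≤
        (if G.node j x = a then G.weight j a else 0) + if G.node j y = a then G.weight j a else 0 := by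
      intro a _
      have := (G.weight_pos j a).le
      split_ifs <;> simp [this]
    refine (sum_le_sum hb).trans (le_of_eq ?_)
    have hmem : ∀ z, G.node j z ∈ G.nodes j := fun z => mem_image_of_mem _ (mem_univ z)
    rw [sum_add_distrib, sum_ite_eq, sum_ite_eq, if_pos (hmem x), if_pos (hmem y)]
    rfl

/-- Masses of clusters are controlled by the earthmover distance. -/
theorem sum_nodes_le_earthmover [MetricSpace X] {c : ℝ} (hc : 0 < c)
    (hG : ∀ x y, G.treeDist x y ≤ c * dist x y) {z z' : X → ℝ} {k : ℝ} (hk : 0 < k)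
    (hz : ∀ x, 0 ≤ z x) (hz' : ∀ x, 0 ≤ z' x) (hs : ∑ x, z x = k) (hs' : ∑ x, z' x = k) :
    ∑ j ∈ Icc 1 G.height, ∑ a ∈ G.nodes j, G.weight j a *
      |∑ x ∈ G.cl j a, z' x - ∑ x ∈ G.cl j a, z x| ≤ c * earthmover z z' := by
  have := sum_cut_le_earthmover ((Icc 1 G.height).sigma fun j => G.nodes j)
    (fun i => G.cl i.1 i.2) (fun i => G.weight i.1 i.2) (fun i _ => (G.weight_pos _ _).le)
    (fun x y => (sum_cut_le_treeDist x y).trans (hG x y)) hc hk hz hz' hs hs'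
  rwa [sum_sigma] at this

/-- Two threshold functions differ exactly at the ranks between the thresholds, and ranks are
distinct in a cluster. -/
theorem sum_cl_abs_threshold (j : ℕ) (a : C) (m m' : ℕ) :
    ∑ x ∈ G.cl j a, |(if G.rank j x < m' then (0 : ℝ) else 1) - if G.rank j x < m then 0 else 1| ≤
      |(m' : ℝ) - m| := by
  have h1 : ∀ x ∈ G.cl j a,
      |(if G.rank j x < m' then (0 : ℝ) else 1) - if G.rank j x < m then 0 else 1| =
      if min m m' ≤ G.rank j x ∧ G.rank j x < max m m' then 1 else 0 := by
    intro x _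
    split_ifs <;> first | (exfalso; omega) | norm_num
  rw [sum_congr rfl h1, ← sum_filter, sum_const, nsmul_eq_mul, mul_one,
    card_filter_rank j a fun i => min m m' ≤ i ∧ i < max m m']
  have h2 : ((range (G.cl j a).card).filter fun i => min m m' ≤ i ∧ i < max m m').card ≤
      max m m' - min m m' := by
    rw [← Nat.card_Ico]
    refine card_le_card fun i hi => ?_
    rw [mem_filter] at hi
    exact mem_Ico.2 hi.2
  refine (Nat.cast_le.2 h2).trans ?_
  rcases le_total m m' with h | h
  · rw [max_eq_right h, min_eq_left h, Nat.cast_sub h]; exact le_abs_self _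
  · rw [max_eq_left h, min_eq_right h, Nat.cast_sub h, abs_sub_comm]; exact le_abs_self _

theorem sum_abs_opt_le [MetricSpace X] {c : ℝ} (hc : 0 < c)
    (hG : ∀ x y, G.treeDist x y ≤ c * dist x y) {B B' : Finset X} (hB : 0 < B.card)
    (hBB : B'.card = B.card) :
    ∑ j ∈ Icc 1 G.height, ∑ x, G.wt j x * |G.opt κ B' j x - G.opt κ B j x| ≤
      c * earthmover (serverMass B) (serverMass B') := by
  refine le_trans (sum_le_sum fun j hj => ?_) (sum_nodes_le_earthmover hc hG
    (k := B.card) (by exact_mod_cast hB) (serverMass_nonneg B) (serverMass_nonneg B')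
    (sum_univ_serverMass B) (by rw [sum_univ_serverMass, hBB]))
  rw [← sum_nodes (G := G) j]
  refine sum_le_sum fun a _ => ?_
  rw [sum_serverMass, sum_serverMass]
  calc ∑ x ∈ G.cl j a, G.wt j x * |G.opt κ B' j x - G.opt κ B j x|
      = G.weight j a * ∑ x ∈ G.cl j a, |(if G.rank j x < (B' ∩ G.cl j a).card then (0 : ℝ) else 1) -
          if G.rank j x < (B ∩ G.cl j a).card then 0 else 1| := by
        rw [mul_sum]
        refine sum_congr rfl fun x hx => ?_
        rw [opt_eq hj, opt_eq hj, wt, mem_cl.1 hx]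
    _ ≤ _ := mul_le_mul_of_nonneg_left (sum_cl_abs_threshold j a _ _) (G.weight_pos j a).le

end Hierarchy

/-- The value log(v + δ) lies between log δ and log(1 + δ), an interval of length log(1 + 1/δ). As δ
≤ 1 this length is at least 1/2, which lets the factor 2 absorb the remaining terms. -/
theorem breg_flip_le {δ p q v : ℝ} (hδ : 0 < δ) (hδ1 : δ ≤ 1) (hp : p = 0 ∨ p = 1)
    (hq : q = 0 ∨ q = 1) (hv : 0 ≤ v) (hv1 : v ≤ 1) :
    breg δ q v - breg δ p v ≤ 2 * Real.log (1 + 1 / δ) * |q - p| := by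
  have hL : Real.log (1 + 1 / δ) = Real.log (1 + δ) - Real.log δ := by
    rw [← Real.log_div (by positivity) hδ.ne']; congr 1; field_simp; ring
  have h1 : Real.log δ ≤ Real.log (v + δ) := Real.log_le_log hδ (by linarith)
  have h2 : Real.log (v + δ) ≤ Real.log (1 + δ) := Real.log_le_log (by linarith) (by linarith)
  have h3 : 1 / 2 ≤ Real.log (1 + δ) - Real.log δ := by
    rw [← hL]
    have h2 : Real.log 2 ≤ Real.log (1 + 1 / δ) :=
      Real.log_le_log (by norm_num) (by have := one_le_one_div hδ hδ1; linarith)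
    linarith [Real.log_two_gt_d9]
  have h4 := mul_nonneg hδ.le (show 0 ≤ Real.log (1 + δ) - Real.log δ by linarith)
  have h5 := mul_nonneg (sub_nonneg.2 hδ1) (show 0 ≤ Real.log (1 + δ) - Real.log δ by linarith)
  rw [hL]
  unfold breg
  rcases hp with rfl | rfl <;> rcases hq with rfl | rfl
  · simp
  · norm_num; nlinarith
  · norm_num; nlinarith
  · simp

namespace Hierarchy

variable {X C : Type*} [Fintype X] [DecidableEq X] [DecidableEq C] {G : Hierarchy X C}
  {κ : ℕ} {τ δ : ℝ} {r : X} {u v : ℕ → X → ℝ} {B : Finset X}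

theorem opt_eq_zero_or_one (j : ℕ) (x : X) : G.opt κ B j x = 0 ∨ G.opt κ B j x = 1 := by
  unfold opt; split_ifs <;> simp

/-- The divergence from the offline servers changes by at most their movement, up to a factor
`2 * log (1 + 1 / δ)`. -/
theorem div_opt_sub_le [MetricSpace X] {c : ℝ} (hc : 0 < c)
    (hG : ∀ x y, G.treeDist x y ≤ c * dist x y) {B B' : Finset X} (hB : 0 < B.card)
    (hBB : B'.card = B.card) (hδ : 0 < δ) (hδ1 : δ ≤ 1) (hv : ∀ j x, 0 ≤ v j x)
    (hv1 : ∀ j x, v j x ≤ 1) :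
    G.div δ (G.opt κ B') v - G.div δ (G.opt κ B) v ≤
      2 * Real.log (1 + 1 / δ) * (c * earthmover (serverMass B) (serverMass B')) := by
  have hL : 0 ≤ 2 * Real.log (1 + 1 / δ) := by
    have := Real.log_nonneg (show 1 ≤ 1 + 1 / δ by have := one_div_pos.2 hδ; linarith)
    positivity
  refine le_trans ?_ (mul_le_mul_of_nonneg_left (sum_abs_opt_le (κ := κ) hc hG hB hBB) hL)
  unfold div
  simp only [← sum_sub_distrib, mul_sum]
  refine sum_le_sum fun j _ => sum_le_sum fun x _ => ?_
  have := mul_le_mul_of_nonneg_left (breg_flip_le (v := v j x) hδ hδ1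
    (opt_eq_zero_or_one (G := G) (κ := κ) (B := B) j x)
    (opt_eq_zero_or_one (G := G) (κ := κ) (B := B') j x) (hv j x) (hv1 j x)) (G.wt_pos j x).le
  linarith

end Hierarchy

/-! ### The online algorithm and its potential argument -/

namespace Hierarchy

variable {X C : Type*} [Fintype X] [DecidableEq X] [DecidableEq C] {G : Hierarchy X C}
  {κ : ℕ} {τ : ℝ} {r : X} {u v : ℕ → X → ℝ} {B : Finset X}

variable (G) in
/-- The server masses of a state, scaled by `s`. -/
def toMass (s : ℝ) (y : ℕ → X → ℝ) (x : X) : ℝ := (1 - y G.height x) * s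

variable (G) in
/-- One step of the algorithm. -/
noncomputable def step (κ : ℕ) (τ : ℝ) (v : ℕ → X → ℝ) (r : X) : ℕ → X → ℝ :=
  open Classical in if h : ∃ u, G.IsProjection κ τ τ r v u then h.choose else v

variable (G) in
/-- The state of the algorithm after a history of requests. -/
noncomputable def run (κ : ℕ) (τ : ℝ) (l : List X) : ℕ → X → ℝ := l.foldl (G.step κ τ) (G.init κ)

theorem run_append (l : List X) (r : X) :
    G.run κ τ (l ++ [r]) = G.step κ τ (G.run κ τ l) r := by simp [run]

theorem isProjection_step (hτ : 0 ≤ τ) (hH : 1 ≤ G.height) (hκ : 1 ≤ κ) (v : ℕ → X → ℝ) (r : X) :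
    G.IsProjection κ τ τ r v (G.step κ τ v r) := by
  have h : ∃ u, G.IsProjection κ τ τ r v u :=
    exists_isProjection v ⟨_, opt_mem_candidates (B := {r}) hτ hH (by simpa using hκ) (by simp)⟩
  unfold step
  rw [dif_pos h]
  exact h.choose_spec

/-- The parameters of the algorithm. -/
structure Params (G : Hierarchy X C) (k κ : ℕ) (τ : ℝ) : Prop where
  height : 1 ≤ G.height
  one_le : 1 ≤ κ
  lt : κ < k
  le_card : k ≤ Fintype.card X
  le_two : k ≤ 2 * κ
  eq : τ = 1 - κ / k

namespace Params

variable {k : ℕ} (h : Params G k κ τ)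
include h

theorem k_pos : (0 : ℝ) < k := by have := h.one_le.trans_lt h.lt; positivity

theorem κ_pos : (0 : ℝ) < κ := by have := h.one_le; positivity

theorem τ_pos : 0 < τ := by
  rw [h.eq, sub_pos, div_lt_one h.k_pos]; exact_mod_cast h.lt

theorem τ_le_half : τ ≤ 1 / 2 := by
  have : (1 : ℝ) / 2 ≤ κ / k := by
    rw [div_le_div_iff₀ two_pos h.k_pos]
    have : (k : ℝ) ≤ 2 * κ := by exact_mod_cast h.le_two
    linarith
  rw [h.eq]; linarith

theorem scale : (1 - τ) * (k / κ : ℝ) = 1 := by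
  have := h.k_pos; have := h.κ_pos
  rw [h.eq]; field_simp; ring

theorem scale_nonneg : (0 : ℝ) ≤ k / κ := by
  have := h.k_pos; have := h.κ_pos; positivity

theorem scale_le_two : (k / κ : ℝ) ≤ 2 := by
  rw [div_le_iff₀ h.κ_pos]; exact_mod_cast h.le_two

theorem isState_run (l : List X) : G.IsState κ τ (G.run κ τ l) := by
  induction l using List.reverseRecOn with
  | nil =>
    have hkn : (k : ℝ) ≤ Fintype.card X := by exact_mod_cast h.le_card
    have hn : (0 : ℝ) < Fintype.card X := h.k_pos.trans_le hkn
    refine isState_init (h.lt.le.trans h.le_card) (by exact_mod_cast hn) ?_ h.height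
    rw [h.eq]
    have := div_le_div_of_nonneg_left h.κ_pos.le h.k_pos hkn
    linarith
  | append_singleton l r ih =>
    rw [run_append]
    exact (isProjection_step h.τ_pos.le h.height h.one_le _ r).isState h.τ_pos ih h.height

theorem toMass_nonneg (hv : G.IsState κ τ v) (x : X) : 0 ≤ G.toMass (k / κ) v x :=
  mul_nonneg (by linarith [hv.le_one G.height x]) h.scale_nonneg

theorem toMass_le_one (hv : G.IsState κ τ v) (x : X) : G.toMass (k / κ) v x ≤ 1 := by
  rw [← h.scale]
  exact mul_le_mul_of_nonneg_right (by linarith [hv.leaf x]) h.scale_nonneg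

theorem sum_toMass (hv : G.IsState κ τ v) : ∑ x, G.toMass (k / κ) v x = k := by
  have hn : 0 < Fintype.card X := (h.one_le.trans h.lt.le).trans h.le_card
  have : Nonempty X := Fintype.card_pos_iff.1 hn
  unfold toMass
  rw [← sum_mul, sum_sub_distrib, hv.sum_eq le_rfl (h.lt.le.trans h.le_card), sum_const, card_univ,
    nsmul_eq_mul, mul_one, sub_sub_cancel, mul_div_cancel₀ _ h.κ_pos.ne']

theorem toMass_request (hv : G.IsState κ τ v) (hu : G.IsProjection κ τ τ r v u) :
    G.toMass (k / κ) u r = 1 := by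
  rw [toMass, hu.leaf_request h.τ_pos hv h.height, h.scale]

/-- The fractional algorithm with initial state `A`. -/
noncomputable def algorithm (A : Finset X) (hA : A.card = k) : FractionalAlgorithm X k where
  -- The underlying run starts at the uniform state and ignores `A`. Only the empty history shows
  -- `A`, so the first request pays for a jump of cost at most k times the diameter.
  state := fun l => open Classical in if l = [] then serverMass A else G.toMass (k / κ) (G.run κ τ l)
  nonneg := fun l x => by
    split_ifs
    · exact serverMass_nonneg A x
    · exact h.toMass_nonneg (h.isState_run l) x
  le_one := fun l x => by
    split_ifs
    · exact serverMass_le_one A x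
    · exact h.toMass_le_one (h.isState_run l) x
  total := fun l => by
    split_ifs
    · rw [sum_univ_serverMass, hA]
    · exact h.sum_toMass (h.isState_run l)
  serves := fun l r => by
    rw [if_neg (by simp), run_append]
    exact h.toMass_request (h.isState_run l) (isProjection_step h.τ_pos.le h.height h.one_le _ r)

end Params

theorem requestHistory_succ {X : Type*} (r : ℕ → X) (t : ℕ) :
    requestHistory r (t + 1) = requestHistory r t ++ [r t] := by
  simp [requestHistory, List.range_succ]

/-- A potential argument: it suffices to bound the cost of a single step. -/
theorem Params.competitive_of_step [MetricSpace X] {k : ℕ} (h : Params G k κ τ) {c : ℝ} (hc : 0 < c)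
    (hG : ∀ x y, G.treeDist x y ≤ c * dist x y) {Φ : (ℕ → X → ℝ) → ℝ} {lo hi α : ℝ} (hα : 0 ≤ α)
    (hlo : ∀ y, G.IsState κ τ y → lo ≤ Φ y) (hhi : ∀ y, G.IsState κ τ y → Φ y ≤ hi)
    (hstep : ∀ r v u B, G.IsState κ τ v → G.IsProjection κ τ τ r v u → B.card ≤ κ → r ∈ B →
      earthmover (G.toMass (k / κ) v) (G.toMass (k / κ) u) ≤
        Φ u - Φ v + α * (G.div τ (G.opt κ B) v - G.div τ (G.opt κ B) u))
    {m : ℕ} (hm : 1 ≤ m) (hmκ : m ≤ κ) :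
    ∃ C', ∀ (A : Finset X) (hA : A.card = k),
      (h.algorithm A hA).IsCompetitive m (α * (2 * Real.log (1 + 1 / τ) * c)) C' := by
  obtain ⟨W, hW⟩ := (Set.finite_range fun B : Finset X => G.div τ (G.opt κ B) (G.init κ)).bddAbove
  obtain ⟨b, hb⟩ := (Set.finite_range fun p : X × X => dist p.1 p.2).bddAbove
  have hW : ∀ B, G.div τ (G.opt κ B) (G.init κ) ≤ W := fun B => hW ⟨B, rfl⟩
  have hb : ∀ x y : X, dist x y ≤ b := fun x y => hb ⟨(x, y), rfl⟩
  -- The three terms pay for the initial jump, the range of the potential, and the initial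
  -- divergence from the adversary's arbitrary starting set.
  refine ⟨k * b + (hi - lo) + α * W, fun A hA r T B hB => ?_⟩
  set y : ℕ → ℕ → X → ℝ := fun t => G.run κ τ (requestHistory r t) with hy
  have hys : ∀ t, G.IsState κ τ (y t) := fun t => h.isState_run _
  have hyp : ∀ t, G.IsProjection κ τ τ (r t) (y t) (y (t + 1)) := fun t => by
    simp only [hy, requestHistory_succ, run_append]
    exact isProjection_step h.τ_pos.le h.height h.one_le _ _
  have hstate : ∀ t, (h.algorithm A hA).state (requestHistory r (t + 1)) =
      G.toMass (k / κ) (y (t + 1)) := fun t => by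
    simp only [Params.algorithm]
    rw [if_neg (by simp [requestHistory_succ])]
  have hL : 0 ≤ 2 * Real.log (1 + 1 / τ) := by
    have := Real.log_nonneg (show 1 ≤ 1 + 1 / τ by have := one_div_pos.2 h.τ_pos; linarith)
    positivity
  have hterm : ∀ t < T, earthmover ((h.algorithm A hA).state (requestHistory r t))
      ((h.algorithm A hA).state (requestHistory r (t + 1))) ≤
      (if t = 0 then k * b else 0) + (Φ (y (t + 1)) - Φ (y t)) +
        α * ((G.div τ (G.opt κ (B t)) (y t) - G.div τ (G.opt κ (B (t + 1))) (y (t + 1))) +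
          2 * Real.log (1 + 1 / τ) *
            (c * earthmover (serverMass (B t)) (serverMass (B (t + 1))))) := by
    intro t ht
    have h1 := hstep (r t) (y t) (y (t + 1)) (B (t + 1)) (hys t) (hyp t)
      (by rw [hB.1]; exact hmκ) (hB.2 t ht)
    have h2 := mul_le_mul_of_nonneg_left (div_opt_sub_le (κ := κ) (v := y t) hc hG (B := B t)
      (B' := B (t + 1)) (by rw [hB.1]; omega) (by rw [hB.1, hB.1]) h.τ_pos
      (h.τ_le_half.trans (by norm_num)) (hys t).nonneg (hys t).le_one) hα
    rcases Nat.eq_zero_or_pos t with rfl | ht0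
    · have h3 := earthmover_le_mul h.k_pos ((h.algorithm A hA).nonneg (requestHistory r 0))
        ((h.algorithm A hA).nonneg (requestHistory r (0 + 1)))
        ((h.algorithm A hA).total _) ((h.algorithm A hA).total _) hb
      have h4 := earthmover_nonneg (G.toMass (k / κ) (y 0)) (G.toMass (k / κ) (y (0 + 1)))
      rw [if_pos rfl]
      linarith
    · obtain ⟨t, rfl⟩ : ∃ t', t = t' + 1 := ⟨t - 1, by omega⟩
      rw [hstate t, hstate (t + 1), if_neg (by omega)]
      linarith
  have hsum := sum_le_sum fun t ht => hterm t (mem_range.1 ht)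
  unfold FractionalAlgorithm.cost movementCost
  refine hsum.trans ?_
  simp only [sum_add_distrib, ← mul_sum]
  rw [sum_range_sub fun t => Φ (y t), sum_range_sub' fun t => G.div τ (G.opt κ (B t)) (y t)]
  have h1 : ∑ t ∈ range T, (if t = 0 then (k : ℝ) * b else 0) ≤ k * b := by
    obtain ⟨x⟩ : Nonempty X := ⟨r 0⟩
    have hb0 : 0 ≤ b := dist_nonneg.trans (hb x x)
    rw [sum_ite_eq']
    split_ifs
    · exact le_rfl
    · have := h.k_pos; positivity
  have h2 := hhi _ (hys T)
  have h3 := hlo _ (hys 0)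
  have h4 : G.div τ (G.opt κ (B 0)) (y 0) - G.div τ (G.opt κ (B T)) (y T) ≤ W := by
    have := div_nonneg (G := G) h.τ_pos (opt_nonneg (G := G) (κ := κ) (B := B T)) (hys T).nonneg
    have := hW (B 0)
    simp only [hy] at *
    simp only [requestHistory, List.range_zero, List.map_nil, run, List.foldl_nil] at *
    linarith
  have h5 := mul_le_mul_of_nonneg_left h4 hα
  linarith

variable (G) in
/-- The mass of a cluster. -/
def mass (z : X → ℝ) (j : ℕ) (a : C) : ℝ := ∑ x ∈ G.cl j a, z x

/-- The cost of a step in terms of the mass that enters the clusters of the requested point. -/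
theorem earthmover_le_of_sink [MetricSpace X] {c : ℝ} (hc : 0 ≤ c)
    (hG : ∀ x y, dist x y ≤ c * G.treeDist x y) {z z' : X → ℝ}
    (hz : ∀ x, 0 ≤ z x) (hz' : ∀ x, 0 ≤ z' x) (hs : ∑ x, z x = ∑ x, z' x)
    (hle : ∀ x, x ≠ r → z' x ≤ z x) :
    earthmover z z' ≤ c * ∑ j ∈ Icc 1 G.height, (∑ x, G.wt j x * (z x - z' x) +
      2 * (G.wt j r * (G.mass z' j (G.node j r) - G.mass z j (G.node j r)))) := by
  refine (earthmover_le_of_single_sink r hz hz' hs hle).trans ?_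
  have h1 : ∀ x, (z x - z' x) * dist x r ≤ c * ((z x - z' x) * G.treeDist x r) := by
    intro x
    by_cases hx : x = r
    · subst hx; simp [treeDist]
    · have := mul_le_mul_of_nonneg_left (hG x r) (sub_nonneg.2 (hle x hx))
      linarith
  refine (sum_le_sum fun x _ => h1 x).trans ?_
  rw [← mul_sum]
  refine mul_le_mul_of_nonneg_left (le_of_eq ?_) hc
  unfold treeDist
  simp only [mul_sum]
  rw [sum_comm]
  refine sum_congr rfl fun j _ => ?_
  -- Each level that separates `x` from `r` contributes both weights. Extending the sum to all
  -- points makes the `wt j r` part vanish, as totals agree, and leaves the inflow into the cluster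
  -- of `r` twice.
  have h2 : ∀ x, (z x - z' x) * (if G.node j x = G.node j r then 0 else G.wt j x + G.wt j r) =
      G.wt j x * (z x - z' x) + G.wt j r * (z x - z' x) -
        if G.node j x = G.node j r then 2 * (G.wt j r * (z x - z' x)) else 0 := by
    intro x
    split_ifs with h
    · have : G.wt j x = G.wt j r := by unfold wt; rw [h]
      rw [this]; ring
    · ring
  simp only [h2, sum_sub_distrib, sum_add_distrib]
  rw [← mul_sum, sum_sub_distrib, hs, sub_self, mul_zero, add_zero, ← sum_filter, mass, mass]
  rw [show (univ.filter fun x => G.node j x = G.node j r) = G.cl j (G.node j r) from rfl,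
    ← sum_sub_distrib, ← mul_sum, ← mul_sum, sum_sub_distrib, sum_sub_distrib]
  ring

/-- By conservation the missing mass of a cluster can be read on its own level instead of at the
leaves; the inflow is therefore bounded by the positive parts of v - u on that level. -/
theorem Params.wt_mass_le {k : ℕ} (h : Params G k κ τ) (hv : G.IsState κ τ v)
    (hu : G.IsState κ τ u) {j : ℕ} (hj : j ≤ G.height) :
    G.wt j r * (G.mass (G.toMass (k / κ) u) j (G.node j r) -
      G.mass (G.toMass (k / κ) v) j (G.node j r)) ≤
      k / κ * ∑ x, G.wt j x * max (v j x - u j x) 0 := by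
  have h1 : G.mass (G.toMass (k / κ) u) j (G.node j r) -
      G.mass (G.toMass (k / κ) v) j (G.node j r) =
      k / κ * ∑ x ∈ G.cl j (G.node j r), (v j x - u j x) := by
    unfold mass toMass
    rw [← sum_sub_distrib, sum_sub_distrib (s := G.cl j _) (v j), ← hv.sum_cl_eq hj le_rfl,
      ← hu.sum_cl_eq hj le_rfl, ← sum_sub_distrib, mul_sum]
    exact sum_congr rfl fun x _ => by ring
  rw [h1, mul_left_comm]
  refine mul_le_mul_of_nonneg_left ?_ h.scale_nonneg
  rw [mul_sum]
  calc ∑ x ∈ G.cl j (G.node j r), G.wt j r * (v j x - u j x)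
      ≤ ∑ x ∈ G.cl j (G.node j r), G.wt j x * max (v j x - u j x) 0 :=
        sum_le_sum fun x hx => by
          have : G.wt j x = G.wt j r := by unfold wt; rw [mem_cl.1 hx]
          rw [this]
          exact mul_le_mul_of_nonneg_left (le_max_left _ _) (G.wt_pos j r).le
    _ ≤ _ := sum_le_sum_of_subset_of_nonneg (subset_univ _) fun x _ _ =>
        mul_nonneg (G.wt_pos j x).le (le_max_right _ _)

theorem Params.toMass_le {k : ℕ} (h : Params G k κ τ) (hv : G.IsState κ τ v)
    (hu : G.IsProjection κ τ τ r v u) {x : X} (hx : x ≠ r) :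
    G.toMass (k / κ) u x ≤ G.toMass (k / κ) v x :=
  mul_le_mul_of_nonneg_right (by linarith [hu.leaf_mono h.τ_pos hv h.height hx]) h.scale_nonneg

/-- The fractional algorithm loses a factor of the height of the hierarchy. -/
theorem Params.competitive_height [MetricSpace X] {k : ℕ} (h : Params G k κ τ) {c c' : ℝ}
    (hc : 0 < c) (hc' : 0 ≤ c') (hG : ∀ x y, G.treeDist x y ≤ c * dist x y)
    (hG' : ∀ x y, dist x y ≤ c' * G.treeDist x y) {m : ℕ} (hm : 1 ≤ m) (hmκ : m ≤ κ) :
    ∃ C', ∀ (A : Finset X) (hA : A.card = k),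
      (h.algorithm A hA).IsCompetitive m
        ((8 * c' * G.height) * (2 * Real.log (1 + 1 / τ) * c)) C' := by
  set s : ℝ := k / κ with hsdef
  -- The potential collects what telescopes: the leaf terms of `earthmover_le_of_sink` and the
  -- deeper levels in `inflow_le`, summed over all levels.
  set Φ : (ℕ → X → ℝ) → ℝ := fun y => c' * s * ∑ j ∈ Icc 1 G.height,
    (∑ x, G.wt j x * y G.height x +
      2 * ∑ i ∈ Icc (j + 1) G.height, ∑ x, G.wt i x * y i x) with hΦ
  have hmono : ∀ y y' : ℕ → X → ℝ, (∀ j x, y j x ≤ y' j x) → Φ y ≤ Φ y' := by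
    intro y y' hyy
    refine mul_le_mul_of_nonneg_left (sum_le_sum fun j _ => add_le_add
      (sum_le_sum fun x _ => mul_le_mul_of_nonneg_left (hyy _ _) (G.wt_pos j x).le)
      (mul_le_mul_of_nonneg_left (sum_le_sum fun i _ => sum_le_sum fun x _ =>
        mul_le_mul_of_nonneg_left (hyy _ _) (G.wt_pos i x).le) two_pos.le))
      (mul_nonneg hc' h.scale_nonneg)
  refine h.competitive_of_step hc hG (Φ := Φ) (lo := Φ 0) (hi := Φ 1) (by positivity)
    (fun y hy => hmono _ _ hy.nonneg) (fun y hy => hmono _ _ hy.le_one) ?_ hm hmκ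
  intro r v u B hv hu hB hr
  have hus := hu.isState h.τ_pos hv h.height
  have h1 := earthmover_le_of_sink hc' hG' (h.toMass_nonneg hv) (h.toMass_nonneg hus)
    (by rw [h.sum_toMass hv, h.sum_toMass hus]) (fun x hx => h.toMass_le hv hu hx)
  refine h1.trans ?_
  set drop := G.div τ (G.opt κ B) v - G.div τ (G.opt κ B) u with hdrop
  have h2 : ∀ j ∈ Icc 1 G.height, ∑ x, G.wt j x * (G.toMass s v x - G.toMass s u x) +
      2 * (G.wt j r * (G.mass (G.toMass s u) j (G.node j r) -
        G.mass (G.toMass s v) j (G.node j r))) ≤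
      s * (((∑ x, G.wt j x * u G.height x +
        2 * ∑ i ∈ Icc (j + 1) G.height, ∑ x, G.wt i x * u i x) -
        (∑ x, G.wt j x * v G.height x +
        2 * ∑ i ∈ Icc (j + 1) G.height, ∑ x, G.wt i x * v i x)) + 4 * drop) := by
    intro j hj
    have h3 := (h.wt_mass_le (r := r) hv hus (mem_Icc.1 hj).2).trans (mul_le_mul_of_nonneg_left
      (hu.inflow_le h.τ_pos hv hB hr hj) h.scale_nonneg)
    have h4 : ∑ x, G.wt j x * (G.toMass s v x - G.toMass s u x) =
        s * (∑ x, G.wt j x * u G.height x - ∑ x, G.wt j x * v G.height x) := by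
      rw [← sum_sub_distrib, mul_sum]
      exact sum_congr rfl fun x _ => by unfold toMass; ring
    rw [h4]
    simp only [mul_sub, sum_sub_distrib] at h3 ⊢
    linarith
  have h5 := mul_le_mul_of_nonneg_left (sum_le_sum h2) hc'
  refine h5.trans ?_
  -- On the deepest level the inflow inequality has no telescoping term.
  have h6 : 0 ≤ drop := by
    have := hu.inflow_le h.τ_pos hv hB hr (mem_Icc.2 ⟨h.height, le_refl G.height⟩)
    have h7 : 0 ≤ ∑ x, G.wt G.height x * max (v G.height x - u G.height x) 0 :=
      sum_nonneg fun x _ => mul_nonneg (G.wt_pos _ x).le (le_max_right _ _)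
    rw [Icc_eq_empty (by omega), sum_empty] at this
    linarith
  rw [← mul_sum, sum_add_distrib, sum_const, nsmul_eq_mul, Nat.card_Icc, sum_sub_distrib]
  -- Per level: twice the inflow, which costs 2 s drop, with s ≤ 2.
  have h7 : c' * (s * ((G.height + 1 - 1 : ℕ) * (4 * drop))) ≤ 8 * c' * G.height * drop := by
    have : s * (4 * c' * G.height * drop) ≤ 2 * (4 * c' * G.height * drop) :=
      mul_le_mul_of_nonneg_right h.scale_le_two (by positivity)
    rw [Nat.add_sub_cancel]
    linarith
  simp only [hΦ]
  rw [mul_add s, mul_add c']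
  have h8 : ∀ a b : ℝ, c' * s * a - c' * s * b = c' * (s * (a - b)) := fun a b => by ring
  rw [h8]
  linarith

end Hierarchy

/-! ### From the height to log k -/

/-- The number of times a decreasing sequence is halved while it is at least `1 / 2`. -/
theorem two_pow_card_halvings_le {m : ℕ → ℝ} {k : ℝ} (h0 : m 0 ≤ k) (hk : 1 ≤ k)
    (hmono : ∀ j, m (j + 1) ≤ m j) (n : ℕ) :
    (2 : ℝ) ^ ((range n).filter fun j => m (j + 1) < m j / 2 ∧ 1 / 2 ≤ m j).card ≤ 4 * k := by
  -- A counted step doubles the power and more than halves m, so their product stays at most k.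
  -- Before a counted step m is at least 1/2, so the power is at most 2k and becomes at most 4k.
  have key : m n * (2 : ℝ) ^ ((range n).filter fun j => m (j + 1) < m j / 2 ∧ 1 / 2 ≤ m j).card ≤ k
      ∧ (2 : ℝ) ^ ((range n).filter fun j => m (j + 1) < m j / 2 ∧ 1 / 2 ≤ m j).card ≤ 4 * k := by
    induction n with
    | zero => simp; constructor <;> linarith
    | succ n ih =>
      rw [range_add_one, filter_insert]
      set c := ((range n).filter fun j => m (j + 1) < m j / 2 ∧ 1 / 2 ≤ m j).card with hc
      have hpos : (0 : ℝ) < 2 ^ c := by positivity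
      split_ifs with h
      · rw [card_insert_of_notMem (by simp), pow_succ]
        constructor
        · nlinarith [ih.1]
        · nlinarith [ih.1]
      · exact ⟨(mul_le_mul_of_nonneg_right (hmono n) hpos.le).trans ih.1, ih.2⟩
  exact key.2

/-- A sibling of the requested child, which itself does not gain, raises the potential only through
the cap M/2. If the cap is active then m/M ≥ 1/2, so the rise is at most its share m/M of the inflow
into the parent; these shares sum to at most 1. -/
theorem min_sub_min_half_le {m M M' : ℝ} (hm : 0 ≤ m) (hM : 0 < M) (hMM : M ≤ M') {m' : ℝ}
    (hmm : m' ≤ m) : min m' (M' / 2) - min m (M / 2) ≤ m / M * (M' - M) := by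
  have h0 : 0 ≤ m / M * (M' - M) := mul_nonneg (div_nonneg hm hM.le) (by linarith)
  rcases le_total m (M / 2) with h | h
  · rw [min_eq_left h]
    linarith [min_le_left m' (M' / 2)]
  · rw [min_eq_right h]
    have h1 : 1 / 2 ≤ m / M := by rw [div_le_div_iff₀ two_pos hM]; linarith
    have h2 := mul_le_mul_of_nonneg_right h1 (sub_nonneg.2 hMM)
    linarith [min_le_right m' (M' / 2)]

namespace Hierarchy

variable {X C : Type*} [Fintype X] [DecidableEq X] [DecidableEq C] {G : Hierarchy X C}
  {κ : ℕ} {τ : ℝ} {r : X} {u v : ℕ → X → ℝ} {B : Finset X} {z z' : X → ℝ}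

variable (G) in
/-- The contribution of level `j + 1` to the potential `lightPot`. -/
noncomputable def lightPotLevel (z : X → ℝ) (j : ℕ) : ℝ :=
  ∑ a ∈ G.nodes (j + 1), min (G.mass z (j + 1) a) (G.mass z j (G.parent j a) / 2)

variable (G) in
/-- The weighted mass in the clusters that hold less than half of the mass of their parent. -/
noncomputable def lightPot (ω : ℕ → ℝ) (z : X → ℝ) : ℝ :=
  ∑ j ∈ range G.height, ω (j + 1) * G.lightPotLevel z j

theorem mem_nodes (j : ℕ) (x : X) : G.node j x ∈ G.nodes j := mem_image_of_mem _ (mem_univ x)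

theorem mass_nonneg (hz : ∀ x, 0 ≤ z x) (j : ℕ) (a : C) : 0 ≤ G.mass z j a :=
  sum_nonneg fun x _ => hz x

theorem mass_children (z : X → ℝ) (j : ℕ) (r : X) :
    ∑ a ∈ (G.nodes (j + 1)).filter (fun a => G.parent j a = G.node j r), G.mass z (j + 1) a =
      G.mass z j (G.node j r) := by
  unfold mass
  rw [sum_cl_fiberwise (Nat.le_succ j)]
  refine sum_congr ?_ fun _ _ => rfl
  ext a
  rw [mem_filter, nodes, mem_image, mem_image]
  constructor
  · rintro ⟨⟨x, -, rfl⟩, h⟩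
    rw [G.parent_node] at h
    exact ⟨x, mem_cl.2 h, rfl⟩
  · rintro ⟨x, hx, rfl⟩
    exact ⟨⟨x, mem_univ x, rfl⟩, by rw [G.parent_node, mem_cl.1 hx]⟩

theorem mass_le_of_ne (hle : ∀ x, x ≠ r → z' x ≤ z x) {j : ℕ} {a : C} (ha : a ≠ G.node j r) :
    G.mass z' j a ≤ G.mass z j a :=
  sum_le_sum fun x hx => hle x fun h => ha (by rw [← h, mem_cl.1 hx])

/-- The mass that enters the cluster of `r` comes from outside. -/
theorem mass_sub_eq (hs : ∑ x, z x = ∑ x, z' x) (j : ℕ) :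
    G.mass z' j (G.node j r) - G.mass z j (G.node j r) =
      ∑ x ∈ univ \ G.cl j (G.node j r), (z x - z' x) := by
  have h1 := sum_sdiff (f := z) (subset_univ (G.cl j (G.node j r)))
  have h2 := sum_sdiff (f := z') (subset_univ (G.cl j (G.node j r)))
  unfold mass
  rw [sum_sub_distrib]
  linarith

theorem mass_mono (hs : ∑ x, z x = ∑ x, z' x) (hle : ∀ x, x ≠ r → z' x ≤ z x) (j : ℕ) :
    G.mass z j (G.node j r) ≤ G.mass z' j (G.node j r) := by
  rw [← sub_nonneg, mass_sub_eq hs]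
  refine sum_nonneg fun x hx => sub_nonneg.2 (hle x fun h => ?_)
  rw [h, mem_sdiff, mem_cl] at hx
  exact hx.2 rfl

/-- The change of the potential on one level. -/
theorem lightPotLevel_sub_le (hz : ∀ x, 0 ≤ z x)
    (hs : ∑ x, z x = ∑ x, z' x) (hle : ∀ x, x ≠ r → z' x ≤ z x) (j : ℕ) :
    (G.mass z j (G.node j r) / 2 ≤ G.mass z (j + 1) (G.node (j + 1) r) →
      G.lightPotLevel z' j - G.lightPotLevel z j ≤
        2 * (G.mass z' j (G.node j r) - G.mass z j (G.node j r)) -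
        (G.mass z' (j + 1) (G.node (j + 1) r) - G.mass z (j + 1) (G.node (j + 1) r))) ∧
    (G.mass z (j + 1) (G.node (j + 1) r) < G.mass z j (G.node j r) / 2 →
      G.lightPotLevel z' j - G.lightPotLevel z j ≤
        (G.mass z' j (G.node j r) - G.mass z j (G.node j r)) +
        (G.mass z' (j + 1) (G.node (j + 1) r) - G.mass z (j + 1) (G.node (j + 1) r))) := by
  set p := G.node j r with hp
  set a := G.node (j + 1) r with ha
  set M := G.mass z j p with hM
  set M' := G.mass z' j p with hM'
  have hMM : M ≤ M' := mass_mono hs hle j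
  set f : C → ℝ := fun b => min (G.mass z' (j + 1) b) (G.mass z' j (G.parent j b) / 2) -
    min (G.mass z (j + 1) b) (G.mass z j (G.parent j b) / 2) with hf
  set F := (G.nodes (j + 1)).filter (fun b => G.parent j b = p) with hF
  have haF : a ∈ F := mem_filter.2 ⟨mem_nodes _ r, G.parent_node j r⟩
  have hother : ∀ b ∈ F.erase a, G.mass z' (j + 1) b ≤ G.mass z (j + 1) b := fun b hb =>
    mass_le_of_ne hle (ne_of_mem_erase hb)
  have hpar : ∀ b ∈ F, G.parent j b = p := fun b hb => (mem_filter.1 hb).2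
  -- Children of other parents, and these parents, only lose mass; their terms do not increase.
  have hsum : G.lightPotLevel z' j - G.lightPotLevel z j ≤ f a + ∑ b ∈ F.erase a, f b := by
    unfold lightPotLevel
    rw [← sum_sub_distrib, add_sum_erase _ _ haF]
    rw [← sum_filter_add_sum_filter_not (G.nodes (j + 1)) (fun b => G.parent j b = p)]
    have : ∑ b ∈ (G.nodes (j + 1)).filter (fun b => ¬ G.parent j b = p),
        (min (G.mass z' (j + 1) b) (G.mass z' j (G.parent j b) / 2) -
        min (G.mass z (j + 1) b) (G.mass z j (G.parent j b) / 2)) ≤ 0 := by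
      refine sum_nonpos fun b hb => ?_
      rw [mem_filter] at hb
      have h1 : G.mass z' (j + 1) b ≤ G.mass z (j + 1) b := mass_le_of_ne hle fun h => hb.2 (by
        rw [h, G.parent_node])
      have h2 : G.mass z' j (G.parent j b) ≤ G.mass z j (G.parent j b) := mass_le_of_ne hle hb.2
      linarith [min_le_min h1 (div_le_div_of_nonneg_right h2 two_pos.le)]
    linarith
  have hch := add_sum_erase F (G.mass z (j + 1)) haF
  have hch' := add_sum_erase F (G.mass z' (j + 1)) haF
  rw [mass_children] at hch hch'
  have hsib0 : ∀ b ∈ F.erase a, 0 ≤ G.mass z (j + 1) b := fun b _ => mass_nonneg hz _ _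
  constructor
  -- The requested child sits at its cap, hence gains at most half the parent's inflow. Each sibling
  -- is below the cap, so the potential records the full loss of the siblings, which is the child's
  -- inflow minus the parent's.
  · intro hheavy
    have h1 : f a ≤ (M' - M) / 2 := by
      simp only [hf]
      rw [hpar a haF, min_eq_right hheavy]
      linarith [min_le_right (G.mass z' (j + 1) a) (M' / 2)]
    have h2 : ∀ b ∈ F.erase a, f b ≤ G.mass z' (j + 1) b - G.mass z (j + 1) b := by
      intro b hb
      have h3 := single_le_sum hsib0 hb
      simp only [hf]
      rw [hpar b (mem_of_mem_erase hb), min_eq_left (show G.mass z (j + 1) b ≤ M / 2 by linarith)]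
      linarith [min_le_left (G.mass z' (j + 1) b) (M' / 2)]
    have h3 : ∑ b ∈ F.erase a, f b ≤
        ∑ b ∈ F.erase a, G.mass z' (j + 1) b - ∑ b ∈ F.erase a, G.mass z (j + 1) b := by
      rw [← sum_sub_distrib]
      exact sum_le_sum h2
    linarith
  · intro hlight
    have ha0 : 0 ≤ G.mass z (j + 1) a := mass_nonneg hz _ _
    have hMpos : 0 < M := by linarith
    have h1 : f a ≤ G.mass z' (j + 1) a - G.mass z (j + 1) a := by
      simp only [hf]
      rw [hpar a haF, min_eq_left hlight.le]
      linarith [min_le_left (G.mass z' (j + 1) a) (M' / 2)]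
    have h2 : ∀ b ∈ F.erase a, f b ≤ G.mass z (j + 1) b / M * (M' - M) := by
      intro b hb
      simp only [hf]
      rw [hpar b (mem_of_mem_erase hb)]
      exact min_sub_min_half_le (hsib0 b hb) hMpos hMM (hother b hb)
    have h3 := sum_le_sum h2
    rw [← sum_mul, ← sum_div] at h3
    have h4 : (∑ b ∈ F.erase a, G.mass z (j + 1) b) / M ≤ 1 := (div_le_one hMpos).2 (by linarith)
    have h5 := mul_le_mul_of_nonneg_right h4 (sub_nonneg.2 hMM)
    linarith

/-- If weights decrease geometrically, the total inflow is bounded by the inflow in the few levels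
where the mass is halved, up to a change of the potential. -/
theorem sum_inflow_le (hz : ∀ x, 0 ≤ z x) (hz' : ∀ x, 0 ≤ z' x)
    (hs : ∑ x, z x = ∑ x, z' x) (hle : ∀ x, x ≠ r → z' x ≤ z x) (hr : 1 ≤ z' r)
    {ω : ℕ → ℝ} (hω : ∀ j, 0 ≤ ω j) (hω' : ∀ j, 10 * ω (j + 1) ≤ ω j) {R N : ℝ} (hR : 0 ≤ R)
    (hin : ∀ j < G.height, ω (j + 1) * (G.mass z' (j + 1) (G.node (j + 1) r) -
      G.mass z (j + 1) (G.node (j + 1) r)) ≤ R)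
    (hN : (((range G.height).filter fun j =>
      G.mass z (j + 1) (G.node (j + 1) r) < G.mass z j (G.node j r) / 2 ∧
        1 / 2 ≤ G.mass z j (G.node j r)).card : ℝ) ≤ N) :
    ∑ j ∈ range G.height, ω (j + 1) * (G.mass z' (j + 1) (G.node (j + 1) r) -
      G.mass z (j + 1) (G.node (j + 1) r)) ≤
      2 * (G.lightPot ω z - G.lightPot ω z') + 4 * N * R := by
  set Δ : ℕ → ℝ := fun j => G.mass z' j (G.node j r) - G.mass z j (G.node j r) with hΔ
  have hΔ0 : Δ 0 = 0 := by
    simp only [hΔ]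
    rw [mass_sub_eq hs, cl_zero, Finset.sdiff_self, sum_empty]
  have hΔnn : ∀ j, 0 ≤ Δ j := fun j => sub_nonneg.2 (mass_mono hs hle j)
  have hlevel : ∀ j ∈ range G.height, ω (j + 1) * Δ (j + 1) ≤
      (ω (j + 1) * G.lightPotLevel z j - ω (j + 1) * G.lightPotLevel z' j) +
        1 / 2 * (ω j * Δ j) +
        if G.mass z (j + 1) (G.node (j + 1) r) < G.mass z j (G.node j r) / 2 ∧
          1 / 2 ≤ G.mass z j (G.node j r) then 2 * R else 0 := by
    intro j hj
    have hj := mem_range.1 hj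
    have hpot := lightPotLevel_sub_le (G := G) hz hs hle j
    -- The worst case costs five times the parent's inflow: once from the light bound, and 2 · 2
    -- when the child's inflow is at most twice the parent's. Decay by 10 turns this into the factor
    -- 1/2.
    have hgeo : 5 * (ω (j + 1) * Δ j) ≤ 1 / 2 * (ω j * Δ j) := by
      have := mul_le_mul_of_nonneg_right (hω' j) (hΔnn j)
      linarith
    have hd0 := mul_nonneg (hω (j + 1)) (hΔnn j)
    rcases le_or_gt (G.mass z j (G.node j r) / 2) (G.mass z (j + 1) (G.node (j + 1) r)) with h | h
    · have h1 := mul_le_mul_of_nonneg_left (hpot.1 h) (hω (j + 1))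
      rw [if_neg fun h' => absurd h'.1 (not_lt.2 h)]
      simp only [hΔ] at *
      linarith
    · have h1 := mul_le_mul_of_nonneg_left (hpot.2 h) (hω (j + 1))
      rcases lt_or_ge (G.mass z j (G.node j r)) (1 / 2) with h2 | h2
      · rw [if_neg fun h' => absurd h'.2 (not_le.2 h2)]
        have h3 : (1 : ℝ) ≤ G.mass z' (j + 1) (G.node (j + 1) r) :=
          hr.trans (single_le_sum (fun x _ => hz' x) (mem_cl.2 rfl))
        have h4 : G.mass z' (j + 1) (G.node (j + 1) r) ≤ G.mass z' j (G.node j r) :=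
          sum_le_sum_of_subset_of_nonneg (cl_subset_cl (Nat.le_succ j) r) fun x _ _ => hz' x
        have h5 := mass_nonneg (G := G) hz (j + 1) (G.node (j + 1) r)
        -- The parent held less than 1/2 and now holds at least 1, so it gained at least half of its
        -- new mass, which bounds half of the child's gain.
        have h6 : Δ (j + 1) ≤ 2 * Δ j := by simp only [hΔ]; linarith
        have h7 := mul_le_mul_of_nonneg_left h6 (hω (j + 1))
        simp only [hΔ] at *
        linarith
      · rw [if_pos ⟨h, h2⟩]
        have h3 := hin j hj
        simp only [hΔ] at *
        linarith
  have hsum := sum_le_sum hlevel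
  rw [sum_add_distrib, sum_add_distrib, sum_sub_distrib, ← mul_sum, ← sum_filter, sum_const,
    nsmul_eq_mul] at hsum
  -- The root cluster has no inflow, so the parents' sum is at most the children's sum and half of
  -- the latter can be absorbed.
  have hshift : ∑ j ∈ range G.height, ω j * Δ j ≤ ∑ j ∈ range G.height, ω (j + 1) * Δ (j + 1) := by
    have h1 := sum_range_succ (fun j => ω j * Δ j) G.height
    rw [sum_range_succ', hΔ0, mul_zero, add_zero] at h1
    have := mul_nonneg (hω G.height) (hΔnn G.height)
    linarith
  have hN' := mul_le_mul_of_nonneg_right hN (show 0 ≤ 2 * R by linarith)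
  unfold lightPot
  linarith

theorem sum_Icc_eq_range (f : ℕ → ℝ) (H : ℕ) : ∑ j ∈ Icc 1 H, f j = ∑ j ∈ range H, f (j + 1) := by
  induction H with
  | zero => simp
  | succ H ih => rw [sum_Icc_succ_top (by omega), ih, sum_range_succ]

theorem nat_le_five_log {n k : ℕ} (hk : 2 ≤ k) (h : (2 : ℝ) ^ n ≤ 4 * k) :
    (n : ℝ) ≤ 5 * Real.log k := by
  have hk' : (2 : ℝ) ≤ k := by exact_mod_cast hk
  have h1 := Real.log_le_log (by positivity) h
  rw [Real.log_pow, Real.log_mul (by norm_num) (by positivity)] at h1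
  have h2 : Real.log 4 = 2 * Real.log 2 := by
    rw [show (4 : ℝ) = 2 ^ 2 by norm_num, Real.log_pow]; norm_num
  have h3 := Real.log_le_log two_pos hk'
  have h4 := Real.log_two_gt_d9
  have h5 : (n : ℝ) * Real.log 2 ≤ 3 * Real.log k := by linarith
  have h6 := mul_le_mul_of_nonneg_left h4.le (Nat.cast_nonneg (α := ℝ) n)
  linarith

/-- On a hierarchy with uniform, geometrically decreasing weights the fractional algorithm loses a
factor of `log k` only. -/
theorem Params.competitive_log [MetricSpace X] {k : ℕ} (h : Params G k κ τ) {c c' : ℝ}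
    (hc : 0 < c) (hc' : 0 ≤ c') (hG : ∀ x y, G.treeDist x y ≤ c * dist x y)
    (hG' : ∀ x y, dist x y ≤ c' * G.treeDist x y) {ω : ℕ → ℝ} (hω : ∀ j a, G.weight j a = ω j)
    (hω' : ∀ j, 10 * ω (j + 1) ≤ ω j) {m : ℕ} (hm : 1 ≤ m) (hmκ : m ≤ κ) :
    ∃ C', ∀ (A : Finset X) (hA : A.card = k),
      (h.algorithm A hA).IsCompetitive m
        ((160 * c' * Real.log k) * (2 * Real.log (1 + 1 / τ) * c)) C' := by
  set s : ℝ := k / κ with hsdef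
  have hk2 : 2 ≤ k := by have := h.one_le; have := h.lt; omega
  have hk2' : (2 : ℝ) ≤ k := by exact_mod_cast hk2
  have hlog : 0 ≤ Real.log k := Real.log_nonneg (by linarith)
  have hX : Nonempty X := Fintype.card_pos_iff.1 (by have := h.le_card; omega)
  have hω0 : ∀ j, 0 ≤ ω j := fun j => by
    rw [← hω j (G.node j (Classical.arbitrary X))]; exact (G.weight_pos _ _).le
  have hpot : ∀ z : X → ℝ, (∀ x, 0 ≤ z x) → 0 ≤ G.lightPot ω z := fun z hz =>
    sum_nonneg fun j _ => mul_nonneg (hω0 _) (sum_nonneg fun a _ =>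
      le_min (mass_nonneg hz _ _) (_root_.div_nonneg (mass_nonneg hz _ _) two_pos.le))
  have hpot' : ∀ z : X → ℝ, (∀ x, z x ≤ 1) → G.lightPot ω z ≤ G.lightPot ω 1 := fun z hz =>
    sum_le_sum fun j _ => mul_le_mul_of_nonneg_left (sum_le_sum fun a _ =>
      min_le_min (sum_le_sum fun x _ => hz x)
        (div_le_div_of_nonneg_right (sum_le_sum fun x _ => hz x) two_pos.le)) (hω0 _)
  -- The inflow is paid by a decrease of the light potential, hence the sign; the factor 4 is 2 from
  -- `earthmover_le_of_sink` times 2 from `sum_inflow_le`.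
  refine h.competitive_of_step hc hG (Φ := fun y => - (4 * c' * G.lightPot ω (G.toMass s y)))
    (lo := - (4 * c' * G.lightPot ω 1)) (hi := 0) (by positivity)
    (fun y hy => neg_le_neg (mul_le_mul_of_nonneg_left (hpot' _ (h.toMass_le_one hy))
      (by positivity)))
    (fun y hy => neg_nonpos.2 (mul_nonneg (by positivity) (hpot _ (h.toMass_nonneg hy)))) ?_ hm hmκ
  intro r v u B hv hu hB hr
  have hus := hu.isState h.τ_pos hv h.height
  have hsum : ∑ x, G.toMass s v x = ∑ x, G.toMass s u x := by
    rw [h.sum_toMass hv, h.sum_toMass hus]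
  set drop := G.div τ (G.opt κ B) v - G.div τ (G.opt κ B) u with hdrop
  have hwt : ∀ j x, G.wt j x = ω j := fun j x => hω j _
  have hin : ∀ j ∈ Icc 1 G.height, ω j * (G.mass (G.toMass s u) j (G.node j r) -
      G.mass (G.toMass s v) j (G.node j r)) ≤ s * (2 * drop) := by
    intro j hj
    have h1 := (h.wt_mass_le (r := r) hv hus (mem_Icc.1 hj).2).trans (mul_le_mul_of_nonneg_left
      (hu.inflow_le h.τ_pos hv hB hr hj) h.scale_nonneg)
    -- With weights constant on levels the telescoping term is zero, since total missing mass on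
    -- every level is the number of points minus κ.
    rw [hwt, sum_eq_zero fun i hi => ?_, zero_add] at h1
    · exact h1
    · simp only [hwt]
      rw [← mul_sum, sum_sub_distrib, hus.sum_eq (mem_Icc.1 hi).2 (h.lt.le.trans h.le_card),
        hv.sum_eq (mem_Icc.1 hi).2 (h.lt.le.trans h.le_card), sub_self, mul_zero]
  have hR : 0 ≤ s * (2 * drop) := by
    refine le_trans ?_ (hin 1 (mem_Icc.2 ⟨le_rfl, h.height⟩))
    exact mul_nonneg (hω0 1) (sub_nonneg.2 (mass_mono hsum (fun x hx => h.toMass_le hv hu hx) 1))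
  have hN := nat_le_five_log hk2 (two_pow_card_halvings_le
    (m := fun j => G.mass (G.toMass s v) j (G.node j r)) (k := k) (by
      simp only [mass, cl_zero]; exact (h.sum_toMass hv).le) (by linarith)
    (fun j => sum_le_sum_of_subset_of_nonneg (cl_subset_cl (Nat.le_succ j) r)
      fun x _ _ => h.toMass_nonneg hv x) G.height)
  have hmain := sum_inflow_le (h.toMass_nonneg hv) (h.toMass_nonneg hus) hsum
    (fun x hx => h.toMass_le hv hu hx) (h.toMass_request hv hu).ge hω0 hω' hR
    (fun j hj => hin (j + 1) (mem_Icc.2 ⟨by omega, hj⟩)) hN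
  have h1 := earthmover_le_of_sink hc' hG' (h.toMass_nonneg hv) (h.toMass_nonneg hus) hsum
    (fun x hx => h.toMass_le hv hu hx)
  refine h1.trans ?_
  have h2 : ∀ j ∈ Icc 1 G.height, ∑ x, G.wt j x * (G.toMass s v x - G.toMass s u x) +
      2 * (G.wt j r * (G.mass (G.toMass s u) j (G.node j r) -
        G.mass (G.toMass s v) j (G.node j r))) =
      2 * (ω j * (G.mass (G.toMass s u) j (G.node j r) -
        G.mass (G.toMass s v) j (G.node j r))) := by
    intro j _
    simp only [hwt]
    rw [← mul_sum, sum_sub_distrib, hsum, sub_self, mul_zero, zero_add]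
  rw [sum_congr rfl h2, ← mul_sum, sum_Icc_eq_range]
  have h3 := mul_le_mul_of_nonneg_left (mul_le_mul_of_nonneg_left hmain two_pos.le) hc'
  refine h3.trans ?_
  have hdrop0 : 0 ≤ drop := by
    have hs0 : 0 < s := div_pos h.k_pos h.κ_pos
    have := nonneg_of_mul_nonneg_right hR hs0
    linarith
  have h4 : s * (80 * c' * Real.log k * drop) ≤ 2 * (80 * c' * Real.log k * drop) :=
    mul_le_mul_of_nonneg_right h.scale_le_two (by positivity)
  linarith

end Hierarchy

/-! ## Rooted weighted trees -/

namespace WeightedTree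

variable {V : Type*} (T : WeightedTree V) (root : V)

/-- The length of a walk. -/
noncomputable def walkLen {u v : V} (p : T.graph.Walk u v) : ℝ := (p.edges.map T.len).sum

/-- The number of edges between the root and a vertex. -/
noncomputable def depth (v : V) : ℕ := T.graph.dist root v

/-- The neighbour of `v` on the way to the root; a junk value at the root itself. -/
noncomputable def par (v : V) : V :=
  open Classical in if h : ∃ u, T.IsChild root u v then h.choose else v

/-- The length of the edge from `v` to its parent. -/
noncomputable def parLen (v : V) : ℝ := T.len s(v, T.par root v)

/-- The ancestor of `v` of depth `j`. -/
noncomputable def anc (j : ℕ) (v : V) : Option V :=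
  if j ≤ T.depth root v then some ((T.par root)^[T.depth root v - j] v) else none

/-- The length of the edge from a vertex to its parent, and zero for no vertex. -/
noncomputable def optLen : Option V → ℝ
  | none => 0
  | some v => T.parLen root v

/-- The length of the path between two vertices, as a sum over the levels from `1` to `H`. -/
noncomputable def levelDist (H : ℕ) (a b : V) : ℝ :=
  ∑ j ∈ Icc 1 H, open Classical in if T.anc root j a = T.anc root j b then 0 else
    T.optLen root (T.anc root j a) + T.optLen root (T.anc root j b)

variable {T root}

theorem isChild_par {v : V} (hv : v ≠ root) : T.IsChild root (T.par root v) v := by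
  have h : ∃ u, T.IsChild root u v := by
    obtain ⟨p, hp⟩ := T.isTree.connected.exists_walk_length_eq_dist root v
    have hnil : ¬ p.Nil := fun hn => hv hn.eq.symm
    have hadj := p.adj_penultimate hnil
    refine ⟨p.penultimate, hadj, ?_⟩
    have h1 := SimpleGraph.dist_le p.dropLast
    have h2 := T.isTree.dist_eq_dist_add_one_of_adj root hadj
    have h3 : p.dropLast.length + 1 = p.length := by
      rw [← SimpleGraph.Walk.length_concat p.dropLast hadj, SimpleGraph.Walk.concat_dropLast]
    omega
  unfold par
  rw [dif_pos h]
  exact h.choose_spec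

theorem adj_par {v : V} (hv : v ≠ root) : T.graph.Adj v (T.par root v) := (isChild_par hv).1.symm

theorem depth_par {v : V} (hv : v ≠ root) :
    T.depth root v = T.depth root (T.par root v) + 1 := (isChild_par hv).2

theorem depth_eq_zero {v : V} : T.depth root v = 0 ↔ v = root := by
  unfold depth
  rw [T.isTree.connected.dist_eq_zero_iff]
  exact eq_comm

/-- A geodesic from the root to any parent of v, extended by the edge to v, is a path. Paths in a
tree are unique, so the penultimate vertices agree. -/
theorem eq_par_of_isChild {u v : V} (h : T.IsChild root u v) : u = T.par root v := by
  have key : ∀ w, T.IsChild root w v → ∃ p : T.graph.Walk root v, p.IsPath ∧ p.penultimate = w := by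
    intro w hw
    obtain ⟨p, hp⟩ := T.isTree.connected.exists_walk_length_eq_dist root w
    refine ⟨p.concat hw.1, SimpleGraph.Walk.isPath_of_length_eq_dist _ ?_, by simp⟩
    rw [SimpleGraph.Walk.length_concat, hp, hw.2]
  have hv : v ≠ root := by
    rintro rfl
    have := h.2
    simp at this
  obtain ⟨p, hp, hpu⟩ := key u h
  obtain ⟨q, hq, hqu⟩ := key _ (isChild_par hv)
  have := (T.isTree.existsUnique_path root v).unique hp hq
  rw [← hpu, ← hqu, this]

theorem eq_par_or_eq_par {u v : V} (h : T.graph.Adj u v) :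
    (v ≠ root ∧ u = T.par root v) ∨ (u ≠ root ∧ v = T.par root u) := by
  have hne : ∀ {a b : V}, T.IsChild root a b → b ≠ root := by
    rintro a b hab rfl
    have := hab.2
    simp at this
  rcases T.isTree.dist_eq_dist_add_one_of_adj root h with h1 | h1
  · have hc : T.IsChild root v u := ⟨h.symm, h1⟩
    exact Or.inr ⟨hne hc, eq_par_of_isChild hc⟩
  · have hc : T.IsChild root u v := ⟨h, h1⟩
    exact Or.inl ⟨hne hc, eq_par_of_isChild hc⟩

theorem parLen_pos {v : V} (hv : v ≠ root) : 0 < T.parLen root v :=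
  T.len_pos _ ((SimpleGraph.mem_edgeSet _).2 (adj_par hv))

theorem anc_par_of_ne {v : V} (hv : v ≠ root) {j : ℕ} (hj : j ≠ T.depth root v) :
    T.anc root j (T.par root v) = T.anc root j v := by
  have h := depth_par (T := T) hv
  unfold anc
  by_cases hle : j ≤ T.depth root v
  · rw [if_pos hle, if_pos (by omega), show T.depth root v - j =
      T.depth root (T.par root v) - j + 1 by omega, Function.iterate_succ_apply]
  · rw [if_neg hle, if_neg (by omega)]

theorem anc_depth (v : V) : T.anc root (T.depth root v) v = some v := by simp [anc]

theorem anc_of_lt {v : V} {j : ℕ} (h : T.depth root v < j) : T.anc root j v = none := by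
  unfold anc; rw [if_neg (by omega)]

theorem depth_iterate_par {v : V} {n : ℕ} (hn : n ≤ T.depth root v) :
    T.depth root ((T.par root)^[n] v) = T.depth root v - n := by
  induction n with
  | zero => simp
  | succ n ih =>
    have h1 := ih (by omega)
    rw [Function.iterate_succ_apply']
    have hne : (T.par root)^[n] v ≠ root := by
      rw [Ne, ← depth_eq_zero (T := T), h1]; omega
    have := depth_par (T := T) hne
    omega

theorem depth_of_anc {v w : V} {j : ℕ} (h : T.anc root j v = some w) : T.depth root w = j := by
  unfold anc at h
  split_ifs at h with hj
  cases h
  rw [depth_iterate_par (by omega)]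
  omega

theorem anc_zero (v : V) : T.anc root 0 v = some root := by
  unfold anc
  rw [if_pos (Nat.zero_le _)]
  congr 1
  rw [← depth_eq_zero (T := T), depth_iterate_par (by omega)]
  omega

theorem par_of_anc {v w : V} {j : ℕ} (h : T.anc root (j + 1) v = some w) :
    T.anc root j v = some (T.par root w) := by
  unfold anc at h ⊢
  split_ifs at h with hj
  cases h
  rw [if_pos (by omega), ← Function.iterate_succ_apply' (T.par root)]
  congr 3
  omega

theorem optLen_nonneg {v : V} {j : ℕ} (hj : 1 ≤ j) : 0 ≤ T.optLen root (T.anc root j v) := by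
  cases h : T.anc root j v with
  | none => exact le_rfl
  | some w =>
    refine (parLen_pos ?_).le
    rw [Ne, ← depth_eq_zero (T := T), depth_of_anc h]
    omega

theorem levelDist_self (H : ℕ) (a : V) : T.levelDist root H a a = 0 := by simp [levelDist]

theorem levelDist_comm (H : ℕ) (a b : V) : T.levelDist root H a b = T.levelDist root H b a := by
  unfold levelDist
  refine sum_congr rfl fun j _ => ?_
  split_ifs with h1 h2 h2
  · rfl
  · exact absurd h1.symm h2
  · exact absurd h2.symm h1
  · exact add_comm _ _

/-- Holds level by level: each summand is a star metric on the possible ancestors, with nonnegative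
spokes. -/
theorem levelDist_triangle (H : ℕ) (a b c : V) :
    T.levelDist root H a c ≤ T.levelDist root H a b + T.levelDist root H b c := by
  unfold levelDist
  rw [← sum_add_distrib]
  refine sum_le_sum fun j hj => ?_
  have hj1 := (mem_Icc.1 hj).1
  have ha := optLen_nonneg (T := T) (root := root) (v := a) hj1
  have hb := optLen_nonneg (T := T) (root := root) (v := b) hj1
  have hc := optLen_nonneg (T := T) (root := root) (v := c) hj1
  generalize T.anc root j a = p at *
  generalize T.anc root j b = q at *
  generalize T.anc root j c = s at *
  by_cases h1 : p = q
  · subst h1; simp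
  · by_cases h2 : q = s
    · subst h2; simp
    · rw [if_neg h1, if_neg h2]
      split_ifs <;> linarith

/-- Passing from a deepest endpoint to its parent changes its ancestor only on its own level, where
the other endpoint cannot contribute the same vertex. -/
theorem levelDist_par {H : ℕ} {a b : V} (ha : a ≠ root) (hH : T.depth root a ≤ H)
    (hb : T.depth root b ≤ T.depth root a) (hab : a ≠ b) :
    T.levelDist root H a b = T.levelDist root H (T.par root a) b + T.parLen root a := by
  have hd := depth_par (T := T) ha
  have hmem : T.depth root a ∈ Icc 1 H := mem_Icc.2 ⟨by omega, hH⟩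
  unfold levelDist
  rw [← add_sum_erase _ _ hmem, ← add_sum_erase _ _ hmem]
  have h1 : ∀ j ∈ (Icc 1 H).erase (T.depth root a),
      T.anc root j (T.par root a) = T.anc root j a := fun j hj => anc_par_of_ne ha (ne_of_mem_erase hj)
  rw [sum_congr rfl fun j hj => by rw [← h1 j hj], anc_depth, anc_of_lt (v := T.par root a) (by omega)]
  have h2 : T.anc root (T.depth root a) b ≠ some a := by
    rcases hb.lt_or_eq with h | h
    · rw [anc_of_lt h]; simp
    · rw [← h, anc_depth]; simpa using hab.symm
  rw [if_neg h2.symm]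
  split_ifs with h3
  · rw [← h3]; simp [optLen]; ring
  · simp only [optLen]; ring

/-- Equality holds for single edges, and the triangle inequality extends the bound to walks. -/
theorem levelDist_le_walkLen {H : ℕ} (hH : ∀ v, T.depth root v ≤ H) {a b : V}
    (p : T.graph.Walk a b) : T.levelDist root H a b ≤ T.walkLen p := by
  induction p with
  | nil => simp [levelDist_self, walkLen]
  | @cons u v w h p ih =>
    have hcons : T.walkLen (SimpleGraph.Walk.cons h p) = T.len s(u, v) + T.walkLen p := by
      simp [walkLen]
    have hpar : ∀ {x : V}, x ≠ root →
        T.levelDist root H x (T.par root x) = T.len s(x, T.par root x) := by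
      intro x hx
      have hd := depth_par (T := T) hx
      rw [levelDist_par hx (hH x) (by omega) (fun h => by rw [← h] at hd; omega), levelDist_self,
        zero_add, parLen]
    have hedge : T.levelDist root H u v = T.len s(u, v) := by
      rcases eq_par_or_eq_par (T := T) (root := root) h with ⟨hv, rfl⟩ | ⟨hu, rfl⟩
      · rw [levelDist_comm, hpar hv, Sym2.eq_swap]
      · exact hpar hu
    rw [hcons]
    linarith [levelDist_triangle (T := T) (root := root) H u v w]

/-- Always climb from the deeper endpoint; each step accounts for exactly its parent edge. -/
theorem exists_walkLen_le {H : ℕ} (hH : ∀ v, T.depth root v ≤ H) (n : ℕ) :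
    ∀ a b : V, T.depth root a + T.depth root b ≤ n →
      ∃ p : T.graph.Walk a b, T.walkLen p = T.levelDist root H a b := by
  induction n with
  | zero =>
    intro a b h
    have ha := (depth_eq_zero (T := T) (root := root) (v := a)).1 (by omega)
    have hb := (depth_eq_zero (T := T) (root := root) (v := b)).1 (by omega)
    subst ha hb
    exact ⟨SimpleGraph.Walk.nil, by simp [walkLen, levelDist_self]⟩
  | succ n ih =>
    have key : ∀ a b : V, T.depth root a + T.depth root b ≤ n + 1 →
        T.depth root b ≤ T.depth root a →
        ∃ p : T.graph.Walk a b, T.walkLen p = T.levelDist root H a b := by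
      intro a b h hle
      by_cases hab : a = b
      · subst hab
        exact ⟨SimpleGraph.Walk.nil, by simp [walkLen, levelDist_self]⟩
      have ha : a ≠ root := by
        intro ha
        have h0 := (depth_eq_zero (T := T) (root := root) (v := a)).2 ha
        have hb := (depth_eq_zero (T := T) (root := root) (v := b)).1 (by omega)
        exact hab (ha.trans hb.symm)
      have hd := depth_par (T := T) ha
      obtain ⟨p, hp⟩ := ih (T.par root a) b (by omega)
      refine ⟨SimpleGraph.Walk.cons (adj_par ha) p, ?_⟩
      rw [levelDist_par ha (hH a) hle hab, ← hp]
      simp [walkLen, parLen]; ring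
    intro a b h
    rcases le_total (T.depth root b) (T.depth root a) with hle | hle
    · exact key a b h hle
    · obtain ⟨p, hp⟩ := key b a (by omega) hle
      refine ⟨p.reverse, ?_⟩
      rw [levelDist_comm, ← hp]
      simp [walkLen]

variable {X : Type*} [MetricSpace X] {φ : X → V}

theorem Realizes.dist_le (hφ : T.Realizes φ) {x y : X} (p : T.graph.Walk (φ x) (φ y)) :
    dist x y ≤ T.walkLen p := by
  classical
  rw [hφ x y p.bypass p.bypass_isPath]
  refine (p.edges_bypass_sublist_edges.map T.len).sum_le_sum ?_
  intro e he
  obtain ⟨e', he', rfl⟩ := List.mem_map.1 he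
  exact (T.len_pos _ (p.edges_subset_edgeSet he')).le

theorem Realizes.exists_walk (hφ : T.Realizes φ) (x y : X) :
    ∃ p : T.graph.Walk (φ x) (φ y), dist x y = T.walkLen p := by
  obtain ⟨p, hp, -⟩ := T.isTree.existsUnique_path (φ x) (φ y)
  exact ⟨p, hφ x y p hp⟩

theorem Realizes.injective (hφ : T.Realizes φ) : Function.Injective φ := by
  intro x y h
  have h1 : dist x y ≤ T.walkLen ((SimpleGraph.Walk.nil : T.graph.Walk (φ x) (φ x)).copy rfl h) :=
    hφ.dist_le _
  rw [← dist_le_zero]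
  simpa [walkLen] using h1

theorem Realizes.dist_eq (hφ : T.Realizes φ) {H : ℕ} (hH : ∀ v, T.depth root v ≤ H) (x y : X) :
    dist x y = T.levelDist root H (φ x) (φ y) := by
  apply le_antisymm
  · obtain ⟨p, hp⟩ := exists_walkLen_le hH _ (φ x) (φ y) le_rfl
    rw [← hp]; exact hφ.dist_le p
  · obtain ⟨p, hp⟩ := hφ.exists_walk x y
    rw [hp]; exact levelDist_le_walkLen hH p

theorem depth_le_diam [Finite V] (v : V) : T.depth root v ≤ T.graph.diam := by
  have : Nonempty V := ⟨root⟩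
  exact SimpleGraph.dist_le_diam (SimpleGraph.connected_iff_ediam_ne_top.1 T.isTree.connected)

theorem Realizes.one_le_diam [Finite V] [Nontrivial X] (hφ : T.Realizes φ) : 1 ≤ T.graph.diam := by
  have := hφ.injective.nontrivial
  exact Nat.one_le_iff_ne_zero.2
    (SimpleGraph.connected_iff_diam_ne_zero.1 T.isTree.connected)

theorem exists_pos_le_dist (X : Type*) [MetricSpace X] [Finite X] :
    ∃ δ : ℝ, 0 < δ ∧ ∀ x y : X, x ≠ y → δ ≤ dist x y := by
  classical
  have := Fintype.ofFinite X
  have h : ∃ δ : ℝ, 0 < δ ∧ ∀ p ∈ (univ : Finset (X × X)), p.1 ≠ p.2 → δ ≤ dist p.1 p.2 := by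
    induction (univ : Finset (X × X)) using Finset.induction_on with
    | empty => exact ⟨1, one_pos, by simp⟩
    | insert p s _ ih =>
      obtain ⟨δ, hδ, h⟩ := ih
      by_cases hp : p.1 = p.2
      · refine ⟨δ, hδ, fun q hq hne => ?_⟩
        rcases mem_insert.1 hq with rfl | hq
        · exact absurd hp hne
        · exact h q hq hne
      · refine ⟨min δ (dist p.1 p.2), lt_min hδ (dist_pos.2 hp), fun q hq hne => ?_⟩
        rcases mem_insert.1 hq with rfl | hq
        · exact min_le_right _ _
        · exact (min_le_left _ _).trans (h q hq hne)
  obtain ⟨δ, hδ, h⟩ := h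
  exact ⟨δ, hδ, fun x y hxy => h (x, y) (mem_univ _) hxy⟩

variable (T root φ) in
/-- The ancestor of `x` at depth `j`, or `x` itself below its vertex. -/
noncomputable def ancNode (j : ℕ) (x : X) : V ⊕ X :=
  match T.anc root j (φ x) with
  | none => Sum.inr x
  | some v => Sum.inl v

/-- The clusters of a tree metric are the subtrees below the vertices of a given depth. -/
theorem Realizes.exists_hierarchy [Finite V] [Finite X] [DecidableEq (V ⊕ X)] [Nontrivial X]
    (hφ : T.Realizes φ) : ∃ G : Hierarchy X (V ⊕ X), G.height = T.graph.diam + 1 ∧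
      (∀ x y, G.treeDist x y ≤ 2 * dist x y) ∧ ∀ x y, dist x y ≤ 1 * G.treeDist x y := by
  classical
  obtain ⟨x₀⟩ : Nonempty X := inferInstance
  set root := φ x₀
  obtain ⟨δ, hδ, hδd⟩ := exists_pos_le_dist X
  -- One level more than the largest possible depth, so that every point, even one at an inner
  -- vertex, ends in a cluster of its own.
  set H := T.graph.diam + 1 with hH
  have hdepth : ∀ v, T.depth root v < H := fun v => Nat.lt_succ_of_le (depth_le_diam v)
  -- Clusters below a point's vertex need positive weight. Over H levels the two points of a pair
  -- add at most 2Hη = δ, hence at most their distance.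
  set η : ℝ := δ / (2 * H) with hη
  have hHpos : (0 : ℝ) < H := by rw [hH]; positivity
  have hηpos : 0 < η := by positivity
  let G : Hierarchy X (V ⊕ X) :=
    { height := H
      node := T.ancNode root φ
      parent := fun j a => match a with
        | Sum.inl v => Sum.inl (T.par root v)
        | Sum.inr x => T.ancNode root φ j x
      weight := fun _ a => match a with
        -- An arbitrary positive value: the root occurs at level 0 only, which `treeDist` omits.
        | Sum.inl v => if v = root then 1 else T.parLen root v
        | Sum.inr _ => η
      weight_pos := by
        rintro j (v | x)
        · show 0 < if v = root then 1 else T.parLen root v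
          split_ifs with h
          · exact one_pos
          · exact parLen_pos h
        · exact hηpos
      parent_node := by
        intro j x
        cases h : T.anc root (j + 1) (φ x) with
        | none => simp [ancNode, h]
        | some v => simp [ancNode, h, par_of_anc h]
      node_zero := by intro x y; simp [ancNode, anc_zero]
      node_height := by
        intro x y h
        simpa [ancNode, anc_of_lt (hdepth (φ x)), anc_of_lt (hdepth (φ y))] using h }
  have hnode : ∀ j x, G.node j x = T.ancNode root φ j x := fun _ _ => rfl
  have hwt : ∀ j, 1 ≤ j → ∀ x, T.optLen root (T.anc root j (φ x)) ≤ G.wt j x ∧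
      G.wt j x ≤ T.optLen root (T.anc root j (φ x)) + η := by
    intro j hj x
    show _ ≤ G.weight j (G.node j x) ∧ G.weight j (G.node j x) ≤ _
    rw [hnode]
    cases h : T.anc root j (φ x) with
    | none =>
      have h1 : T.ancNode root φ j x = Sum.inr x := by simp [ancNode, h]
      rw [h1]
      exact ⟨hηpos.le, by simp [optLen, G]⟩
    | some v =>
      have h1 : T.ancNode root φ j x = Sum.inl v := by simp [ancNode, h]
      rw [h1]
      have hv : v ≠ root := by
        rw [Ne, ← depth_eq_zero (T := T), depth_of_anc h]; omega
      have h2 : G.weight j (Sum.inl v) = T.parLen root v := if_neg hv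
      rw [h2]
      exact ⟨le_rfl, by simpa [optLen] using hηpos.le⟩
  have hd := hφ.dist_eq (root := root) fun v => (hdepth v).le
  refine ⟨G, rfl, fun x y => ?_, fun x y => ?_⟩
  · by_cases hxy : x = y
    · subst hxy; simp [Hierarchy.treeDist]
    have h1 : G.treeDist x y ≤ ∑ j ∈ Icc 1 H,
        ((if T.anc root j (φ x) = T.anc root j (φ y) then 0 else
          T.optLen root (T.anc root j (φ x)) + T.optLen root (T.anc root j (φ y))) + 2 * η) := by
      refine sum_le_sum fun j hj => ?_
      have hj1 := (mem_Icc.1 hj).1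
      have hx := (hwt j hj1 x).2
      have hy := (hwt j hj1 y).2
      by_cases h : T.anc root j (φ x) = T.anc root j (φ y)
      · rw [if_pos h]
        split_ifs with hn
        · linarith
        · cases hxn : T.anc root j (φ x) with
          | none =>
            rw [hxn] at hx h
            rw [← h] at hy
            simp only [optLen] at hx hy
            linarith
          | some v =>
            exact absurd (by rw [hnode, hnode]; simp [ancNode, ← h, hxn]) hn
      · rw [if_neg h]
        have h0 := optLen_nonneg (T := T) (root := root) (v := φ x) hj1
        have h0' := optLen_nonneg (T := T) (root := root) (v := φ y) hj1
        split_ifs <;> linarith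
    rw [sum_add_distrib, sum_const, Nat.card_Icc, nsmul_eq_mul] at h1
    have h2 : (((H + 1 - 1 : ℕ) : ℝ)) * (2 * η) = δ := by
      rw [Nat.add_sub_cancel, hη]; field_simp
    have h3 := hd x y
    unfold levelDist at h3
    have h4 := hδd x y hxy
    linarith
  · rw [hd x y, one_mul]
    refine sum_le_sum fun j hj => ?_
    have hj1 := (mem_Icc.1 hj).1
    have hx := (hwt j hj1 x).1
    have hy := (hwt j hj1 y).1
    have hx0 := (G.wt_pos j x).le
    have hy0 := (G.wt_pos j y).le
    by_cases h : T.anc root j (φ x) = T.anc root j (φ y)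
    · rw [if_pos h]
      split_ifs <;> linarith
    · rw [if_neg h, if_neg ?_]
      · linarith
      · intro hn
        rw [hnode, hnode] at hn
        unfold ancNode at hn
        cases hxn : T.anc root j (φ x) with
        | none =>
          cases hyn : T.anc root j (φ y) with
          | none => exact h (hxn.trans hyn.symm)
          | some w => rw [hxn, hyn] at hn; simp at hn
        | some v =>
          cases hyn : T.anc root j (φ y) with
          | none => rw [hxn, hyn] at hn; simp at hn
          | some w => rw [hxn, hyn] at hn; simp at hn; exact h (by rw [hxn, hyn, hn])

end WeightedTree

/-! ### Uniform hierarchies for HSTs -/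

namespace WeightedTree

variable {V : Type*} {T : WeightedTree V} {root : V} {X : Type*} [MetricSpace X] {φ : X → V}

variable (T) in
/-- The forest of all edges of length at most `s`. -/
def shortForest (s : ℝ) : SimpleGraph V where
  Adj u v := T.graph.Adj u v ∧ T.len s(u, v) ≤ s
  symm := by
    constructor
    intro u v h
    exact ⟨h.1.symm, by rw [Sym2.eq_swap]; exact h.2⟩
  loopless := ⟨fun u (h : T.graph.Adj u u ∧ _) => h.1.ne rfl⟩

theorem shortForest_reachable_mono {s t : ℝ} (hst : s ≤ t) {u v : V}
    (h : (T.shortForest s).Reachable u v) : (T.shortForest t).Reachable u v :=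
  h.mono fun a b (h : T.graph.Adj a b ∧ T.len s(a, b) ≤ s) => ⟨h.1, h.2.trans hst⟩

/-- No edge of a path is longer than the whole path. -/
theorem Realizes.reachable_of_dist_le (hφ : T.Realizes φ) {x y : X} {s : ℝ} (h : dist x y ≤ s) :
    (T.shortForest s).Reachable (φ x) (φ y) := by
  obtain ⟨p, hp⟩ := hφ.exists_walk x y
  rw [hp] at h
  clear hp
  revert h
  generalize φ x = a at p
  generalize φ y = b at p
  intro h
  have h0 : ∀ {a b : V} (p : T.graph.Walk a b), 0 ≤ T.walkLen p := fun p =>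
    List.sum_nonneg fun l hl => by
      obtain ⟨e, he, rfl⟩ := List.mem_map.1 hl
      exact (T.len_pos _ (p.edges_subset_edgeSet he)).le
  induction p with
  | nil => exact SimpleGraph.Reachable.refl _
  | @cons u v w hadj p ih =>
    have hcons : T.walkLen (SimpleGraph.Walk.cons hadj p) = T.len s(u, v) + T.walkLen p := by
      simp [walkLen]
    have h1 := T.len_pos s(u, v) hadj
    have h2 := h0 p
    have h3 : (T.shortForest s).Adj u v := ⟨hadj, by linarith⟩
    exact h3.reachable.trans (ih (by linarith))

variable (T root) in
/-- `c` is reached from `a` by climbing towards the root along edges of length at most `s`. -/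
def Climbs (s : ℝ) : V → V → Prop :=
  Relation.ReflTransGen fun u v => u ≠ root ∧ v = T.par root u ∧ T.parLen root u ≤ s

/-- Induct on a walk: a step up is prepended to the climb of its first endpoint, and a step down
either cancels the first step of that climb or moves the meeting vertex up to its start. -/
theorem exists_climbs_of_reachable {s : ℝ} {a b : V} (h : (T.shortForest s).Reachable a b) :
    ∃ c, T.Climbs root s a c ∧ T.Climbs root s b c := by
  obtain ⟨p⟩ := h
  induction p with
  | nil => exact ⟨_, Relation.ReflTransGen.refl, Relation.ReflTransGen.refl⟩
  | @cons u v w hadj p ih =>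
    obtain ⟨c, hv, hw⟩ := ih
    rcases eq_par_or_eq_par (T := T) (root := root) hadj.1 with ⟨hne, rfl⟩ | ⟨hne, rfl⟩
    · rcases hv.cases_head with rfl | ⟨d, ⟨_, rfl, hlen⟩, hd⟩
      · refine ⟨_, Relation.ReflTransGen.refl, hw.tail ⟨hne, rfl, ?_⟩⟩
        have := hadj.2
        rwa [Sym2.eq_swap] at this
      · exact ⟨c, hd, hw⟩
    · exact ⟨c, Relation.ReflTransGen.head ⟨hne, rfl, hadj.2⟩ hv, hw⟩

/-- Lengths grow by a factor τ while climbing, so the last edge dominates a geometric series. The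
second bound, in terms of the next edge, is the induction hypothesis; it gives the first when one
more edge is added. -/
theorem IsHST.exists_walk_of_climbs {τ : ℝ} (hτ : 1 < τ) (hT : T.IsHST root τ) {s : ℝ} (hs : 0 ≤ s)
    {a c : V} (h : T.Climbs root s a c) : ∃ p : T.graph.Walk a c,
      T.walkLen p ≤ τ / (τ - 1) * s ∧ (c ≠ root → T.walkLen p ≤ T.parLen root c / (τ - 1)) := by
  have hτ1 : 0 < τ - 1 := by linarith
  induction h with
  | refl =>
    refine ⟨SimpleGraph.Walk.nil, ?_, fun hc => ?_⟩
    · have : 0 ≤ τ / (τ - 1) * s := by positivity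
      simpa [walkLen] using this
    · have := (parLen_pos (T := T) hc).le
      have : 0 ≤ T.parLen root a / (τ - 1) := by positivity
      simpa [walkLen] using this
  | @tail b c _ hbc ih =>
    obtain ⟨hb, rfl, hlen⟩ := hbc
    obtain ⟨p, -, hp⟩ := ih
    have hp := hp hb
    have hq : T.walkLen (p.concat (adj_par hb)) = T.walkLen p + T.parLen root b := by
      simp [walkLen, parLen, SimpleGraph.Walk.edges_concat, List.concat_eq_append]
    have h1 : T.walkLen p + T.parLen root b ≤ τ / (τ - 1) * T.parLen root b := by
      have : τ / (τ - 1) * T.parLen root b = T.parLen root b / (τ - 1) + T.parLen root b := by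
        field_simp; ring
      linarith
    refine ⟨p.concat (adj_par hb), ?_, fun hc => ?_⟩
    · rw [hq]
      exact h1.trans (mul_le_mul_of_nonneg_left hlen (by positivity))
    · have h2 := hT _ _ _ (isChild_par hc) (isChild_par hb)
      have h3 : τ * T.parLen root b ≤ T.parLen root (T.par root b) := by
        unfold parLen
        rwa [Sym2.eq_swap, Sym2.eq_swap (b := T.par root (T.par root b))]
      rw [hq]
      refine h1.trans ?_
      rw [div_mul_eq_mul_div]
      gcongr

theorem Realizes.dist_le_of_reachable (hφ : T.Realizes φ) {τ : ℝ} (hτ : 1 < τ)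
    (hT : T.IsHST root τ) {s : ℝ} (hs : 0 ≤ s) {x y : X}
    (h : (T.shortForest s).Reachable (φ x) (φ y)) : dist x y ≤ 2 * (τ / (τ - 1) * s) := by
  obtain ⟨c, hx, hy⟩ := exists_climbs_of_reachable (root := root) h
  obtain ⟨p, hp, -⟩ := hT.exists_walk_of_climbs hτ hs hx
  obtain ⟨q, hq, -⟩ := hT.exists_walk_of_climbs hτ hs hy
  have h1 := hφ.dist_le (p.append q.reverse)
  have h2 : T.walkLen (p.append q.reverse) = T.walkLen p + T.walkLen q := by
    simp [walkLen, SimpleGraph.Walk.edges_append]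
  linarith

theorem sum_ite_lt_le {ω : ℕ → ℝ} (hω : ∀ j, 0 < ω j) (hω' : ∀ j, 2 * ω (j + 1) ≤ ω j) {d : ℝ}
    (hd : 0 ≤ d) (n : ℕ) : ∑ j ∈ Icc 1 n, (if ω j < d then ω j else 0) ≤ 2 * d := by
  -- The reserve min(ω n, 2d) makes the induction close: a new term ω (n + 1) is at most half the
  -- old reserve.
  suffices h : ∑ j ∈ Icc 1 n, (if ω j < d then ω j else 0) + min (ω n) (2 * d) ≤ 2 * d by
    have : 0 ≤ min (ω n) (2 * d) := le_min (hω n).le (by linarith)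
    linarith
  induction n with
  | zero => simp
  | succ n ih =>
    rw [sum_Icc_succ_top (by omega)]
    have h1 := hω' n
    have h2 := hω (n + 1)
    split_ifs with h
    · have : ω (n + 1) + ω (n + 1) ≤ min (ω n) (2 * d) := le_min (by linarith) (by linarith)
      linarith [min_le_left (ω (n + 1)) (2 * d)]
    · have : min (ω (n + 1)) (2 * d) ≤ min (ω n) (2 * d) := min_le_min_right _ (by linarith)
      linarith

variable (T φ) in
/-- The points that are connected to `x` by edges of length at most `s`. -/
def component (s : ℝ) (x : X) : Set X := {y | (T.shortForest s).Reachable (φ x) (φ y)}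

theorem component_eq_iff {s : ℝ} {x y : X} :
    T.component φ s x = T.component φ s y ↔ (T.shortForest s).Reachable (φ x) (φ y) := by
  constructor
  · intro h
    have : y ∈ T.component φ s y := SimpleGraph.Reachable.refl _
    rw [← h] at this
    exact this
  · intro h
    ext z
    exact ⟨fun hz => h.symm.trans hz, fun hz => h.trans hz⟩

/-- The metric of a hierarchically separated tree is equivalent to that of a hierarchy whose weights
depend on the level only and decrease by a factor of 64 per level. -/
theorem Realizes.exists_uniform_hierarchy [Finite X] [Nontrivial X] [DecidableEq (Set X)]
    (hφ : T.Realizes φ) {τ : ℝ} (hτ : 1 < τ) (hT : T.IsHST root τ) :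
    ∃ (G : Hierarchy X (Set X)) (ω : ℕ → ℝ), 1 ≤ G.height ∧ (∀ j a, G.weight j a = ω j) ∧
      (∀ j, 64 * ω (j + 1) ≤ ω j) ∧ (∀ x y, G.treeDist x y ≤ 4 * dist x y) ∧
      ∀ x y, dist x y ≤ 64 * (τ / (τ - 1)) * G.treeDist x y := by
  classical
  obtain ⟨δ, hδ, hδd⟩ := exists_pos_le_dist X
  have hτ1 : 0 < τ - 1 := by linarith
  obtain ⟨D, hD⟩ : ∃ D : ℝ, ∀ x y : X, dist x y ≤ D := by
    obtain ⟨D, hD⟩ := (Set.finite_range fun p : X × X => dist p.1 p.2).bddAbove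
    exact ⟨D, fun x y => hD ⟨(x, y), rfl⟩⟩
  have hDpos : 0 < D := by
    obtain ⟨x, y, hxy⟩ := exists_pair_ne X
    exact (dist_pos.2 hxy).trans_le (hD x y)
  -- At level 0 the threshold is a bound for the diameter, so there is one component. The ratio 64
  -- is chosen for the exchange arguments of the rounding; `competitive_log` needs only 10.
  let ω : ℕ → ℝ := fun j => D * (1 / 64) ^ j
  have hω : ∀ j, 0 < ω j := fun j => by positivity
  have hω1 : ∀ j, 64 * ω (j + 1) = ω j := fun j => by simp only [ω, pow_succ]; ring
  obtain ⟨n, hn⟩ : ∃ n : ℕ, 2 * (τ / (τ - 1) * ω n) < δ := by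
    obtain ⟨n, hn⟩ := exists_pow_lt_of_lt_one
      (show 0 < δ / (2 * (τ / (τ - 1)) * D) by positivity) (show (1 / 64 : ℝ) < 1 by norm_num)
    refine ⟨n, ?_⟩
    rw [lt_div_iff₀ (by positivity)] at hn
    calc 2 * (τ / (τ - 1) * ω n) = (1 / 64) ^ n * (2 * (τ / (τ - 1)) * D) := by simp only [ω]; ring
      _ < δ := hn
  have hsep : ∀ x y, T.component φ (ω n) x = T.component φ (ω n) y → x = y := by
    intro x y h
    by_contra hxy
    have := hφ.dist_le_of_reachable hτ hT (hω n).le (component_eq_iff.1 h)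
    linarith [hδd x y hxy]
  have hzero : ∀ x y, T.component φ (ω 0) x = T.component φ (ω 0) y := fun x y =>
    component_eq_iff.2 (hφ.reachable_of_dist_le (by simpa [ω] using hD x y))
  have hmono : ∀ j x y, T.component φ (ω (j + 1)) x = T.component φ (ω (j + 1)) y →
      T.component φ (ω j) x = T.component φ (ω j) y := fun j x y h => by
    rw [component_eq_iff] at h ⊢
    exact shortForest_reachable_mono (by linarith [hω1 j, hω (j + 1)]) h
  let G : Hierarchy X (Set X) :=
    { height := n
      node := fun j => T.component φ (ω j)
      -- Any representative gives the same coarser component by `hmono`; the empty set is a default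
      -- for sets that are not components.
      parent := fun j a => if h : ∃ x, T.component φ (ω (j + 1)) x = a then
        T.component φ (ω j) h.choose else ∅
      weight := fun j _ => ω j
      weight_pos := fun j _ => hω j
      parent_node := by
        intro j x
        have h : ∃ y, T.component φ (ω (j + 1)) y = T.component φ (ω (j + 1)) x := ⟨x, rfl⟩
        rw [dif_pos h]
        exact hmono j _ _ h.choose_spec
      node_zero := hzero
      node_height := fun x y h => hsep x y h }
  have htree : ∀ x y, G.treeDist x y =
      ∑ j ∈ Icc 1 n, if T.component φ (ω j) x = T.component φ (ω j) y then 0 else ω j + ω j :=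
    fun _ _ => rfl
  refine ⟨G, ω, ?_, fun _ _ => rfl, fun j => (hω1 j).le, fun x y => ?_, fun x y => ?_⟩
  · rw [Nat.one_le_iff_ne_zero]
    intro h0
    obtain ⟨x, y, hxy⟩ := exists_pair_ne X
    refine hxy (hsep x y ?_)
    have : n = 0 := h0
    rw [this]
    exact hzero x y
  · rw [htree]
    have h1 := sum_ite_lt_le hω (fun j => by linarith [hω1 j, hω (j + 1)])
      (dist_nonneg (x := x) (y := y)) n
    have h2 : ∑ j ∈ Icc 1 n,
        (if T.component φ (ω j) x = T.component φ (ω j) y then 0 else ω j + ω j) ≤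
        ∑ j ∈ Icc 1 n, 2 * (if ω j < dist x y then ω j else 0) := by
      refine sum_le_sum fun j _ => ?_
      have hj := hω j
      by_cases h : ω j < dist x y
      · rw [if_pos h]; split_ifs <;> linarith
      · rw [if_neg h, if_pos (component_eq_iff.2 (hφ.reachable_of_dist_le (not_lt.1 h))), mul_zero]
    rw [← mul_sum] at h2
    linarith
  · by_cases hxy : x = y
    · subst hxy; simp [Hierarchy.treeDist]
    have hex : ∃ j, T.component φ (ω j) x ≠ T.component φ (ω j) y := ⟨n, fun h => hxy (hsep x y h)⟩
    have hspec := Nat.find_spec hex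
    have hmin : ∀ i < Nat.find hex, T.component φ (ω i) x = T.component φ (ω i) y :=
      fun i hi => not_not.1 (Nat.find_min hex hi)
    have hle : Nat.find hex ≤ n := Nat.find_min' hex fun h => hxy (hsep x y h)
    generalize Nat.find hex = j at *
    obtain ⟨i, rfl⟩ : ∃ i, j = i + 1 := by
      rcases j with _ | i
      · exact absurd (hzero x y) hspec
      · exact ⟨i, rfl⟩
    have h1 := hφ.dist_le_of_reachable hτ hT (hω i).le (component_eq_iff.1 (hmin i (by omega)))
    have h2 : ω (i + 1) + ω (i + 1) ≤ G.treeDist x y := by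
      rw [htree]
      have h := single_le_sum (f := fun j => if T.component φ (ω j) x = T.component φ (ω j) y then 0
        else ω j + ω j) (fun j _ => by have := hω j; split_ifs <;> linarith)
        (mem_Icc.2 ⟨by omega, hle⟩ : i + 1 ∈ Icc 1 n)
      simpa only [if_neg hspec] using h
    -- The points share the component at level i, which bounds their distance, and are separated at
    -- i + 1, which alone contributes twice the weight ω (i + 1).
    calc dist x y ≤ 2 * (τ / (τ - 1) * ω i) := h1
      _ = 64 * (τ / (τ - 1)) * (ω (i + 1) + ω (i + 1)) := by rw [← hω1 i]; ring
      _ ≤ _ := mul_le_mul_of_nonneg_left h2 (by positivity)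

end WeightedTree

/-! ## A first order condition -/

/-- An upper bound for the derivative of `|s + t * δ|` on the right of `t = 0`. -/
noncomputable def dirAbs (s δ : ℝ) : ℝ := if s * δ < 0 then -|δ| else |δ|

theorem dirAbs_le (s δ : ℝ) : dirAbs s δ ≤ |δ| := by
  unfold dirAbs; split_ifs
  · linarith [abs_nonneg δ]
  · exact le_rfl

theorem dirAbs_zero (s : ℝ) : dirAbs s 0 = 0 := by simp [dirAbs]

theorem eventually_abs_add_mul_le (s δ : ℝ) :
    ∀ᶠ t in nhdsWithin (0 : ℝ) (Set.Ioi 0), |s + t * δ| ≤ |s| + t * dirAbs s δ := by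
  unfold dirAbs
  split_ifs with h
  · have hδ : 0 < |δ| := abs_pos.2 fun h0 => by simp [h0] at h
    have hs : 0 < |s| := abs_pos.2 fun h0 => by simp [h0] at h
    filter_upwards [Ioo_mem_nhdsGT (show (0 : ℝ) < |s| / |δ| by positivity)] with t ht
    have ht2 : t * |δ| < |s| := (lt_div_iff₀ hδ).1 ht.2
    have ht1 : 0 < t := ht.1
    rcases mul_neg_iff.1 h with ⟨h1, h2⟩ | ⟨h1, h2⟩
    · rw [abs_of_pos h1, abs_of_neg h2] at *
      rw [abs_of_nonneg] <;> nlinarith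
    · rw [abs_of_neg h1, abs_of_pos h2] at *
      rw [abs_of_nonpos] <;> nlinarith
  · filter_upwards [self_mem_nhdsWithin] with t ht
    have ht1 : 0 < t := ht
    calc |s + t * δ| ≤ |s| + |t * δ| := abs_add_le _ _
      _ = |s| + t * |δ| := by rw [abs_mul, abs_of_pos ht1]

/-- The penalties are not differentiable, so their right derivatives are replaced by the upper bound
`dirAbs`; the inequality is read off at a single small t. -/
theorem first_order_condition {P ι : Type*} [Fintype P] (Q : Finset ι) (g : P → ℝ) (w : ι → ℝ)
    (n : P → ι → ℝ) (m : ι → ℝ) (π d : P → ℝ) (hw : ∀ q ∈ Q, 0 ≤ w q)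
    (hmin : ∀ᶠ t in nhdsWithin (0 : ℝ) (Set.Ioi 0),
      ∑ p, π p * g p + ∑ q ∈ Q, w q * |∑ p, π p * n p q - m q| ≤
      ∑ p, (π p + t * d p) * g p + ∑ q ∈ Q, w q * |∑ p, (π p + t * d p) * n p q - m q|) :
    0 ≤ ∑ p, d p * g p +
      ∑ q ∈ Q, w q * dirAbs (∑ p, π p * n p q - m q) (∑ p, d p * n p q) := by
  have h1 : ∀ᶠ t in nhdsWithin (0 : ℝ) (Set.Ioi 0), ∀ q ∈ Q,
      |(∑ p, π p * n p q - m q) + t * ∑ p, d p * n p q| ≤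
        |∑ p, π p * n p q - m q| + t * dirAbs (∑ p, π p * n p q - m q) (∑ p, d p * n p q) :=
    (Filter.eventually_all_finset Q).2 fun q _ => eventually_abs_add_mul_le _ _
  obtain ⟨t, ⟨h2, h3⟩, ht⟩ := ((hmin.and h1).and self_mem_nhdsWithin).exists
  have ht : 0 < t := ht
  have h4 : ∀ f : P → ℝ, ∑ p, (π p + t * d p) * f p = ∑ p, π p * f p + t * ∑ p, d p * f p := by
    intro f
    rw [mul_sum, ← sum_add_distrib]
    exact sum_congr rfl fun p _ => by ring
  have h5 : ∑ q ∈ Q, w q * |∑ p, (π p + t * d p) * n p q - m q| ≤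
      ∑ q ∈ Q, w q * |∑ p, π p * n p q - m q| +
        t * ∑ q ∈ Q, w q * dirAbs (∑ p, π p * n p q - m q) (∑ p, d p * n p q) := by
    rw [mul_sum, ← sum_add_distrib]
    refine sum_le_sum fun q hq => ?_
    have h6 := mul_le_mul_of_nonneg_left (h3 q hq) (hw q hq)
    rw [h4]
    calc _ = w q * |(∑ p, π p * n p q - m q) + t * ∑ p, d p * n p q| := by congr 2; ring
      _ ≤ _ := h6
      _ = _ := by ring
  rw [h4] at h2
  by_contra hneg
  have := mul_neg_of_pos_of_neg ht (not_le.1 hneg)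
  linarith

/-! ## Rounding fractional states -/

/-- The distance of `n` to the interval from `⌊t⌋` to `⌈t⌉`. -/
noncomputable def roundingDefect (t : ℝ) (n : ℕ) : ℕ := (⌊t⌋₊ - n) + (n - ⌈t⌉₊)

theorem abs_roundingDefect_sub_le (t : ℝ) (n m : ℕ) :
    |(roundingDefect t n : ℝ) - roundingDefect t m| ≤ |(n : ℝ) - m| := by
  have h := Nat.floor_le_ceil t
  have : |(roundingDefect t n : ℤ) - roundingDefect t m| ≤ |(n : ℤ) - m| := by
    unfold roundingDefect
    rcases abs_cases ((n : ℤ) - m) with ⟨h1, _⟩ | ⟨h1, _⟩ <;> rw [h1, abs_le] <;>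
      constructor <;> push_cast <;> omega
  exact_mod_cast this

namespace Hierarchy

variable {X C : Type*} [Fintype X] [DecidableEq X] [DecidableEq C] {G : Hierarchy X C}
  {z z' : X → ℝ} {B : Finset X} {k : ℕ}

variable (G) in
/-- The number of servers in a cluster. -/
def count (B : Finset X) (j : ℕ) (a : C) : ℕ := (B ∩ G.cl j a).card

theorem mass_serverMass (B : Finset X) (j : ℕ) (a : C) :
    G.mass (serverMass B) j a = G.count B j a := sum_serverMass _ _

theorem count_children (B : Finset X) (j : ℕ) (r : X) :
    ∑ a ∈ (G.nodes (j + 1)).filter (fun a => G.parent j a = G.node j r), G.count B (j + 1) a =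
      G.count B j (G.node j r) := by
  have := mass_children (G := G) (serverMass B) j r
  simp only [mass_serverMass] at this
  exact_mod_cast this

theorem count_move {a b : X} (ha : a ∈ B) (hb : b ∉ B) (i : ℕ) (v : C) :
    (G.count (insert b (B.erase a)) i v : ℝ) - G.count B i v =
      (if G.node i b = v then 1 else 0) - (if G.node i a = v then 1 else 0) := by
  have h : ∀ B : Finset X, (G.count B i v : ℝ) = ∑ x ∈ B, if G.node i x = v then 1 else 0 := by
    intro B
    rw [sum_boole]
    unfold count
    congr 2
    ext x; simp [mem_cl]
  rw [h, h, sum_insert (fun h => hb (mem_of_mem_erase h)), ← add_sum_erase _ _ ha]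
  ring

theorem node_mem_nodes (j : ℕ) (x : X) : G.node j x ∈ G.nodes j := mem_image_of_mem _ (mem_univ x)

theorem sum_abs_move_le (i : ℕ) (a b : X) :
    ∑ v ∈ G.nodes i, |(if G.node i b = v then (1 : ℝ) else 0) - if G.node i a = v then 1 else 0| ≤
      2 := by
  calc _ ≤ ∑ v ∈ G.nodes i, ((if G.node i b = v then (1 : ℝ) else 0) +
        if G.node i a = v then 1 else 0) := by
        refine sum_le_sum fun v _ => (abs_sub _ _).trans (le_of_eq ?_)
        congr 1 <;> split_ifs <;> simp
    _ = 2 := by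
        rw [sum_add_distrib, sum_ite_eq, sum_ite_eq, if_pos (node_mem_nodes i b),
          if_pos (node_mem_nodes i a)]
        norm_num

/-- A quantity that vanishes above level `j` is dominated by its value on that level. -/
theorem sum_levels_le {ω : ℕ → ℝ} (hω : ∀ j, 0 ≤ ω j) (hω' : ∀ j, 64 * ω (j + 1) ≤ ω j)
    {S : ℕ → ℝ} {M : ℝ} (hM : 0 ≤ M) {j H : ℕ} (hj : 1 ≤ j) (hjH : j ≤ H) (h1 : ∀ i < j, S i ≤ 0)
    (h2 : ∀ i, j < i → S i ≤ M) :
    ∑ i ∈ Icc 1 H, ω i * S i ≤ ω j * S j + M * (ω j / 63) := by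
  -- With decay 64 all levels deeper than j have total weight at most ω j / 63; keeping the term ω H
  -- makes the sum telescope.
  suffices h : ∑ i ∈ Icc 1 H, ω i * S i ≤ ω j * S j + M * (ω j - ω H) / 63 by
    have := mul_nonneg hM (hω H)
    linarith
  induction H, hjH using Nat.le_induction with
  | base =>
    obtain ⟨i, rfl⟩ : ∃ i, j = i + 1 := ⟨j - 1, by omega⟩
    rw [sum_Icc_succ_top (by omega)]
    have : ∑ l ∈ Icc 1 i, ω l * S l ≤ 0 := sum_nonpos fun l hl =>
      mul_nonpos_of_nonneg_of_nonpos (hω l) (h1 l (by have := (mem_Icc.1 hl).2; omega))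
    linarith
  | succ H hH ih =>
    rw [sum_Icc_succ_top (by omega)]
    have h3 := mul_le_mul_of_nonneg_left (h2 (H + 1) (by omega)) (hω (H + 1))
    have h4 := mul_le_mul_of_nonneg_left (hω' H) hM
    linarith

variable (G) in
/-- The weighted number of servers that have to be added or removed to balance the clusters. -/
noncomputable def imbalance (ω : ℕ → ℝ) (z : X → ℝ) (B : Finset X) : ℝ :=
  ∑ j ∈ Icc 1 G.height, ω j * ∑ v ∈ G.nodes j, (roundingDefect (G.mass z j v) (G.count B j v) : ℝ)

variable {ω : ℕ → ℝ}

/-- Moving a server between children of the same cluster. -/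
theorem imbalance_move (hω : ∀ j, 0 ≤ ω j) (hω' : ∀ j, 64 * ω (j + 1) ≤ ω j) {a b : X}
    (ha : a ∈ B) (hb : b ∉ B) {j : ℕ} (hj : j < G.height) (hab : G.node j a = G.node j b)
    (hne : G.node (j + 1) a ≠ G.node (j + 1) b) {D : ℝ}
    (hD : (roundingDefect (G.mass z (j + 1) (G.node (j + 1) a))
        (G.count (insert b (B.erase a)) (j + 1) (G.node (j + 1) a)) : ℝ) -
      roundingDefect (G.mass z (j + 1) (G.node (j + 1) a)) (G.count B (j + 1) (G.node (j + 1) a)) +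
      (roundingDefect (G.mass z (j + 1) (G.node (j + 1) b))
        (G.count (insert b (B.erase a)) (j + 1) (G.node (j + 1) b)) -
      roundingDefect (G.mass z (j + 1) (G.node (j + 1) b)) (G.count B (j + 1) (G.node (j + 1) b)))
      ≤ D) :
    G.imbalance ω z (insert b (B.erase a)) - G.imbalance ω z B ≤ ω (j + 1) * (D + 2 / 63) := by
  set B' := insert b (B.erase a) with hB'
  set S : ℕ → ℝ := fun i => ∑ v ∈ G.nodes i, ((roundingDefect (G.mass z i v) (G.count B' i v) : ℝ) -
    roundingDefect (G.mass z i v) (G.count B i v)) with hS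
  have h0 : G.imbalance ω z B' - G.imbalance ω z B = ∑ i ∈ Icc 1 G.height, ω i * S i := by
    unfold imbalance
    rw [← sum_sub_distrib]
    exact sum_congr rfl fun i _ => by rw [← mul_sub, ← sum_sub_distrib]
  have h1 : ∀ i, S i ≤ ∑ v ∈ G.nodes i,
      |(if G.node i b = v then (1 : ℝ) else 0) - if G.node i a = v then 1 else 0| := fun i =>
    sum_le_sum fun v _ => (le_abs_self _).trans
      ((abs_roundingDefect_sub_le _ _ _).trans (by rw [count_move ha hb]))
  have h2 : ∀ i < j + 1, S i ≤ 0 := fun i hi => by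
    refine (h1 i).trans (le_of_eq (sum_eq_zero fun v _ => ?_))
    rw [node_eq_of_le (Nat.lt_succ_iff.1 hi) hab, sub_self, abs_zero]
  have h3 := sum_levels_le hω hω' (S := S) two_pos.le (Nat.le_add_left 1 j) hj h2
    fun i _ => (h1 i).trans (sum_abs_move_le i a b)
  have h4 : S (j + 1) ≤ D := by
    refine le_trans (le_of_eq ?_) hD
    refine sum_eq_add_of_mem _ _ (node_mem_nodes _ a) (node_mem_nodes _ b) hne fun v _ hv => ?_
    have h5 := count_move (G := G) ha hb (j + 1) v
    rw [if_neg hv.2.symm, if_neg hv.1.symm, sub_self, sub_eq_zero] at h5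
    have h6 : G.count B' (j + 1) v = G.count B (j + 1) v := by exact_mod_cast h5
    rw [h6, sub_self]
  rw [h0]
  have := mul_le_mul_of_nonneg_left h4 (hω (j + 1))
  linarith

theorem dist_le_of_node_eq [MetricSpace X] {c' : ℝ} (hc' : 0 ≤ c')
    (hG' : ∀ x y, dist x y ≤ c' * G.treeDist x y) (hwt : ∀ j a, G.weight j a = ω j)
    (hω : ∀ j, 0 ≤ ω j) (hω' : ∀ j, 64 * ω (j + 1) ≤ ω j) {a b : X} {j : ℕ} (hj : j < G.height)
    (hab : G.node j a = G.node j b) : dist a b ≤ c' * (ω (j + 1) * (2 + 2 / 63)) := by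
  refine (hG' a b).trans (mul_le_mul_of_nonneg_left ?_ hc')
  set S : ℕ → ℝ := fun i => if G.node i a = G.node i b then 0 else 2 with hS
  have h0 : G.treeDist a b = ∑ i ∈ Icc 1 G.height, ω i * S i :=
    sum_congr rfl fun i _ => by simp only [hS, wt, hwt]; split_ifs <;> ring
  have h1 : ∀ i, S i ≤ 2 := fun i => by simp only [hS]; split_ifs <;> norm_num
  have h2 := sum_levels_le hω hω' (S := S) two_pos.le (Nat.le_add_left 1 j) hj
    (fun i hi => by simp only [hS]; rw [if_pos (node_eq_of_le (Nat.lt_succ_iff.1 hi) hab)])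
    fun i _ => h1 i
  rw [h0]
  have := mul_le_mul_of_nonneg_left (h1 (j + 1)) (hω (j + 1))
  linarith

end Hierarchy

/-! ### Couplings of least objective -/

namespace Hierarchy

variable {X C : Type*} [Fintype X] [DecidableEq X] [DecidableEq C] {G : Hierarchy X C}
  {z z' : X → ℝ} {k : ℕ} {ω : ℕ → ℝ} {K : ℝ} {μ : Finset X → ℝ} {π : Finset X × Finset X → ℝ}

/-- The couplings of a distribution of sets of servers with any distribution of sets of `k`
servers. -/
def couplings (μ : Finset X → ℝ) (k : ℕ) : Set (Finset X × Finset X → ℝ) :=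
  {π | (∀ p, 0 ≤ π p) ∧ (∀ A, ∑ B, π (A, B) = μ A) ∧ ∀ p, p.2.card ≠ k → π p = 0}

variable (G) in
/-- The cost of moving the servers from one set to another, with a penalty for imbalance. -/
noncomputable def roundingCost [MetricSpace X] (ω : ℕ → ℝ) (K : ℝ) (z : X → ℝ)
    (p : Finset X × Finset X) : ℝ :=
  earthmover (serverMass p.1) (serverMass p.2) + 4 * K * G.imbalance ω z p.2

variable (G) in
/-- The difference between the expected number of servers in a cluster and its mass. -/
noncomputable def excess (z : X → ℝ) (π : Finset X × Finset X → ℝ) (j : ℕ) (v : C) : ℝ :=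
  ∑ p, π p * G.count p.2 j v - G.mass z j v

variable (G) in
/-- The expected cost of a coupling, with a penalty for wrong marginals. -/
noncomputable def objective [MetricSpace X] (ω : ℕ → ℝ) (K : ℝ) (z : X → ℝ)
    (π : Finset X × Finset X → ℝ) : ℝ :=
  ∑ p, π p * G.roundingCost ω K z p +
    ∑ q ∈ (Icc 1 G.height).sigma fun j => G.nodes j, K * ω q.1 * |G.excess z π q.1 q.2|

variable (G) in
/-- A coupling of least objective. -/
def IsOptimalCoupling [MetricSpace X] (ω : ℕ → ℝ) (K : ℝ) (z : X → ℝ) (μ : Finset X → ℝ) (k : ℕ)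
    (π : Finset X × Finset X → ℝ) : Prop :=
  π ∈ couplings μ k ∧ ∀ π' ∈ couplings μ k, G.objective ω K z π ≤ G.objective ω K z π'

theorem isCompact_couplings (hμ : ∀ A, μ A ≤ 1) : IsCompact (couplings μ k) := by
  refine (isCompact_univ_pi fun _ : Finset X × Finset X => isCompact_Icc (a := (0 : ℝ))
    (b := 1)).of_isClosed_subset ?_ ?_
  · have heq : couplings μ k = {π | ∀ p, 0 ≤ π p} ∩ {π | ∀ A, ∑ B, π (A, B) = μ A} ∩
        {π | ∀ p : Finset X × Finset X, p.2.card ≠ k → π p = 0} := by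
      ext π
      exact ⟨fun h => ⟨⟨h.1, h.2.1⟩, h.2.2⟩, fun h => ⟨h.1.1, h.1.2, h.2⟩⟩
    rw [heq]
    refine IsClosed.inter (IsClosed.inter ?_ ?_) ?_
    · simp only [Set.ofPred_forall]
      exact isClosed_iInter fun p => isClosed_le continuous_const (by fun_prop)
    · simp only [Set.ofPred_forall]
      exact isClosed_iInter fun A => isClosed_eq (by fun_prop) continuous_const
    · simp only [Set.ofPred_forall]
      exact isClosed_iInter fun p => isClosed_iInter fun _ =>
        isClosed_eq (by fun_prop) continuous_const
  · rintro π ⟨h1, h2, -⟩ p -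
    refine ⟨h1 p, ?_⟩
    have h3 := single_le_sum (f := fun B => π (p.1, B)) (fun B _ => h1 _) (mem_univ p.2)
    rw [h2] at h3
    exact h3.trans (hμ _)

theorem diagonal_mem_couplings (hμ : ∀ A, 0 ≤ μ A) (hk : ∀ A, A.card ≠ k → μ A = 0) :
    (fun p : Finset X × Finset X => if p.1 = p.2 then μ p.1 else 0) ∈ couplings μ k := by
  refine ⟨fun p => ?_, fun A => ?_, fun p hp => ?_⟩
  · dsimp only; split_ifs; exacts [hμ _, le_rfl]
  · simp
  · dsimp only; split_ifs with h
    · exact hk _ (by rw [h]; exact hp)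
    · rfl

theorem exists_isOptimalCoupling [MetricSpace X] (z : X → ℝ) (ω : ℕ → ℝ) (K : ℝ)
    (hμ : ∀ A, 0 ≤ μ A) (hμ1 : ∀ A, μ A ≤ 1) (hk : ∀ A, A.card ≠ k → μ A = 0) :
    ∃ π, G.IsOptimalCoupling ω K z μ k π := by
  have hcont : Continuous (G.objective ω K z) := by
    unfold objective excess
    fun_prop
  obtain ⟨π, hπ, hmin⟩ := (isCompact_couplings (k := k) hμ1).exists_isMinOn
    ⟨_, diagonal_mem_couplings hμ hk⟩ hcont.continuousOn
  exact ⟨π, hπ, fun π' hπ' => hmin hπ'⟩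

/-- Moving mass of an optimal coupling from two pairs to two others does not pay. -/
theorem IsOptimalCoupling.exchange [MetricSpace X] (hπ : G.IsOptimalCoupling ω K z μ k π)
    (hK : 0 ≤ K) (hω : ∀ j, 0 ≤ ω j) {p₁ p₂ : Finset X × Finset X} (h₁ : 0 < π p₁) (h₂ : 0 < π p₂)
    {B₁ B₂ : Finset X} (hB₁ : B₁.card = k) (hB₂ : B₂.card = k) :
    0 ≤ (G.roundingCost ω K z (p₁.1, B₁) - G.roundingCost ω K z p₁) +
      (G.roundingCost ω K z (p₂.1, B₂) - G.roundingCost ω K z p₂) +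
      K * ∑ i ∈ Icc 1 G.height, ω i * ∑ v ∈ G.nodes i, dirAbs (G.excess z π i v)
        (((G.count B₁ i v : ℝ) - G.count p₁.2 i v) + (G.count B₂ i v - G.count p₂.2 i v)) := by
  obtain ⟨⟨hπ0, hπμ, hπk⟩, hmin⟩ := hπ
  let e : Finset X × Finset X → Finset X × Finset X → ℝ := fun q p => if p = q then 1 else 0
  -- Mass is shifted from two pairs in the support to pairs with the same first components, so the
  -- first marginal is kept.
  set d : Finset X × Finset X → ℝ := fun p =>
    (e (p₁.1, B₁) p - e p₁ p) + (e (p₂.1, B₂) p - e p₂ p) with hd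
  have he : ∀ q (f : Finset X × Finset X → ℝ), ∑ p, e q p * f p = f q := by
    intro q f; simp [e]
  have hsum : ∀ f : Finset X × Finset X → ℝ, ∑ p, d p * f p =
      (f (p₁.1, B₁) - f p₁) + (f (p₂.1, B₂) - f p₂) := by
    intro f
    simp only [hd, add_mul, sub_mul, sum_add_distrib, sum_sub_distrib, he]
  have herow : ∀ q A, ∑ B, e q (A, B) = if A = q.1 then 1 else 0 := by
    rintro ⟨A', B'⟩ A
    by_cases h : A = A' <;> simp [e, h]
  have hrow : ∀ A, ∑ B, d (A, B) = 0 := by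
    intro A
    simp only [hd, sum_add_distrib, sum_sub_distrib, herow]
    ring
  have he0 : ∀ q p, 0 ≤ e q p := fun q p => by simp only [e]; split_ifs <;> norm_num
  have hne : ∀ q p, p ≠ q → e q p = 0 := fun q p h => if_neg h
  have hev : ∀ᶠ t in nhdsWithin (0 : ℝ) (Set.Ioi 0), ∀ p, 0 ≤ π p + t * d p := by
    rw [Filter.eventually_all]
    intro p
    by_cases hp : 0 < π p
    · have ht : Filter.Tendsto (fun t : ℝ => π p + t * d p) (nhdsWithin 0 (Set.Ioi 0))
          (nhds (π p + 0 * d p)) :=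
        (Continuous.tendsto (by fun_prop) 0).mono_left nhdsWithin_le_nhds
      rw [zero_mul, add_zero] at ht
      filter_upwards [ht.eventually (lt_mem_nhds hp)] with t h using h.le
    · have h1 : 0 ≤ d p := by
        simp only [hd]
        rw [hne p₁ p (fun h => hp (h ▸ h₁)), hne p₂ p (fun h => hp (h ▸ h₂))]
        linarith [he0 (p₁.1, B₁) p, he0 (p₂.1, B₂) p]
      filter_upwards [self_mem_nhdsWithin] with t ht
      exact add_nonneg (hπ0 p) (mul_nonneg (le_of_lt ht) h1)
  have hk₁ : p₁.2.card = k := by_contra fun h => h₁.ne' (hπk _ h)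
  have hk₂ : p₂.2.card = k := by_contra fun h => h₂.ne' (hπk _ h)
  have hmem : ∀ᶠ t in nhdsWithin (0 : ℝ) (Set.Ioi 0),
      (fun p => π p + t * d p) ∈ couplings μ k := by
    filter_upwards [hev] with t ht
    refine ⟨ht, fun A => ?_, fun p hp => ?_⟩
    · rw [sum_add_distrib, ← mul_sum, hrow, mul_zero, add_zero, hπμ]
    · have h1 : ∀ q : Finset X × Finset X, q.2.card = k → p ≠ q := by
        rintro q hq rfl; exact hp hq
      simp only [hd]
      rw [hπk p hp, hne _ _ (h1 (p₁.1, B₁) hB₁), hne _ _ (h1 (p₂.1, B₂) hB₂),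
        hne _ _ (h1 p₁ hk₁), hne _ _ (h1 p₂ hk₂)]
      ring
  have hfoc := first_order_condition ((Icc 1 G.height).sigma fun j => G.nodes j)
    (G.roundingCost ω K z) (fun q => K * ω q.1) (fun p q => (G.count p.2 q.1 q.2 : ℝ))
    (fun q => G.mass z q.1 q.2) π d (fun q _ => mul_nonneg hK (hω _))
    (by filter_upwards [hmem] with t ht using hmin _ ht)
  simp only [hsum] at hfoc
  rw [sum_sigma] at hfoc
  refine hfoc.trans (le_of_eq ?_)
  congr 1
  rw [mul_sum]
  refine sum_congr rfl fun i _ => ?_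
  rw [mul_sum, mul_sum]
  refine sum_congr rfl fun v _ => ?_
  rw [← mul_assoc]
  rfl

variable (G) in
/-- A fractional state with `k` servers. -/
structure IsFractional (z : X → ℝ) (k : ℕ) : Prop where
  nonneg : ∀ x, 0 ≤ z x
  le_one : ∀ x, z x ≤ 1
  sum : ∑ x, z x = k

theorem mass_le_card (hz : ∀ x, z x ≤ 1) (j : ℕ) (a : C) : G.mass z j a ≤ (G.cl j a).card := by
  have := sum_le_sum fun x (_ : x ∈ G.cl j a) => hz x
  simpa [mass] using this

theorem exists_mem_of_count_pos {B : Finset X} {j : ℕ} {a : C} (h : 0 < G.count B j a) :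
    ∃ x ∈ B, G.node j x = a := by
  obtain ⟨x, hx⟩ := card_pos.1 h
  rw [mem_inter, mem_cl] at hx
  exact ⟨x, hx.1, hx.2⟩

theorem exists_notMem_of_count_lt {B : Finset X} {j : ℕ} {a : C}
    (h : G.count B j a < (G.cl j a).card) : ∃ x, x ∉ B ∧ G.node j x = a := by
  by_contra! hcon
  refine h.not_ge (card_le_card fun x hx => mem_inter.2 ⟨?_, hx⟩)
  by_contra hxB
  exact hcon x hxB (mem_cl.1 hx)

/-- A move of a server within a cluster, into a child that is not too full. -/
theorem exists_move [MetricSpace X] {c' : ℝ} (hc' : 0 ≤ c')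
    (hG' : ∀ x y, dist x y ≤ c' * G.treeDist x y) (hwt : ∀ j a, G.weight j a = ω j)
    (hω : ∀ j, 0 ≤ ω j) (hω' : ∀ j, 64 * ω (j + 1) ≤ ω j) (hK : 0 ≤ K) {A B : Finset X}
    (hAB : A.card = B.card) {j : ℕ} (hj : j < G.height)
    {c d : C} (hcd : c ≠ d) (hpar : G.parent j c = G.parent j d) (hc : 0 < G.count B (j + 1) c)
    (hd : G.count B (j + 1) d < (G.cl (j + 1) d).card) {D : ℝ}
    (hD : (roundingDefect (G.mass z (j + 1) c) (G.count B (j + 1) c - 1) : ℝ) -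
      roundingDefect (G.mass z (j + 1) c) (G.count B (j + 1) c) +
      (roundingDefect (G.mass z (j + 1) d) (G.count B (j + 1) d + 1) -
      roundingDefect (G.mass z (j + 1) d) (G.count B (j + 1) d)) ≤ D) :
    ∃ B' : Finset X, B'.card = B.card ∧
      G.roundingCost ω K z (A, B') - G.roundingCost ω K z (A, B) ≤
        ω (j + 1) * (c' * (2 + 2 / 63) + 4 * K * (D + 2 / 63)) ∧
      (∀ v, (G.count B' (j + 1) v : ℝ) - G.count B (j + 1) v =
        (if d = v then 1 else 0) - if c = v then 1 else 0) ∧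
      (∀ i ≤ j, ∀ v, (G.count B' i v : ℝ) - G.count B i v = 0) ∧
      ∀ i, ∑ v ∈ G.nodes i, |(G.count B' i v : ℝ) - G.count B i v| ≤ 2 := by
  obtain ⟨a, ha, rfl⟩ := exists_mem_of_count_pos hc
  obtain ⟨b, hb, rfl⟩ := exists_notMem_of_count_lt hd
  rw [G.parent_node, G.parent_node] at hpar
  have hmove := fun i v => count_move (G := G) ha hb i v
  refine ⟨insert b (B.erase a), ?_, ?_, fun v => hmove _ v, fun i hi v => ?_, fun i => ?_⟩
  · rw [card_insert_of_notMem (fun h => hb (mem_of_mem_erase h)), card_erase_of_mem ha]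
    have := card_pos.2 ⟨a, ha⟩
    omega
  · have h1 := earthmover_move hAB (hAB ▸ card_pos.2 ⟨a, ha⟩) ha hb
    have h2 := dist_le_of_node_eq hc' hG' hwt hω hω' hj hpar
    have h3 : G.imbalance ω z (insert b (B.erase a)) - G.imbalance ω z B ≤
        ω (j + 1) * (D + 2 / 63) := by
      refine imbalance_move hω hω' ha hb hj hpar hcd ?_
      have h4 := hmove (j + 1) (G.node (j + 1) a)
      have h5 := hmove (j + 1) (G.node (j + 1) b)
      rw [if_neg hcd.symm, if_pos rfl] at h4
      rw [if_neg hcd, if_pos rfl] at h5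
      have h6 : G.count (insert b (B.erase a)) (j + 1) (G.node (j + 1) a) =
          G.count B (j + 1) (G.node (j + 1) a) - 1 := by
        have : G.count (insert b (B.erase a)) (j + 1) (G.node (j + 1) a) + 1 =
            G.count B (j + 1) (G.node (j + 1) a) := by
          have : (G.count (insert b (B.erase a)) (j + 1) (G.node (j + 1) a) : ℝ) + 1 =
            G.count B (j + 1) (G.node (j + 1) a) := by linarith
          exact_mod_cast this
        omega
      have h7 : G.count (insert b (B.erase a)) (j + 1) (G.node (j + 1) b) =
          G.count B (j + 1) (G.node (j + 1) b) + 1 := by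
        have : (G.count (insert b (B.erase a)) (j + 1) (G.node (j + 1) b) : ℝ) =
            G.count B (j + 1) (G.node (j + 1) b) + 1 := by linarith
        exact_mod_cast this
      rw [h6, h7]
      exact hD
    have h4 := mul_le_mul_of_nonneg_left h3 (show 0 ≤ 4 * K by linarith)
    unfold roundingCost
    dsimp only
    linarith
  · rw [hmove, node_eq_of_le hi hpar, sub_self]
  · simp only [hmove]
    exact sum_abs_move_le i a b

end Hierarchy

/-! ### Optimal couplings are balanced -/

namespace Hierarchy

variable {X C : Type*} [Fintype X] [DecidableEq X] [DecidableEq C] {G : Hierarchy X C}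
  {z z' : X → ℝ} {k : ℕ} {ω : ℕ → ℝ} {c' : ℝ} {μ : Finset X → ℝ} {π : Finset X × Finset X → ℝ}

variable (G) in
/-- The weights of the hierarchy depend on the level only and decrease geometrically, and the
distances are dominated by those in the tree. -/
structure IsUniform [MetricSpace X] (ω : ℕ → ℝ) (c' : ℝ) : Prop where
  pos : 0 < c'
  dist_le : ∀ x y, dist x y ≤ c' * G.treeDist x y
  weight : ∀ j a, G.weight j a = ω j
  weight_pos : ∀ j, 0 < ω j
  decay : ∀ j, 64 * ω (j + 1) ≤ ω j

theorem IsOptimalCoupling.card_eq [MetricSpace X] {K : ℝ} (hπ : G.IsOptimalCoupling ω K z μ k π)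
    (hμk : ∀ A, A.card ≠ k → μ A = 0) {p : Finset X × Finset X} (hp : 0 < π p) :
    p.1.card = k ∧ p.2.card = k := by
  constructor
  · by_contra h
    have h1 := single_le_sum (f := fun B => π (p.1, B)) (fun B _ => hπ.1.1 _) (mem_univ p.2)
    rw [hπ.1.2.1, hμk _ h] at h1
    exact absurd hp (not_lt.2 h1)
  · by_contra h
    exact hp.ne' (hπ.1.2.2 _ h)

theorem mem_nodes_of_count_pos {B : Finset X} {j : ℕ} {a : C} (h : 0 < G.count B j a) :
    a ∈ G.nodes j := by
  obtain ⟨x, -, rfl⟩ := exists_mem_of_count_pos h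
  exact node_mem_nodes j x

theorem mem_nodes_of_count_lt {B : Finset X} {j : ℕ} {a : C}
    (h : G.count B j a < (G.cl j a).card) : a ∈ G.nodes j := by
  obtain ⟨x, -, rfl⟩ := exists_notMem_of_count_lt h
  exact node_mem_nodes j x

/-- An optimal coupling is not improved by a single move. -/
theorem IsUniform.single_move [MetricSpace X] (hG : G.IsUniform ω c')
    (hπ : G.IsOptimalCoupling ω (3 * c') z μ k π) (hμk : ∀ A, A.card ≠ k → μ A = 0)
    {p : Finset X × Finset X} (hp : 0 < π p) {j : ℕ} (hj : j < G.height) {c d : C} (hcd : c ≠ d)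
    (hpar : G.parent j c = G.parent j d) (hc : 0 < G.count p.2 (j + 1) c)
    (hd : G.count p.2 (j + 1) d < (G.cl (j + 1) d).card) {D : ℝ}
    (hD : (roundingDefect (G.mass z (j + 1) c) (G.count p.2 (j + 1) c - 1) : ℝ) -
      roundingDefect (G.mass z (j + 1) c) (G.count p.2 (j + 1) c) +
      (roundingDefect (G.mass z (j + 1) d) (G.count p.2 (j + 1) d + 1) -
      roundingDefect (G.mass z (j + 1) d) (G.count p.2 (j + 1) d)) ≤ D) :
    -2 < 4 * D + (dirAbs (G.excess z π (j + 1) c) (-1) + dirAbs (G.excess z π (j + 1) d) 1) := by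
  have hcpos := hG.pos
  have hω := fun j => (hG.weight_pos j).le
  obtain ⟨hp1, hp2⟩ := hπ.card_eq hμk hp
  obtain ⟨B', hB', hcost, hlevel, habove, hbelow⟩ := exists_move hG.pos.le hG.dist_le hG.weight hω
    hG.decay (show 0 ≤ 3 * c' by linarith) (hp1.trans hp2.symm) hj hcd hpar hc hd hD
  have hex := hπ.exchange (by linarith) hω hp hp (hB'.trans hp2) hp2
  set S : ℕ → ℝ := fun i => ∑ v ∈ G.nodes i, dirAbs (G.excess z π i v)
        (((G.count B' i v : ℝ) - G.count p.2 i v) + (G.count p.2 i v - G.count p.2 i v)) with hS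
  have h1 : ∀ i < j + 1, S i ≤ 0 := fun i hi => by
    simp only [hS, habove i (Nat.lt_succ_iff.1 hi), sub_self, add_zero, dirAbs_zero, sum_const_zero,
      le_refl]
  have h2 : ∀ i, S i ≤ 2 := fun i => (sum_le_sum fun v _ => by
    rw [sub_self, add_zero]; exact dirAbs_le _ _).trans (hbelow i)
  have h3 := sum_levels_le hω hG.decay two_pos.le (Nat.le_add_left 1 j) hj h1 fun i _ => h2 i
  have h4 : S (j + 1) =
      dirAbs (G.excess z π (j + 1) c) (-1) + dirAbs (G.excess z π (j + 1) d) 1 := by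
    simp only [hS, hlevel, sub_self, add_zero]
    rw [sum_eq_add_of_mem _ _ (mem_nodes_of_count_pos hc) (mem_nodes_of_count_lt hd) hcd
      fun v _ hv => by rw [if_neg hv.2.symm, if_neg hv.1.symm, sub_self, dirAbs_zero]]
    rw [if_pos rfl, if_neg hcd.symm, if_neg hcd, if_pos rfl]
    norm_num
  -- With S = `S (j + 1)`, in units of c' ω (j + 1), the change is at most 2 + 2/63 for movement, 12
  -- (D + 2/63) for imbalance and 3 (S + 2/63) for the mean. The total is 2 + 32/63 + 3 (4D + S),
  -- negative if 4D + S ≤ -2.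
  by_contra hcon
  rw [not_lt, ← h4] at hcon
  have h5 := mul_le_mul_of_nonneg_left h3 (show 0 ≤ 3 * c' by linarith)
  have h6 : 0 < c' * ω (j + 1) := mul_pos hcpos (hG.weight_pos _)
  have h7 := mul_le_mul_of_nonneg_left hcon h6.le
  rw [Prod.mk.eta, sub_self, add_zero] at hex
  have h8 := hex.trans (add_le_add hcost h5)
  nlinarith

/-- An optimal coupling is not improved by two moves that exchange servers between three
clusters. -/
theorem IsUniform.double_move [MetricSpace X] (hG : G.IsUniform ω c')
    (hπ : G.IsOptimalCoupling ω (3 * c') z μ k π) (hμk : ∀ A, A.card ≠ k → μ A = 0)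
    {p q : Finset X × Finset X} (hp : 0 < π p) (hq : 0 < π q) {j : ℕ} (hj : j < G.height)
    {c d e : C} (hcd : c ≠ d) (hce : c ≠ e) (hed : e ≠ d)
    (hpar : G.parent j c = G.parent j e) (hpar' : G.parent j e = G.parent j d)
    (hc : 0 < G.count p.2 (j + 1) c)
    (he : G.count p.2 (j + 1) e < (G.cl (j + 1) e).card)
    (he' : 0 < G.count q.2 (j + 1) e)
    (hd : G.count q.2 (j + 1) d < (G.cl (j + 1) d).card)
    (hD : (roundingDefect (G.mass z (j + 1) c) (G.count p.2 (j + 1) c - 1) : ℝ) -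
      roundingDefect (G.mass z (j + 1) c) (G.count p.2 (j + 1) c) +
      (roundingDefect (G.mass z (j + 1) e) (G.count p.2 (j + 1) e + 1) -
      roundingDefect (G.mass z (j + 1) e) (G.count p.2 (j + 1) e)) ≤ 0)
    (hD' : (roundingDefect (G.mass z (j + 1) e) (G.count q.2 (j + 1) e - 1) : ℝ) -
      roundingDefect (G.mass z (j + 1) e) (G.count q.2 (j + 1) e) +
      (roundingDefect (G.mass z (j + 1) d) (G.count q.2 (j + 1) d + 1) -
      roundingDefect (G.mass z (j + 1) d) (G.count q.2 (j + 1) d)) ≤ 0) :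
    -2 < dirAbs (G.excess z π (j + 1) c) (-1) + dirAbs (G.excess z π (j + 1) d) 1 := by
  have hcpos := hG.pos
  have hω := fun j => (hG.weight_pos j).le
  obtain ⟨hp1, hp2⟩ := hπ.card_eq hμk hp
  obtain ⟨hq1, hq2⟩ := hπ.card_eq hμk hq
  obtain ⟨B₁, hB₁, hcost, hlevel, habove, hbelow⟩ := exists_move hG.pos.le hG.dist_le hG.weight hω
    hG.decay (show 0 ≤ 3 * c' by linarith) (hp1.trans hp2.symm) hj hce hpar hc he hD
  obtain ⟨B₂, hB₂, hcost', hlevel', habove', hbelow'⟩ := exists_move hG.pos.le hG.dist_le hG.weight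
    hω hG.decay (show 0 ≤ 3 * c' by linarith) (hq1.trans hq2.symm) hj hed hpar' he' hd hD'
  have hex := hπ.exchange (by linarith) hω hp hq (hB₁.trans hp2) (hB₂.trans hq2)
  set S : ℕ → ℝ := fun i => ∑ v ∈ G.nodes i, dirAbs (G.excess z π i v)
        (((G.count B₁ i v : ℝ) - G.count p.2 i v) + (G.count B₂ i v - G.count q.2 i v)) with hS
  have h1 : ∀ i < j + 1, S i ≤ 0 := fun i hi => by
    simp only [hS, habove i (Nat.lt_succ_iff.1 hi), habove' i (Nat.lt_succ_iff.1 hi), add_zero,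
      dirAbs_zero, sum_const_zero, le_refl]
  have h2 : ∀ i, S i ≤ 4 := fun i => by
    have : S i ≤ _ := sum_le_sum fun v _ => (dirAbs_le _ _).trans (abs_add_le _ _)
    rw [sum_add_distrib] at this
    linarith [hbelow i, hbelow' i]
  have h3 := sum_levels_le hω hG.decay (by norm_num) (Nat.le_add_left 1 j) hj h1 fun i _ => h2 i
  have h4 : S (j + 1) =
      dirAbs (G.excess z π (j + 1) c) (-1) + dirAbs (G.excess z π (j + 1) d) 1 := by
    simp only [hS, hlevel, hlevel']
    rw [sum_eq_add_of_mem _ _ (mem_nodes_of_count_pos hc) (mem_nodes_of_count_lt hd) hcd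
      fun v _ hv => ?_]
    · rw [if_pos rfl, if_neg hcd.symm, if_neg hcd, if_pos rfl, if_neg hce.symm, if_neg hed]
      norm_num
    · rw [if_neg hv.2.symm, if_neg hv.1.symm]
      convert dirAbs_zero _ using 2
      ring
  -- Two moves with D = 0 cost 4 + 64/63 + 3 S (j + 1) in the same units, which is negative if S (j
  -- + 1) ≤ -2.
  by_contra hcon
  rw [not_lt, ← h4] at hcon
  have h5 := mul_le_mul_of_nonneg_left h3 (show 0 ≤ 3 * c' by linarith)
  have h6 : 0 < c' * ω (j + 1) := mul_pos hcpos (hG.weight_pos _)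
  have h7 := mul_le_mul_of_nonneg_left hcon h6.le
  have h8 := hex.trans (add_le_add (add_le_add hcost hcost') h5)
  nlinarith

variable (G) in
/-- Clusters at level `j` hold the correct number of servers, surely and in expectation. -/
structure IsBalancedAt (z : X → ℝ) (π : Finset X × Finset X → ℝ) (j : ℕ) : Prop where
  defect : ∀ p, 0 < π p → ∀ v, roundingDefect (G.mass z j v) (G.count p.2 j v) = 0
  excess : ∀ v, G.excess z π j v = 0

theorem defect_eq_zero_iff {t : ℝ} {n : ℕ} : roundingDefect t n = 0 ↔ ⌊t⌋₊ ≤ n ∧ n ≤ ⌈t⌉₊ := by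
  unfold roundingDefect; omega

theorem cl_eq_empty {j : ℕ} {v : C} (hv : v ∉ G.nodes j) : G.cl j v = ∅ := by
  rw [eq_empty_iff_forall_notMem]
  intro x hx
  exact hv (mem_cl.1 hx ▸ node_mem_nodes j x)

theorem excess_eq_sum (hπ1 : ∑ p, π p = 1) (j : ℕ) (v : C) :
    G.excess z π j v = ∑ p, π p * (G.count p.2 j v - G.mass z j v) := by
  simp only [mul_sub, sum_sub_distrib]
  rw [← sum_mul, hπ1, one_mul, excess]

theorem isBalancedAt_zero (hz : ∑ x, z x = k) (hπ0 : ∀ p, 0 ≤ π p) (hπ1 : ∑ p, π p = 1)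
    (hπk : ∀ p, 0 < π p → p.2.card = k) : G.IsBalancedAt z π 0 := by
  have h : ∀ p, 0 < π p → ∀ v, (G.count p.2 0 v : ℝ) = G.mass z 0 v := by
    intro p hp v
    by_cases hv : v ∈ G.nodes 0
    · obtain ⟨x, -, rfl⟩ := mem_image.1 hv
      unfold count mass
      rw [cl_zero, inter_univ, hz, hπk p hp]
    · simp [count, mass, cl_eq_empty hv]
  refine ⟨fun p hp v => ?_, fun v => ?_⟩
  · rw [← h p hp v, defect_eq_zero_iff]
    simp
  · rw [excess_eq_sum hπ1]
    refine sum_eq_zero fun p _ => ?_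
    rcases (hπ0 p).eq_or_lt with h0 | h0
    · rw [← h0, zero_mul]
    · rw [h p h0, sub_self, mul_zero]

theorem dirAbs_neg_one_of_pos {s : ℝ} (hs : 0 < s) : dirAbs s (-1) = -1 := by
  unfold dirAbs; rw [if_pos (by linarith)]; norm_num

theorem dirAbs_one_of_neg {s : ℝ} (hs : s < 0) : dirAbs s 1 = -1 := by
  unfold dirAbs; rw [if_pos (by linarith)]; norm_num

section

variable [MetricSpace X] (hG : G.IsUniform ω c') (hz : IsFractional z k)
  (hπ : G.IsOptimalCoupling ω (3 * c') z μ k π) (hμk : ∀ A, A.card ≠ k → μ A = 0)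
include hG hz hπ hμk

/-- If a child has too few servers, the balance of the parent yields a sibling above its floor, and
moving one server reduces the defect. The change -1 of the defect, with weight 4, outweighs any
effect on the means. Too many servers is symmetric. -/
theorem IsUniform.defect_succ {j : ℕ} (hj : j < G.height) (hbal : G.IsBalancedAt z π j)
    {p : Finset X × Finset X} (hp : 0 < π p) (v : C) :
    roundingDefect (G.mass z (j + 1) v) (G.count p.2 (j + 1) v) = 0 := by
  by_cases hv : v ∉ G.nodes (j + 1)
  · simp [count, mass, cl_eq_empty hv, roundingDefect]
  rw [not_not] at hv
  obtain ⟨x, -, rfl⟩ := mem_image.1 hv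
  set v := G.node (j + 1) x with hvdef
  set F := (G.nodes (j + 1)).filter (fun a => G.parent j a = G.node j x) with hF
  have hvF : v ∈ F := mem_filter.2 ⟨node_mem_nodes _ x, G.parent_node j x⟩
  have hcount := count_children (G := G) p.2 j x
  have hmass := mass_children (G := G) z j x
  rw [← hF] at hcount hmass
  obtain ⟨hlo, hhi⟩ := defect_eq_zero_iff.1 (hbal.defect p hp (G.node j x))
  have hm0 : ∀ d, 0 ≤ G.mass z (j + 1) d := fun d => mass_nonneg hz.nonneg _ _
  have hceil : ∀ d, ⌈G.mass z (j + 1) d⌉₊ ≤ (G.cl (j + 1) d).card := fun d =>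
    Nat.ceil_le.2 (mass_le_card hz.le_one _ _)
  have hsumceil : ⌈G.mass z j (G.node j x)⌉₊ ≤ ∑ d ∈ F, ⌈G.mass z (j + 1) d⌉₊ := by
    rw [Nat.ceil_le, ← hmass]
    push_cast
    exact sum_le_sum fun d _ => Nat.le_ceil _
  have hsumfloor : ∑ d ∈ F, ⌊G.mass z (j + 1) d⌋₊ ≤ ⌊G.mass z j (G.node j x)⌋₊ := by
    rw [Nat.le_floor_iff (mass_nonneg hz.nonneg _ _), ← hmass]
    push_cast
    exact sum_le_sum fun d _ => Nat.floor_le (hm0 d)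
  have hfc := fun d => Nat.floor_le_ceil (G.mass z (j + 1) d)
  have hpar : ∀ d ∈ F, G.parent j d = G.node j x := fun d hd => (mem_filter.1 hd).2
  by_contra hne
  rw [defect_eq_zero_iff, not_and_or, not_le, not_le] at hne
  rcases hne with hlow | hhigh
  · have hd : ∃ d ∈ F, ⌊G.mass z (j + 1) d⌋₊ < G.count p.2 (j + 1) d := by
      by_contra! hcon
      have := sum_lt_sum hcon ⟨v, hvF, hlow⟩
      omega
    obtain ⟨d, hdF, hd⟩ := hd
    have hdv : d ≠ v := by rintro rfl; omega
    -- The two mean terms total at most 2, so 4 · (-1) + 2 = -2 contradicts the strict bound.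
    have h := hG.single_move hπ hμk hp hj hdv ((hpar d hdF).trans (hpar v hvF).symm)
      (by omega) (by have := hceil v; have := hfc v; omega) (D := -1) (by
        have h1 : roundingDefect (G.mass z (j + 1) d) (G.count p.2 (j + 1) d - 1) ≤
            roundingDefect (G.mass z (j + 1) d) (G.count p.2 (j + 1) d) := by
          unfold roundingDefect; omega
        have h2 : roundingDefect (G.mass z (j + 1) v) (G.count p.2 (j + 1) v + 1) + 1 ≤
            roundingDefect (G.mass z (j + 1) v) (G.count p.2 (j + 1) v) := by
          have := hfc v
          unfold roundingDefect; omega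
        have h1' : (roundingDefect (G.mass z (j + 1) d) (G.count p.2 (j + 1) d - 1) : ℝ) ≤
            roundingDefect (G.mass z (j + 1) d) (G.count p.2 (j + 1) d) := by exact_mod_cast h1
        have h2' : (roundingDefect (G.mass z (j + 1) v) (G.count p.2 (j + 1) v + 1) : ℝ) + 1 ≤
            roundingDefect (G.mass z (j + 1) v) (G.count p.2 (j + 1) v) := by exact_mod_cast h2
        linarith)
    have h1 := dirAbs_le (G.excess z π (j + 1) d) (-1)
    have h2 := dirAbs_le (G.excess z π (j + 1) v) 1
    rw [abs_neg] at h1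
    rw [abs_one] at h1 h2
    linarith
  · have hd : ∃ d ∈ F, G.count p.2 (j + 1) d < ⌈G.mass z (j + 1) d⌉₊ := by
      by_contra! hcon
      have := sum_lt_sum hcon ⟨v, hvF, hhigh⟩
      omega
    obtain ⟨d, hdF, hd⟩ := hd
    have hdv : v ≠ d := by rintro h; rw [← h] at hd; omega
    have h := hG.single_move hπ hμk hp hj hdv ((hpar v hvF).trans (hpar d hdF).symm)
      (by omega) (by have := hceil d; omega) (D := -1) (by
        have h1 : roundingDefect (G.mass z (j + 1) d) (G.count p.2 (j + 1) d + 1) ≤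
            roundingDefect (G.mass z (j + 1) d) (G.count p.2 (j + 1) d) := by
          unfold roundingDefect; omega
        have h2 : roundingDefect (G.mass z (j + 1) v) (G.count p.2 (j + 1) v - 1) + 1 ≤
            roundingDefect (G.mass z (j + 1) v) (G.count p.2 (j + 1) v) := by
          have := hfc v
          unfold roundingDefect; omega
        have h1' : (roundingDefect (G.mass z (j + 1) d) (G.count p.2 (j + 1) d + 1) : ℝ) ≤
            roundingDefect (G.mass z (j + 1) d) (G.count p.2 (j + 1) d) := by exact_mod_cast h1
        have h2' : (roundingDefect (G.mass z (j + 1) v) (G.count p.2 (j + 1) v - 1) : ℝ) + 1 ≤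
            roundingDefect (G.mass z (j + 1) v) (G.count p.2 (j + 1) v) := by exact_mod_cast h2
        linarith)
    have h1 := dirAbs_le (G.excess z π (j + 1) v) (-1)
    have h2 := dirAbs_le (G.excess z π (j + 1) d) 1
    rw [abs_neg] at h1
    rw [abs_one] at h1 h2
    linarith

/-- Errors of the means sum to zero among siblings, so one child c has surplus and another d a
deficit. A set of servers above the mass in c and below it in d would allow a single improving move.
Otherwise two sets and a third sibling allow two moves that correct c and d simultaneously without
creating any defect. -/
theorem IsUniform.excess_succ (hπ1 : ∑ p, π p = 1) {j : ℕ} (hj : j < G.height)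
    (hbal : G.IsBalancedAt z π j) (v : C) : G.excess z π (j + 1) v = 0 := by
  have hdef := fun p (hp : 0 < π p) v => defect_eq_zero_iff.1 (hG.defect_succ hz hπ hμk hj hbal hp v)
  by_cases hv : v ∉ G.nodes (j + 1)
  · simp [excess, count, mass, cl_eq_empty hv]
  rw [not_not] at hv
  obtain ⟨x, -, rfl⟩ := mem_image.1 hv
  set F := (G.nodes (j + 1)).filter (fun a => G.parent j a = G.node j x) with hF
  have hvF : G.node (j + 1) x ∈ F := mem_filter.2 ⟨node_mem_nodes _ x, G.parent_node j x⟩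
  have hcount := fun B => count_children (G := G) B j x
  have hmass := mass_children (G := G) z j x
  rw [← hF] at hmass
  simp only [← hF] at hcount
  have hm0 : ∀ d, 0 ≤ G.mass z (j + 1) d := fun d => mass_nonneg hz.nonneg _ _
  have hceil : ∀ d, ⌈G.mass z (j + 1) d⌉₊ ≤ (G.cl (j + 1) d).card := fun d =>
    Nat.ceil_le.2 (mass_le_card hz.le_one _ _)
  have hpar : ∀ d ∈ F, G.parent j d = G.node j x := fun d hd => (mem_filter.1 hd).2
  have hsum : ∑ d ∈ F, G.excess z π (j + 1) d = 0 := by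
    rw [← hbal.excess (G.node j x)]
    unfold excess
    rw [sum_sub_distrib, hmass, sum_comm]
    congr 1
    refine sum_congr rfl fun p _ => ?_
    rw [← mul_sum, ← hcount p.2]
    push_cast
    rfl
  have hlow : ∀ {p : Finset X × Finset X} {d : C}, (G.count p.2 (j + 1) d : ℝ) <
      G.mass z (j + 1) d → G.count p.2 (j + 1) d < ⌈G.mass z (j + 1) d⌉₊ := fun h => Nat.lt_ceil.2 h
  have hhigh : ∀ {p : Finset X × Finset X} {d : C}, G.mass z (j + 1) d < G.count p.2 (j + 1) d →
      ⌊G.mass z (j + 1) d⌋₊ < G.count p.2 (j + 1) d := fun h => (Nat.floor_lt (hm0 _)).2 h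
  by_contra hne
  obtain ⟨c, hcF, hc⟩ := exists_pos_of_sum_zero_of_exists_nonzero _ hsum ⟨_, hvF, hne⟩
  obtain ⟨d, hdF, hd⟩ := exists_pos_of_sum_zero_of_exists_nonzero (s := F)
    (fun d => - G.excess z π (j + 1) d) (by rw [sum_neg_distrib, hsum, neg_zero])
    ⟨_, hvF, neg_ne_zero.2 hne⟩
  rw [neg_pos] at hd
  have hcd : c ≠ d := by rintro rfl; linarith
  have hdir : dirAbs (G.excess z π (j + 1) c) (-1) + dirAbs (G.excess z π (j + 1) d) 1 = -2 := by
    rw [dirAbs_neg_one_of_pos hc, dirAbs_one_of_neg hd]; norm_num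
  have hdefdec : ∀ (p : Finset X × Finset X) (e : C), ⌊G.mass z (j + 1) e⌋₊ <
      G.count p.2 (j + 1) e → (roundingDefect (G.mass z (j + 1) e) (G.count p.2 (j + 1) e - 1) : ℝ) ≤
      roundingDefect (G.mass z (j + 1) e) (G.count p.2 (j + 1) e) := by
    intro p e h
    have : roundingDefect (G.mass z (j + 1) e) (G.count p.2 (j + 1) e - 1) ≤
      roundingDefect (G.mass z (j + 1) e) (G.count p.2 (j + 1) e) := by
      unfold roundingDefect; omega
    exact_mod_cast this
  have hdefinc : ∀ (p : Finset X × Finset X) (e : C), G.count p.2 (j + 1) e <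
      ⌈G.mass z (j + 1) e⌉₊ → (roundingDefect (G.mass z (j + 1) e) (G.count p.2 (j + 1) e + 1) : ℝ) ≤
      roundingDefect (G.mass z (j + 1) e) (G.count p.2 (j + 1) e) := by
    intro p e h
    have : roundingDefect (G.mass z (j + 1) e) (G.count p.2 (j + 1) e + 1) ≤
      roundingDefect (G.mass z (j + 1) e) (G.count p.2 (j + 1) e) := by
      unfold roundingDefect; omega
    exact_mod_cast this
  obtain ⟨p, hp, hpc⟩ : ∃ p, 0 < π p ∧ G.mass z (j + 1) c < G.count p.2 (j + 1) c := by
    by_contra! hcon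
    rw [excess_eq_sum hπ1] at hc
    refine hc.not_ge (sum_nonpos fun p _ => ?_)
    rcases (hπ.1.1 p).eq_or_lt with h0 | h0
    · rw [← h0, zero_mul]
    · exact mul_nonpos_of_nonneg_of_nonpos h0.le (sub_nonpos.2 (hcon p h0))
  obtain ⟨q, hq, hqd⟩ : ∃ q, 0 < π q ∧ G.count q.2 (j + 1) d < G.mass z (j + 1) d := by
    by_contra! hcon
    rw [excess_eq_sum hπ1] at hd
    refine hd.not_ge (sum_nonneg fun p _ => ?_)
    rcases (hπ.1.1 p).eq_or_lt with h0 | h0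
    · rw [← h0, zero_mul]
    · exact mul_nonneg h0.le (sub_nonneg.2 (hcon p h0))
  have hsingle : ∀ p, 0 < π p → G.mass z (j + 1) c < G.count p.2 (j + 1) c →
      G.mass z (j + 1) d ≤ G.count p.2 (j + 1) d := by
    intro p hp hpc
    by_contra! hpd
    have h1 := hhigh hpc
    have h2 := hlow hpd
    have h := hG.single_move hπ hμk hp hj hcd ((hpar c hcF).trans (hpar d hdF).symm)
      (by omega) (h2.trans_le (hceil d)) (D := 0)
      (by linarith [hdefdec p c h1, hdefinc p d h2])
    rw [hdir] at h
    linarith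
  have hpd := hsingle p hp hpc
  have hqc : G.count q.2 (j + 1) c ≤ G.mass z (j + 1) c := by
    by_contra! h
    exact absurd (hsingle q hq h) (not_le.2 hqd)
  have hlt_c : G.count q.2 (j + 1) c < G.count p.2 (j + 1) c := by
    exact_mod_cast hqc.trans_lt hpc
  have hlt_d : G.count q.2 (j + 1) d < G.count p.2 (j + 1) d := by
    exact_mod_cast hqd.trans_le hpd
  -- The set of `p` exceeds that of `q` by at least one in both c and d, while the parent's counts
  -- differ by at most one; some sibling must compensate.
  obtain ⟨e, heF, he⟩ : ∃ e ∈ F, G.count p.2 (j + 1) e < G.count q.2 (j + 1) e := by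
    by_contra! hcon
    have hF1 := hcount p.2
    have hF2 := hcount q.2
    have hdF' : d ∈ F.erase c := mem_erase.2 ⟨hcd.symm, hdF⟩
    rw [← add_sum_erase _ _ hcF, ← add_sum_erase _ _ hdF'] at hF1 hF2
    have h1 : ∑ e ∈ (F.erase c).erase d, G.count q.2 (j + 1) e ≤
        ∑ e ∈ (F.erase c).erase d, G.count p.2 (j + 1) e :=
      sum_le_sum fun e he => hcon e (mem_of_mem_erase (mem_of_mem_erase he))
    have h2 := defect_eq_zero_iff.1 (hbal.defect p hp (G.node j x))
    have h3 := defect_eq_zero_iff.1 (hbal.defect q hq (G.node j x))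
    have h4 := Nat.ceil_le_floor_add_one (G.mass z j (G.node j x))
    omega
  have hce : c ≠ e := by rintro rfl; omega
  have hed : e ≠ d := by rintro rfl; omega
  have hpe := hdef p hp e
  have hqe := hdef q hq e
  have hqd' := hlow hqd
  -- The set of `p` moves a server from c to e, that of `q` one from e to d. The mean of e is
  -- unchanged, and both counts in e stay between floor and ceiling.
  have h := hG.double_move hπ hμk hp hq hj hcd hce hed ((hpar c hcF).trans (hpar e heF).symm)
    ((hpar e heF).trans (hpar d hdF).symm) (by omega) (by have := hceil e; omega) (by omega)
    (hqd'.trans_le (hceil d))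
    (by linarith [hdefdec p c (hhigh hpc), hdefinc p e (by omega)])
    (by linarith [hdefdec q e (by omega), hdefinc q d hqd'])
  rw [hdir] at h
  linarith

/-- Optimal couplings are balanced on every level. -/
theorem IsUniform.isBalancedAt (hμ1 : ∑ A, μ A = 1) {j : ℕ} (hj : j ≤ G.height) :
    G.IsBalancedAt z π j := by
  have hπ1 : ∑ p, π p = 1 := by
    rw [Fintype.sum_prod_type, ← hμ1]
    exact sum_congr rfl fun A _ => hπ.1.2.1 A
  induction j with
  | zero => exact isBalancedAt_zero hz.sum hπ.1.1 hπ1 fun p hp => (hπ.card_eq hμk hp).2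
  | succ j ih =>
    exact ⟨fun p hp v => hG.defect_succ hz hπ hμk hj (ih (by omega)) hp v,
      fun v => hG.excess_succ hz hπ hμk hπ1 hj (ih (by omega)) v⟩

end

end Hierarchy

/-! ### The cost of rebalancing -/

/-- On the at most two roundings of t the defect with respect to t' is dominated by one affine
function, the same for all of them. Averages over roundings with mean t are thus bounded by the
value of that function at t. -/
theorem roundingDefect_le_cases (t t' : ℝ) :
    (t ≤ t' ∧ ∀ n : ℕ, ⌊t⌋₊ ≤ n ∧ n ≤ ⌈t⌉₊ → (roundingDefect t' n : ℝ) ≤ t' - n) ∨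
    (∀ n : ℕ, ⌊t⌋₊ ≤ n ∧ n ≤ ⌈t⌉₊ → roundingDefect t' n = 0) ∨
    (t' ≤ t ∧ ∀ n : ℕ, ⌊t⌋₊ ≤ n ∧ n ≤ ⌈t⌉₊ → (roundingDefect t' n : ℝ) ≤ n - t') := by
  have h1 := Nat.floor_le_ceil t
  have h2 := Nat.floor_le_ceil t'
  have h3 := Nat.ceil_le_floor_add_one t
  have h4 := Nat.ceil_le_floor_add_one t'
  rcases le_total t t' with h | h
  · have h5 := Nat.floor_mono h
    have h6 := Nat.ceil_mono h
    by_cases h7 : ⌈t⌉₊ ≤ ⌊t'⌋₊ ∧ 0 ≤ t'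
    · refine Or.inl ⟨h, fun n hn => ?_⟩
      have h8 : roundingDefect t' n + n = ⌊t'⌋₊ := by unfold roundingDefect; omega
      have h9 : (roundingDefect t' n : ℝ) + n = ⌊t'⌋₊ := by exact_mod_cast h8
      linarith [Nat.floor_le h7.2]
    · refine Or.inr (Or.inl fun n hn => ?_)
      by_cases h8 : 0 ≤ t'
      · have h9 : ¬ ⌈t⌉₊ ≤ ⌊t'⌋₊ := fun h => h7 ⟨h, h8⟩
        unfold roundingDefect; omega
      · have h9 : ⌊t'⌋₊ = 0 := Nat.floor_of_nonpos (not_le.1 h8).le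
        unfold roundingDefect; omega
  · have h5 := Nat.floor_mono h
    have h6 := Nat.ceil_mono h
    by_cases h7 : ⌈t'⌉₊ ≤ ⌊t⌋₊
    · refine Or.inr (Or.inr ⟨h, fun n hn => ?_⟩)
      have h8 : roundingDefect t' n + ⌈t'⌉₊ = n := by unfold roundingDefect; omega
      have h9 : (roundingDefect t' n : ℝ) + ⌈t'⌉₊ = n := by exact_mod_cast h8
      linarith [Nat.le_ceil t']
    · refine Or.inr (Or.inl fun n hn => ?_)
      unfold roundingDefect; omega

/-- A random number that rounds `t` is on average within `|t' - t|` of the roundings of `t'`. -/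
theorem sum_roundingDefect_le {ι : Type*} [Fintype ι] {μ : ι → ℝ} {n : ι → ℕ} {t : ℝ} (t' : ℝ)
    (hμ : ∀ i, 0 ≤ μ i) (hμ1 : ∑ i, μ i = 1)
    (hn : ∀ i, 0 < μ i → roundingDefect t (n i) = 0) (ht : ∑ i, μ i * n i = t) :
    ∑ i, μ i * (roundingDefect t' (n i) : ℝ) ≤ |t' - t| := by
  have key : ∀ f : ℕ → ℝ, (∀ m : ℕ, ⌊t⌋₊ ≤ m ∧ m ≤ ⌈t⌉₊ → (roundingDefect t' m : ℝ) ≤ f m) →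
      ∑ i, μ i * (roundingDefect t' (n i) : ℝ) ≤ ∑ i, μ i * f (n i) := by
    intro f hf
    refine sum_le_sum fun i _ => ?_
    rcases (hμ i).eq_or_lt with h | h
    · rw [← h, zero_mul, zero_mul]
    · exact mul_le_mul_of_nonneg_left (hf _ (Hierarchy.defect_eq_zero_iff.1 (hn i h))) h.le
  rcases roundingDefect_le_cases t t' with ⟨-, h⟩ | h | ⟨-, h⟩
  · have := key (fun m => t' - m) h
    simp only [mul_sub, sum_sub_distrib, ht] at this
    rw [← sum_mul, hμ1, one_mul] at this
    exact this.trans (le_abs_self _)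
  · have := key (fun _ => 0) fun m hm => by rw [h m hm, Nat.cast_zero]
    simp only [mul_zero, sum_const_zero] at this
    exact this.trans (abs_nonneg _)
  · have := key (fun m => m - t') h
    simp only [mul_sub, sum_sub_distrib, ht] at this
    rw [← sum_mul, hμ1, one_mul] at this
    rw [abs_sub_comm]
    exact this.trans (le_abs_self _)

namespace Hierarchy

variable {X C : Type*} [Fintype X] [DecidableEq X] [DecidableEq C] {G : Hierarchy X C}
  {z z' : X → ℝ} {k : ℕ} {ω : ℕ → ℝ} {c c' : ℝ} {μ : Finset X → ℝ}

variable (G) in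
/-- A distribution of sets of `k` servers that rounds the state `z` in every cluster. -/
structure IsBalanced (z : X → ℝ) (k : ℕ) (μ : Finset X → ℝ) : Prop where
  nonneg : ∀ A, 0 ≤ μ A
  sum : ∑ A, μ A = 1
  card : ∀ A, A.card ≠ k → μ A = 0
  defect : ∀ A, 0 < μ A → ∀ j ≤ G.height, ∀ v, roundingDefect (G.mass z j v) (G.count A j v) = 0
  mean : ∀ j ≤ G.height, ∀ v, ∑ A, μ A * G.count A j v = G.mass z j v

/-- A distribution that rounds `z` can be moved to one that rounds `z'`, at a cost proportional to
the distance of the states. -/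
theorem IsBalanced.exists_coupling [MetricSpace X] (hμ : G.IsBalanced z k μ)
    (hG : G.IsUniform ω c') (hc : 0 < c) (hGc : ∀ x y, G.treeDist x y ≤ c * dist x y) (hk : 0 < k)
    (hz : IsFractional z k) (hz' : IsFractional z' k) :
    ∃ π : Finset X × Finset X → ℝ, (∀ p, 0 ≤ π p) ∧ (∀ A, ∑ B, π (A, B) = μ A) ∧
      G.IsBalanced z' k (fun B => ∑ A, π (A, B)) ∧
      ∑ p, π p * earthmover (serverMass p.1) (serverMass p.2) ≤ 15 * c * c' * earthmover z z' := by
  have hcpos := hG.pos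
  have hω := fun j => (hG.weight_pos j).le
  have hμ1 : ∀ A, μ A ≤ 1 := fun A => by
    rw [← hμ.sum]; exact single_le_sum (fun A _ => hμ.nonneg A) (mem_univ A)
  obtain ⟨π, hπ⟩ := exists_isOptimalCoupling (G := G) z' ω (3 * c') hμ.nonneg hμ1 hμ.card
  have hbal := fun j (hj : j ≤ G.height) => hG.isBalancedAt hz' hπ hμ.card hμ.sum hj
  have hπ1 : ∑ p, π p = 1 := by
    rw [Fintype.sum_prod_type, ← hμ.sum]
    exact sum_congr rfl fun A _ => hπ.1.2.1 A
  refine ⟨π, hπ.1.1, hπ.1.2.1, ⟨fun B => sum_nonneg fun A _ => hπ.1.1 _, ?_, fun B hB => ?_,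
    fun B hB j hj v => ?_, fun j hj v => ?_⟩, ?_⟩
  · rw [← hπ1, Fintype.sum_prod_type_right]
  · exact sum_eq_zero fun A _ => hπ.1.2.2 _ hB
  · obtain ⟨A, hA⟩ : ∃ A, 0 < π (A, B) := by
      by_contra! hcon
      exact hB.not_ge (sum_nonpos fun A _ => hcon A)
    exact (hbal j hj).defect (A, B) hA v
  · have h := (hbal j hj).excess v
    unfold excess at h
    rw [Fintype.sum_prod_type_right, sub_eq_zero] at h
    rw [← h]
    exact sum_congr rfl fun B _ => sum_mul _ _ _
  · have h1 := hπ.2 _ (diagonal_mem_couplings hμ.nonneg hμ.card)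
    have himb : ∀ A, 0 ≤ G.imbalance ω z' A := fun A =>
      sum_nonneg fun j _ => mul_nonneg (hω j) (sum_nonneg fun v _ => Nat.cast_nonneg _)
    have h2 : ∑ p, π p * earthmover (serverMass p.1) (serverMass p.2) ≤
        G.objective ω (3 * c') z' π := by
      unfold objective
      refine le_add_of_le_of_nonneg (sum_le_sum fun p _ => mul_le_mul_of_nonneg_left ?_ (hπ.1.1 p))
        (sum_nonneg fun q _ => mul_nonneg (mul_nonneg (by linarith) (hω _)) (abs_nonneg _))
      exact le_add_of_nonneg_right (mul_nonneg (by linarith) (himb _))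
    have hdiag : ∀ f : Finset X × Finset X → ℝ,
        ∑ p : Finset X × Finset X, (if p.1 = p.2 then μ p.1 else 0) * f p =
          ∑ A, μ A * f (A, A) := by
      intro f
      rw [Fintype.sum_prod_type]
      refine sum_congr rfl fun A _ => ?_
      simp [ite_mul]
    set R : ℝ := ∑ j ∈ Icc 1 G.height, ∑ v ∈ G.nodes j,
      ω j * |G.mass z' j v - G.mass z j v| with hR
    have h3 : ∑ A, μ A * G.imbalance ω z' A ≤ R := by
      unfold imbalance
      simp only [mul_sum]
      rw [sum_comm]
      refine sum_le_sum fun j hj => ?_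
      rw [sum_comm]
      refine sum_le_sum fun v _ => ?_
      have hjH := (mem_Icc.1 hj).2
      have h4 := sum_roundingDefect_le (n := fun A => G.count A j v) (G.mass z' j v) hμ.nonneg hμ.sum
        (fun A hA => hμ.defect A hA j hjH v) (hμ.mean j hjH v)
      have h5 := mul_le_mul_of_nonneg_left h4 (hω j)
      rw [mul_sum] at h5
      refine le_trans (le_of_eq ?_) h5
      exact sum_congr rfl fun A _ => by ring
    have h4 : G.objective ω (3 * c') z'
        (fun p : Finset X × Finset X => if p.1 = p.2 then μ p.1 else 0) ≤ 15 * c' * R := by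
      unfold objective excess
      simp only [hdiag]
      have h5 : ∑ A, μ A * G.roundingCost ω (3 * c') z' (A, A) =
          4 * (3 * c') * ∑ A, μ A * G.imbalance ω z' A := by
        rw [mul_sum]
        refine sum_congr rfl fun A _ => ?_
        unfold roundingCost
        dsimp only
        rw [earthmover_self (serverMass_nonneg A)]
        ring
      have h6 : ∑ q ∈ (Icc 1 G.height).sigma fun j => G.nodes j, 3 * c' * ω q.1 *
          |∑ A, μ A * G.count A q.1 q.2 - G.mass z' q.1 q.2| = 3 * c' * R := by
        rw [sum_sigma, hR, mul_sum]
        refine sum_congr rfl fun j hj => ?_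
        rw [mul_sum]
        refine sum_congr rfl fun v _ => ?_
        dsimp only
        rw [hμ.mean j (mem_Icc.1 hj).2 v, abs_sub_comm]
        ring
      rw [h5, h6]
      have := mul_le_mul_of_nonneg_left h3 (show 0 ≤ 4 * (3 * c') by linarith)
      linarith
    have h5 : R ≤ c * earthmover z z' := by
      have := sum_nodes_le_earthmover hc hGc (show (0 : ℝ) < k by exact_mod_cast hk)
        hz.nonneg hz'.nonneg hz.sum hz'.sum
      simp only [hG.weight] at this
      exact this
    have h6 := mul_le_mul_of_nonneg_left h5 (show 0 ≤ 15 * c' by linarith)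
    linarith

theorem isBalanced_serverMass {A₀ : Finset X} (hA : A₀.card = k) :
    G.IsBalanced (serverMass A₀) k (fun A => if A = A₀ then 1 else 0) := by
  refine ⟨fun A => ?_, by simp, fun A hc => ?_, fun A hpos j _ v => ?_, fun j _ v => ?_⟩
  · split_ifs <;> norm_num
  · exact if_neg fun h : A = A₀ => hc (h ▸ hA)
  · have h : A = A₀ := by by_contra h; rw [if_neg h] at hpos; exact lt_irrefl _ hpos
    rw [h, mass_serverMass, defect_eq_zero_iff]
    simp
  · simp [mass_serverMass]

/-- The leaf cluster of a point of mass 1 has floor 1, so balance at the deepest level places a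
server there surely. -/
theorem IsBalanced.mem_of_eq_one (hμ : G.IsBalanced z k μ) {A : Finset X} (hA : 0 < μ A) {r : X}
    (hr : z r = 1) : r ∈ A := by
  have h := defect_eq_zero_iff.1 (hμ.defect A hA G.height le_rfl (G.node G.height r))
  have hcl : G.cl G.height (G.node G.height r) = {r} := by
    ext x
    rw [mem_cl, mem_singleton]
    exact ⟨fun h => G.node_height h, fun h => by rw [h]⟩
  unfold mass count at h
  rw [hcl, sum_singleton, hr, Nat.floor_one] at h
  obtain ⟨x, hx⟩ := card_pos.1 (Nat.lt_of_lt_of_le Nat.one_pos h.1)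
  rw [mem_inter, mem_singleton] at hx
  exact hx.2 ▸ hx.1

end Hierarchy

/-! ## Sampling from a uniform random number -/

namespace UniformSampling

open MeasureTheory

/-- The uniform distribution on the unit interval. -/
noncomputable def law : Measure ℝ := volume.restrict (Set.Icc 0 1)

instance isProbabilityMeasure_law : IsProbabilityMeasure law :=
  ⟨by simp [law]⟩

/-- The measure of `E` up to t is 1-Lipschitz in t, so the intermediate value theorem finds the cut.
-/
theorem exists_subset_measureReal_eq {E : Set ℝ} (hE : MeasurableSet E) {w : ℝ} (hw : 0 ≤ w)
    (hwE : w ≤ law.real E) : ∃ F ⊆ E, MeasurableSet F ∧ law.real F = w := by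
  set f : ℝ → ℝ := fun t => law.real (E ∩ Set.Iic t) with hf
  have hsub : ∀ s t : ℝ, s ≤ t → f t - f s ≤ t - s ∧ 0 ≤ f t - f s := by
    intro s t hst
    have h1 : f t = f s + law.real (E ∩ Set.Ioc s t) := by
      simp only [hf]
      rw [← measureReal_union]
      · rw [← Set.inter_union_distrib_left, Set.Iic_union_Ioc_eq_Iic hst]
      · exact (Set.disjoint_left.2 fun x hx hx' => not_lt.2 hx.2 hx'.2.1)
      · exact hE.inter measurableSet_Ioc
    have h2 : law.real (E ∩ Set.Ioc s t) ≤ t - s := by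
      calc law.real (E ∩ Set.Ioc s t) ≤ law.real (Set.Ioc s t) :=
            measureReal_mono Set.inter_subset_right
        _ ≤ volume.real (Set.Ioc s t) := by
            refine ENNReal.toReal_mono (by simp) ?_
            exact Measure.restrict_apply_le _ _
        _ = t - s := by simp [Measure.real, hst]
    exact ⟨by linarith, by linarith [measureReal_nonneg (μ := law) (s := E ∩ Set.Ioc s t)]⟩
  have hcont : Continuous f := by
    refine (LipschitzWith.of_dist_le_mul (K := 1) fun s t => ?_).continuous
    rw [NNReal.coe_one, one_mul, Real.dist_eq, Real.dist_eq]
    rcases le_total s t with h | h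
    · have := hsub s t h
      rw [abs_sub_comm, abs_sub_comm s, abs_of_nonneg this.2, abs_of_nonneg (sub_nonneg.2 h)]
      exact this.1
    · have := hsub t s h
      rw [abs_of_nonneg this.2, abs_of_nonneg (sub_nonneg.2 h)]
      exact this.1
  have h0 : f (-1) = 0 := by
    simp only [hf, law, Measure.real]
    rw [Measure.restrict_apply (hE.inter measurableSet_Iic)]
    have : E ∩ Set.Iic (-1) ∩ Set.Icc 0 1 = ∅ := by
      ext x
      simp only [Set.mem_inter_iff, Set.mem_Iic, Set.mem_Icc, Set.mem_empty_iff_false, iff_false]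
      rintro ⟨⟨-, h1⟩, h2, -⟩
      linarith
    rw [this]; simp
  have h1 : f 1 = law.real E := by
    simp only [hf, law, Measure.real]
    rw [Measure.restrict_apply (hE.inter measurableSet_Iic), Measure.restrict_apply hE]
    congr 2
    ext x
    simp only [Set.mem_inter_iff, Set.mem_Iic, Set.mem_Icc]
    tauto
  obtain ⟨t, -, ht⟩ := intermediate_value_Icc (show (-1 : ℝ) ≤ 1 by norm_num) hcont.continuousOn
    (show w ∈ Set.Icc (f (-1)) (f 1) by rw [h0, h1]; exact ⟨hw, hwE⟩)
  exact ⟨E ∩ Set.Iic t, Set.inter_subset_left, hE.inter measurableSet_Iic, ht⟩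

/-- A measurable set can be divided into parts of given measures. -/
theorem exists_partition {ι : Type*} {s : Finset ι} (hs : s.Nonempty) {w : ι → ℝ}
    (hw : ∀ i, 0 ≤ w i) : ∀ {E : Set ℝ}, MeasurableSet E → ∑ i ∈ s, w i = law.real E →
      ∃ f : ℝ → ι, (∀ x, f x ∈ s) ∧ (∀ i, MeasurableSet (f ⁻¹' {i})) ∧
        ∀ i ∈ s, law.real (E ∩ f ⁻¹' {i}) = w i := by
  classical
  induction hs using Finset.Nonempty.cons_induction with
  | singleton i =>
    intro E _ hsum
    refine ⟨fun _ => i, fun _ => mem_singleton_self i, fun l => MeasurableSet.const _,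
      fun l hl => ?_⟩
    · rw [mem_singleton.1 hl]
      rw [sum_singleton] at hsum
      simp [hsum]
  | cons i s hi hs ih =>
    intro E hE hsum
    rw [sum_cons] at hsum
    obtain ⟨F, hFE, hF, hFw⟩ := exists_subset_measureReal_eq hE (hw i)
      (hsum ▸ le_add_of_nonneg_right (sum_nonneg fun l _ => hw l))
    obtain ⟨f, hfs, hfm, hf⟩ := ih (E := E \ F) (hE.diff hF) (by
      rw [measureReal_sdiff hFE hF, hFw]; linarith)
    refine ⟨fun x => if x ∈ F then i else f x, fun x => ?_, fun l => ?_, fun l hl => ?_⟩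
    · rw [mem_cons]
      dsimp only
      split_ifs
      exacts [Or.inl rfl, Or.inr (hfs x)]
    · have : (fun x => if x ∈ F then i else f x) ⁻¹' {l} =
          (F ∩ {_x | i = l}) ∪ (Fᶜ ∩ f ⁻¹' {l}) := by
        ext x
        by_cases hx : x ∈ F <;> simp [hx]
      rw [this]
      exact (hF.inter (MeasurableSet.const _)).union (hF.compl.inter (hfm l))
    · rcases mem_cons.1 hl with rfl | hl
      · rw [← hFw]
        congr 1
        ext x
        by_cases hx : x ∈ F
        · simp [hx, hFE hx]
        · have : f x ≠ l := fun h => hi (h ▸ hfs x)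
          simp [hx, this]
      · rw [← hf l hl]
        congr 1
        ext x
        have : i ≠ l := fun h => hi (h ▸ hl)
        by_cases hx : x ∈ F <;> simp [hx, this]

variable {α : Type*} [Fintype α] [DecidableEq α]

/-- The random variable `S` has distribution `μ`, and never takes a value of probability zero. -/
structure HasDistribution (S : ℝ → α) (μ : α → ℝ) : Prop where
  measurable : ∀ a, MeasurableSet (S ⁻¹' {a})
  prob : ∀ a, law.real (S ⁻¹' {a}) = μ a
  pos : ∀ x, 0 < μ (S x)

theorem sum_measureReal_inter {S : ℝ → α} (hS : ∀ a, MeasurableSet (S ⁻¹' {a})) {E : Set ℝ}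
    (hE : MeasurableSet E) : ∑ a, law.real (S ⁻¹' {a} ∩ E) = law.real E := by
  rw [← measureReal_biUnion_finset]
  · congr 1
    ext x
    simp
  · intro a _ b _ hab
    refine Set.disjoint_left.2 fun x hx hx' => hab ?_
    exact (show S x = a from hx.1).symm.trans hx'.1
  · exact fun a _ => (hS a).inter hE

/-- Couplings can be realized by random variables. -/
theorem HasDistribution.exists_coupling {S : ℝ → α} {μ : α → ℝ} (hS : HasDistribution S μ)
    {π : α × α → ℝ} (hπ : ∀ p, 0 ≤ π p) (hrow : ∀ a, ∑ b, π (a, b) = μ a) :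
    ∃ S' : ℝ → α, HasDistribution S' (fun b => ∑ a, π (a, b)) ∧
      ∀ a b, law.real (S ⁻¹' {a} ∩ S' ⁻¹' {b}) = π (a, b) := by
  have h : ∀ a, ∃ f : ℝ → α, (∀ b, MeasurableSet (f ⁻¹' {b})) ∧ (0 < μ a → ∀ x, 0 < π (a, f x)) ∧
      (0 < μ a → ∀ b, law.real (S ⁻¹' {a} ∩ f ⁻¹' {b}) = π (a, b)) := by
    intro a
    by_cases ha : 0 < μ a
    -- Only values of positive probability are used, so the new variable never takes a null value
    -- and properties of the support hold surely.
    · have hsum : ∑ b ∈ univ.filter (fun b => 0 < π (a, b)), π (a, b) = μ a := by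
        rw [← hrow a]
        refine sum_subset (subset_univ _) fun b _ hb => ?_
        rw [mem_filter, not_and] at hb
        exact le_antisymm (not_lt.1 (hb (mem_univ b))) (hπ _)
      have hne : (univ.filter fun b => 0 < π (a, b)).Nonempty := by
        rw [nonempty_iff_ne_empty]
        intro h
        rw [h, sum_empty] at hsum
        exact ha.ne hsum
      obtain ⟨f, hfs, hfm, hf⟩ := exists_partition hne (w := fun b => π (a, b)) (fun b => hπ _)
        (hS.measurable a) (hsum.trans (hS.prob a).symm)
      refine ⟨f, hfm, fun _ x => (mem_filter.1 (hfs x)).2, fun _ b => ?_⟩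
      by_cases hb : 0 < π (a, b)
      · exact hf b (mem_filter.2 ⟨mem_univ b, hb⟩)
      · rw [le_antisymm (not_lt.1 hb) (hπ _)]
        have : f ⁻¹' {b} = ∅ := by
          ext x
          simp only [Set.mem_preimage, Set.mem_singleton_iff, Set.mem_empty_iff_false, iff_false]
          rintro rfl
          exact hb (mem_filter.1 (hfs x)).2
        rw [this, Set.inter_empty, measureReal_empty]
    · exact ⟨fun _ => a, fun b => MeasurableSet.const _, fun h => absurd h ha,
        fun h => absurd h ha⟩
  choose f hfm hfpos hf using h
  -- The new variable is f (S x) x: on each event S = a it follows the subdivision of that event.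
  have hinter : ∀ a b, S ⁻¹' {a} ∩ (fun x => f (S x) x) ⁻¹' {b} = S ⁻¹' {a} ∩ f a ⁻¹' {b} := by
    intro a b
    ext x
    simp only [Set.mem_inter_iff, Set.mem_preimage, Set.mem_singleton_iff]
    constructor <;> rintro ⟨rfl, h⟩ <;> exact ⟨rfl, h⟩
  have hmeas : ∀ b, MeasurableSet ((fun x => f (S x) x) ⁻¹' {b}) := by
    intro b
    have : (fun x => f (S x) x) ⁻¹' {b} = ⋃ a, S ⁻¹' {a} ∩ f a ⁻¹' {b} := by
      ext x
      simp
    rw [this]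
    exact MeasurableSet.iUnion fun a => (hS.measurable a).inter (hfm a b)
  have hjoint : ∀ a b, law.real (S ⁻¹' {a} ∩ (fun x => f (S x) x) ⁻¹' {b}) = π (a, b) := by
    intro a b
    rw [hinter]
    by_cases ha : 0 < μ a
    · exact hf a ha b
    · have h1 : S ⁻¹' {a} = ∅ := by
        ext x
        simp only [Set.mem_preimage, Set.mem_singleton_iff, Set.mem_empty_iff_false, iff_false]
        rintro rfl
        exact ha (hS.pos x)
      have h2 : π (a, b) ≤ μ a := by
        rw [← hrow a]
        exact single_le_sum (f := fun b => π (a, b)) (fun b _ => hπ _) (mem_univ b)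
      rw [h1, Set.empty_inter, measureReal_empty]
      linarith [hπ (a, b), not_lt.1 ha]
  refine ⟨fun x => f (S x) x, ⟨hmeas, fun b => ?_, fun x => ?_⟩, hjoint⟩
  · rw [← sum_measureReal_inter hS.measurable (hmeas b)]
    exact sum_congr rfl fun a _ => hjoint a b
  · exact (hfpos _ (hS.pos x) x).trans_le
      (single_le_sum (f := fun a => π (a, f (S x) x)) (fun a _ => hπ _) (mem_univ (S x)))

theorem eq_sum_indicator (S S' : ℝ → α) (g : α × α → ℝ) : (fun x => g (S x, S' x)) =
    fun x => ∑ p : α × α, (S ⁻¹' {p.1} ∩ S' ⁻¹' {p.2}).indicator (fun _ => g p) x := by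
  ext x
  rw [Fintype.sum_eq_single (S x, S' x)]
  · rw [Set.indicator_of_mem]
    exact ⟨rfl, rfl⟩
  · rintro ⟨a, b⟩ hne
    rw [Set.indicator_of_notMem]
    rintro ⟨rfl, rfl⟩
    exact hne rfl

theorem integrable_comp {S S' : ℝ → α} (hS : ∀ a, MeasurableSet (S ⁻¹' {a}))
    (hS' : ∀ a, MeasurableSet (S' ⁻¹' {a})) (g : α × α → ℝ) :
    Integrable (fun x => g (S x, S' x)) law := by
  rw [eq_sum_indicator]
  exact integrable_finsetSum _ fun p _ =>
    (integrable_const _).indicator ((hS _).inter (hS' _))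

theorem integral_comp {S S' : ℝ → α} (hS : ∀ a, MeasurableSet (S ⁻¹' {a}))
    (hS' : ∀ a, MeasurableSet (S' ⁻¹' {a})) (g : α × α → ℝ) :
    ∫ x, g (S x, S' x) ∂law = ∑ p : α × α, law.real (S ⁻¹' {p.1} ∩ S' ⁻¹' {p.2}) * g p := by
  rw [eq_sum_indicator, integral_finsetSum]
  · exact sum_congr rfl fun p _ => by
      rw [integral_indicator_const _ ((hS _).inter (hS' _)), smul_eq_mul]
  · exact fun p _ => (integrable_const _).indicator ((hS _).inter (hS' _))

end UniformSampling

/-! ### Online rounding -/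

namespace Hierarchy

variable {X C : Type*} [Fintype X] [DecidableEq X] [DecidableEq C] [MetricSpace X]
  (G : Hierarchy X C) {k : ℕ} (Z : FractionalAlgorithm X k)

open UniformSampling MeasureTheory

/-- A random set of servers that rounds the state of `Z` after the requests in `l`. -/
def IsRounding (l : List X) (S : ℝ → Finset X) : Prop :=
  ∃ μ, G.IsBalanced (Z.state l) k μ ∧ HasDistribution S μ

/-- A move of the servers from `S` to `S'` when `r` is requested. -/
def IsRoundingStep (ρ : ℝ) (l : List X) (r : X) (S S' : ℝ → Finset X) : Prop :=
  G.IsRounding Z (l ++ [r]) S' ∧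
    ∫ x, earthmover (serverMass (S x)) (serverMass (S' x)) ∂law ≤
      ρ * earthmover (Z.state l) (Z.state (l ++ [r]))

/-- The rounded states; the most recent request comes first. -/
noncomputable def rounding (A₀ : Finset X) (ρ : ℝ) : List X → ℝ → Finset X
  | [] => fun _ => A₀
  | r :: l => open Classical in
      if h : ∃ S', G.IsRoundingStep Z ρ l.reverse r (rounding A₀ ρ l) S' then h.choose
      else rounding A₀ ρ l

variable {G Z} {ω : ℕ → ℝ} {c c' : ℝ}

theorem _root_.FractionalAlgorithm.isFractional (l : List X) : IsFractional (Z.state l) k :=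
  ⟨Z.nonneg l, Z.le_one l, Z.total l⟩

theorem IsRounding.exists_step (hG : G.IsUniform ω c') (hc : 0 < c)
    (hGc : ∀ x y, G.treeDist x y ≤ c * dist x y) (hk : 0 < k) {l : List X} {S : ℝ → Finset X}
    (hS : G.IsRounding Z l S) (r : X) : ∃ S', G.IsRoundingStep Z (15 * c * c') l r S S' := by
  obtain ⟨μ, hμ, hSμ⟩ := hS
  obtain ⟨π, hπ, hrow, hbal, hcost⟩ := hμ.exists_coupling hG hc hGc hk (Z.isFractional l)
    (Z.isFractional (l ++ [r]))
  obtain ⟨S', hS', hjoint⟩ := hSμ.exists_coupling hπ hrow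
  refine ⟨S', ⟨_, hbal, hS'⟩, le_trans (le_of_eq ?_) hcost⟩
  rw [integral_comp hSμ.measurable hS'.measurable
    fun p => earthmover (serverMass p.1) (serverMass p.2)]
  exact sum_congr rfl fun p _ => by rw [hjoint]

section

variable (hG : G.IsUniform ω c') (hc : 0 < c) (hGc : ∀ x y, G.treeDist x y ≤ c * dist x y)
  (hk : 0 < k) {A₀ : Finset X} (hA : A₀.card = k) (hZ : Z.StartsAt A₀)
include hG hc hGc hk hA hZ

/-- By induction a rounding step always exists, so the default branch of `rounding` is never taken.
-/
theorem isRounding_rounding (l : List X) :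
    G.IsRounding Z l.reverse (G.rounding Z A₀ (15 * c * c') l) := by
  induction l with
  | nil =>
    refine ⟨fun A => if A = A₀ then 1 else 0, ?_, ?_⟩
    · rw [List.reverse_nil, hZ]
      exact isBalanced_serverMass hA
    · refine ⟨fun A => MeasurableSet.const (A₀ = A), fun A => ?_, fun x => by simp [rounding]⟩
      by_cases h : A = A₀
      · subst h; simp [rounding]
      · have : A₀ ≠ A := fun h' => h h'.symm
        simp [rounding, h, this]
  | cons r l ih =>
    have h := ih.exists_step hG hc hGc hk r
    rw [List.reverse_cons, rounding, dif_pos h]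
    exact h.choose_spec.1

theorem rounding_cost_le (l : List X) (r : X) :
    ∫ x, earthmover (serverMass (G.rounding Z A₀ (15 * c * c') l.reverse x))
      (serverMass (G.rounding Z A₀ (15 * c * c') (l ++ [r]).reverse x)) ∂law ≤
      15 * c * c' * earthmover (Z.state l) (Z.state (l ++ [r])) := by
  have h := (isRounding_rounding hG hc hGc hk hA hZ l.reverse).exists_step hG hc hGc hk r
  have h1 := h.choose_spec.2
  rw [List.reverse_append, List.reverse_singleton, List.singleton_append]
  simp only [rounding]
  rw [dif_pos h]
  exact h1.trans (le_of_eq (by rw [List.reverse_reverse]))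

/-- Fractional algorithms can be rounded online. -/
theorem exists_randomizedAlgorithm : ∃ R : RandomizedAlgorithm X k, R.StartsAt A₀ ∧
    ∀ (r : ℕ → X) (n : ℕ), R.expectedCost r n ≤ 15 * c * c' * Z.cost r n := by
  have hR := isRounding_rounding hG hc hGc hk hA hZ
  have hmeas : ∀ (l : List X) S,
      MeasurableSet (G.rounding Z A₀ (15 * c * c') l.reverse ⁻¹' {S}) := fun l S => by
    obtain ⟨μ, -, h⟩ := hR l.reverse
    exact h.measurable S
  refine ⟨⟨ℝ, inferInstance, law, inferInstance,
    fun x l => G.rounding Z A₀ (15 * c * c') l.reverse x, hmeas, fun x l => ?_, fun x l r => ?_⟩,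
    fun x => rfl, fun r n => ?_⟩
  · obtain ⟨μ, hμ, h⟩ := hR l.reverse
    by_contra hcard
    exact (h.pos x).ne' (hμ.card _ hcard)
  · obtain ⟨μ, hμ, h⟩ := hR (l ++ [r]).reverse
    rw [List.reverse_reverse] at hμ
    exact hμ.mem_of_eq_one (h.pos x) (Z.serves l r)
  · unfold RandomizedAlgorithm.expectedCost FractionalAlgorithm.cost movementCost
    dsimp only
    rw [integral_finsetSum]
    · rw [mul_sum]
      refine sum_le_sum fun t _ => ?_
      rw [requestHistory_succ]
      exact rounding_cost_le hG hc hGc hk hA hZ _ _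
    · exact fun t _ => integrable_comp (hmeas _) (hmeas _)
        fun p => earthmover (serverMass p.1) (serverMass p.2)

end

end Hierarchy

/-! ## The main theorem -/

theorem movementCost_nonneg {X : Type*} [Fintype X] [MetricSpace X] (s : ℕ → X → ℝ) (T : ℕ) :
    0 ≤ movementCost s T := sum_nonneg fun _ _ => earthmover_nonneg _ _

theorem FractionalAlgorithm.IsCompetitive.mono {X : Type*} [Fintype X] [DecidableEq X]
    [MetricSpace X] {k h : ℕ} {Z : FractionalAlgorithm X k} {ρ ρ' c c' : ℝ}
    (hZ : Z.IsCompetitive h ρ c) (hρ : ρ ≤ ρ') (hc : c ≤ c') : Z.IsCompetitive h ρ' c' :=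
  fun r T B hB => (hZ r T B hB).trans
    (add_le_add (mul_le_mul_of_nonneg_right hρ (movementCost_nonneg _ _)) hc)

/-- The number of servers of the adversary can be assumed to be at least `k / 2`. -/
theorem exists_comparison {h k : ℕ} {ε : ℝ} (hh : 1 ≤ h) (hε : 0 < ε) (hk : (k : ℝ) / h = 1 + ε) :
    2 ≤ k ∧ ∃ κ : ℕ, h ≤ κ ∧ κ < k ∧ k ≤ 2 * κ ∧
      Real.log (1 + 1 / (1 - κ / k)) ≤ 2 * Real.log (2 + 1 / ε) := by
  have hh0 : (0 : ℝ) < h := by exact_mod_cast hh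
  have hkh : (k : ℝ) = h * (1 + ε) := by field_simp at hk; linarith
  have hlt : h < k := by
    have : (h : ℝ) < k := by nlinarith
    exact_mod_cast this
  have hk2 : 2 ≤ k := by omega
  have hk0 : (0 : ℝ) < k := by exact_mod_cast (by omega : 0 < k)
  have hε' : 0 < 1 / ε := by positivity
  -- The rounded-up half of k keeps the scaling factor k/κ at most 2 when h is small; it is below k
  -- because k ≥ 2.
  refine ⟨hk2, max h ((k + 1) / 2), le_max_left _ _, by omega, by omega, ?_⟩
  have hlog : Real.log 2 ≤ Real.log (2 + 1 / ε) := Real.log_le_log two_pos (by linarith)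
  have hlog2 : 0 < Real.log 2 := Real.log_pos one_lt_two
  rcases le_total ((k + 1) / 2) h with hle | hle
  · rw [max_eq_left hle]
    have : 1 + 1 / (1 - (h : ℝ) / k) = 2 + 1 / ε := by
      have h1 : (h : ℝ) / k = 1 / (1 + ε) := by
        rw [hkh]; field_simp
      have h2 : 1 - 1 / (1 + ε) = ε / (1 + ε) := by field_simp; ring
      rw [h1, h2]; field_simp; ring
    rw [this]
    linarith
  · rw [max_eq_right hle]
    -- For k ≥ 2 this gives τ ≥ 1/3, so 1 + 1/τ ≤ 4 = 2², the source of the factor 2 in front of the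
    -- logarithm.
    have h1 : 3 * (((k + 1) / 2 : ℕ) : ℝ) ≤ 2 * k := by
      have : 3 * ((k + 1) / 2) ≤ 2 * k := by omega
      exact_mod_cast this
    have h2 : (1 : ℝ) / 3 ≤ 1 - (((k + 1) / 2 : ℕ) : ℝ) / k := by
      have : (((k + 1) / 2 : ℕ) : ℝ) / k ≤ 2 / 3 := by
        rw [div_le_iff₀ hk0]; linarith
      linarith
    have h3 : 1 / (1 - (((k + 1) / 2 : ℕ) : ℝ) / k) ≤ 3 := by
      rw [div_le_iff₀ (by linarith)]; linarith
    have h4 : 0 < 1 / (1 - (((k + 1) / 2 : ℕ) : ℝ) / k) := by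
      have : 0 < 1 - (((k + 1) / 2 : ℕ) : ℝ) / k := by linarith
      positivity
    have h5 : Real.log (1 + 1 / (1 - (((k + 1) / 2 : ℕ) : ℝ) / k)) ≤ Real.log (2 ^ 2) :=
      Real.log_le_log (by linarith) (by linarith)
    rw [Real.log_pow] at h5
    push_cast at h5
    linarith

namespace WeightedTree

variable {X : Type*} [Fintype X] [DecidableEq X] [MetricSpace X] {V : Type*} [Finite V]
  {T : WeightedTree V} {φ : X → V}

theorem Realizes.exists_fractionalAlgorithm (hφ : T.Realizes φ) {h k : ℕ} {ε : ℝ} (hh : 1 ≤ h)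
    (hkX : k ≤ Fintype.card X) (hε : 0 < ε) (hk : (k : ℝ) / h = 1 + ε) :
    ∃ C' : ℝ, ∀ A₀ : Finset X, A₀.card = k → ∃ Z : FractionalAlgorithm X k, Z.StartsAt A₀ ∧
      Z.IsCompetitive h (128 * (T.graph.diam * Real.log (2 + 1 / ε))) C' := by
  classical
  obtain ⟨hk2, κ, hhκ, hκ, hκ2, hlog⟩ := exists_comparison hh hε hk
  have : Nontrivial X := Fintype.one_lt_card_iff_nontrivial.1 (by omega)
  obtain ⟨G, hheight, hG, hG'⟩ := hφ.exists_hierarchy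
  have hP : Hierarchy.Params G k κ (1 - κ / k) :=
    ⟨by omega, by omega, hκ, hkX, hκ2, rfl⟩
  obtain ⟨C', hC'⟩ := hP.competitive_height two_pos zero_le_one hG hG' hh hhκ
  refine ⟨C', fun A₀ hA => ⟨hP.algorithm A₀ hA, rfl, (hC' A₀ hA).mono ?_ le_rfl⟩⟩
  have hd : (1 : ℝ) ≤ T.graph.diam := by exact_mod_cast hφ.one_le_diam
  have hL : 0 ≤ Real.log (2 + 1 / ε) := Real.log_nonneg (by
    have : 0 < 1 / ε := by positivity
    linarith)
  rw [hheight]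
  push_cast
  have h1 := mul_le_mul_of_nonneg_left hlog (show 0 ≤ 32 * ((T.graph.diam : ℝ) + 1) by positivity)
  have h2 := mul_le_mul_of_nonneg_right hd hL
  linarith

theorem Realizes.exists_hst_algorithms (hφ : T.Realizes φ) {root : V} {τ : ℝ} (hτ : 1 < τ)
    (hT : T.IsHST root τ) {h k : ℕ} {ε : ℝ} (hh : 1 ≤ h)
    (hkX : k ≤ Fintype.card X) (hε : 0 < ε) (hk : (k : ℝ) / h = 1 + ε) {c : ℝ}
    (hcτ : c = 64 * (τ / (τ - 1))) :
    (∃ C' : ℝ, ∀ A₀ : Finset X, A₀.card = k → ∃ Z : FractionalAlgorithm X k, Z.StartsAt A₀ ∧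
      Z.IsCompetitive h
        (2560 * c * (min (T.graph.diam : ℝ) (Real.log k) * Real.log (2 + 1 / ε))) C') ∧
    ∀ (A₀ : Finset X) (Z : FractionalAlgorithm X k), A₀.card = k → Z.StartsAt A₀ →
      ∃ R : RandomizedAlgorithm X k, R.StartsAt A₀ ∧
        ∀ (r : ℕ → X) (n : ℕ), R.expectedCost r n ≤ 60 * c * Z.cost r n := by
  classical
  have hc1 : 1 ≤ c := by
    have : 1 ≤ τ / (τ - 1) := (one_le_div (by linarith)).2 (by linarith)
    linarith
  obtain ⟨hk2, κ, hhκ, hκ, hκ2, hlog⟩ := exists_comparison hh hε hk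
  have : Nontrivial X := Fintype.one_lt_card_iff_nontrivial.1 (by omega)
  have hL : 0 ≤ Real.log (2 + 1 / ε) := Real.log_nonneg (by
    have : 0 < 1 / ε := by positivity
    linarith)
  obtain ⟨G, ω, hheight, hweight, hω, hG, hG'⟩ := hφ.exists_uniform_hierarchy hτ hT
  rw [← hcτ] at hG'
  have hωpos : ∀ j, 0 < ω j := fun j => by rw [← hweight j ∅]; exact G.weight_pos _ _
  have hP : Hierarchy.Params G k κ (1 - κ / k) := ⟨hheight, by omega, hκ, hkX, hκ2, rfl⟩
  refine ⟨?_, fun A₀ Z hA hZ => ?_⟩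
  -- The algorithm is chosen in advance: the tree's own hierarchy if D is smaller, the uniform one
  -- otherwise. The rounding uses the uniform hierarchy in either case.
  · rcases le_total (T.graph.diam : ℝ) (Real.log k) with hle | hle
    · rw [min_eq_left hle]
      obtain ⟨C', hC'⟩ := hφ.exists_fractionalAlgorithm hh hkX hε hk
      refine ⟨C', fun A₀ hA => ?_⟩
      obtain ⟨Z, hZ, hZc⟩ := hC' A₀ hA
      refine ⟨Z, hZ, hZc.mono (mul_le_mul_of_nonneg_right ?_ (by positivity)) le_rfl⟩
      linarith
    · rw [min_eq_right hle]
      obtain ⟨C', hC'⟩ := hP.competitive_log four_pos (by linarith) hG hG' hweight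
        (fun j => by linarith [hω j, hωpos (j + 1)]) hh hhκ
      refine ⟨C', fun A₀ hA => ⟨hP.algorithm A₀ hA, rfl, (hC' A₀ hA).mono ?_ le_rfl⟩⟩
      have hlogk : 0 ≤ Real.log k := Real.log_nonneg (by
        have : (2 : ℝ) ≤ k := by exact_mod_cast hk2
        linarith)
      have := mul_le_mul_of_nonneg_left hlog (show 0 ≤ 1280 * c * Real.log k by positivity)
      linarith
  · obtain ⟨R, hR, hcost⟩ := Hierarchy.exists_randomizedAlgorithm
      (G := G) ⟨by linarith, hG', hweight, hωpos, hω⟩ four_pos hG (by omega) hA hZ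
    refine ⟨R, hR, fun r n => (hcost r n).trans (le_of_eq ?_)⟩
    ring

end WeightedTree

end

theorem mainTheorem6 :
    -- trees: a deterministic fractional algorithm, `C` is an absolute constant
    (∃ C : ℝ, 0 < C ∧
      ∀ (X : Type*) [Fintype X] [DecidableEq X] [MetricSpace X] (V : Type*) [Finite V]
        (T : WeightedTree V) (φ : X → V), T.Realizes φ →
      ∀ (h k : ℕ) (ε : ℝ), 1 ≤ h → k ≤ Fintype.card X → 0 < ε → (k : ℝ) / h = 1 + ε →
      ∃ C' : ℝ, ∀ A₀ : Finset X, A₀.card = k →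
        ∃ Z : FractionalAlgorithm X k, Z.StartsAt A₀ ∧
          Z.IsCompetitive h (C * (T.graph.diam * Real.log (2 + 1 / ε))) C') ∧
    -- HSTs: a deterministic fractional algorithm and a randomized rounding of it,
    -- `C` depends on the separation `τ` only
    (∀ τ : ℝ, 1 < τ → ∃ C : ℝ, 0 < C ∧
      ∀ (X : Type*) [Fintype X] [DecidableEq X] [MetricSpace X] (V : Type*) [Finite V]
        (T : WeightedTree V) (root : V) (φ : X → V), T.Realizes φ →
        T.IsHST root τ → Set.range φ = T.leaves root →
      ∀ (h k : ℕ) (ε : ℝ), 1 ≤ h → k ≤ Fintype.card X → 0 < ε → (k : ℝ) / h = 1 + ε →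
      ∃ C' : ℝ, ∀ A₀ : Finset X, A₀.card = k →
        ∃ Z : FractionalAlgorithm X k, Z.StartsAt A₀ ∧
          Z.IsCompetitive h
            (C * (min (T.graph.diam : ℝ) (Real.log k) * Real.log (2 + 1 / ε))) C' ∧
          ∃ R : RandomizedAlgorithm X k, R.StartsAt A₀ ∧
            (∀ (r : ℕ → X) (n : ℕ), R.expectedCost r n ≤ C * Z.cost r n) ∧
            R.IsCompetitive h
              (C * (min (T.graph.diam : ℝ) (Real.log k) * Real.log (2 + 1 / ε))) C') := by
  refine ⟨⟨128, by norm_num, fun X _ _ _ V _ T φ hφ h k ε hh hkX hε hk =>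
    hφ.exists_fractionalAlgorithm hh hkX hε hk⟩, fun τ hτ => ?_⟩
  have hc1 : 1 ≤ 64 * (τ / (τ - 1)) := by
    have : 1 ≤ τ / (τ - 1) := (one_le_div (by linarith)).2 (by linarith)
    linarith
  obtain ⟨c, hc⟩ : ∃ c, c = 64 * (τ / (τ - 1)) := ⟨_, rfl⟩
  rw [← hc] at hc1
  have hC : 0 < 60 * c * (2560 * c) := by positivity
  -- The rounding loss times the fractional ratio; since c ≥ 1, this one constant also bounds each
  -- factor.
  refine ⟨60 * c * (2560 * c), hC,
    fun X _ _ _ V _ T root φ hφ hT _ h k ε hh hkX hε hk => ?_⟩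
  obtain ⟨⟨C', hZ⟩, hR⟩ := hφ.exists_hst_algorithms hτ hT hh hkX hε hk hc
  -- The absolute value makes one additive term dominate both `C'` and its multiple by the rounding
  -- loss.
  refine ⟨60 * c * |C'|, fun A₀ hA => ?_⟩
  obtain ⟨Z, hZA, hZc⟩ := hZ A₀ hA
  obtain ⟨R, hRA, hRc⟩ := hR A₀ Z hA hZA
  set D := min (T.graph.diam : ℝ) (Real.log k) * Real.log (2 + 1 / ε) with hD
  have hD0 : 0 ≤ D := by
    have hk2 := (exists_comparison hh hε hk).1
    have hk2' : (2 : ℝ) ≤ k := by exact_mod_cast hk2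
    have : 0 < 1 / ε := by positivity
    exact mul_nonneg (le_min (Nat.cast_nonneg _) (Real.log_nonneg (by linarith)))
      (Real.log_nonneg (by linarith))
  refine ⟨Z, hZA, hZc.mono ?_ ?_, R, hRA, fun r n => (hRc r n).trans ?_, fun r n B hB => ?_⟩
  · refine mul_le_mul_of_nonneg_right ?_ hD0
    nlinarith
  · exact (le_abs_self C').trans (le_mul_of_one_le_left (abs_nonneg _) (by linarith))
  · refine mul_le_mul_of_nonneg_right ?_ (movementCost_nonneg _ _)
    nlinarith
  · have h1 := mul_le_mul_of_nonneg_left (hZc r n B hB) (show 0 ≤ 60 * c by linarith)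
    have h2 := mul_le_mul_of_nonneg_left (le_abs_self C') (show 0 ≤ 60 * c by linarith)
    calc R.expectedCost r n ≤ _ := hRc r n
      _ ≤ _ := h1
      _ = 60 * c * (2560 * c) * D * movementCost (fun t => serverMass (B t)) n + 60 * c * C' := by
        ring
      _ ≤ _ := add_le_add le_rfl h2
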